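/- Let $\square$ be the category whose objects are the posets $[1]^n=\{0\le 1\}^n$, $n\ge 0$, and whose maps are generated under composition by the faces $\partial_{i,\varepsilon}:[1]^{n}\to[1]^{n+1}$ (insert $\varepsilon\in\{0,1\}$ as $i$-th coordinate), the degeneracies (forget the $i$-th coordinate) and the negative connections (replace the coordinates $x_i,x_{i+1}$ by $\max(x_i,x_{i+1})$). A cubical set is a presheaf of sets on $\square$; $\square^n$ is the presheaf represented by $[1]^n$, and $S_0$ is the set of vertices of a cubical set $S$. For a cubical set $S$ with two vertices $a,b$ write $S_{a,b}$ for the corresponding double pointed cubical set; $\square^n$ is double pointed by its least and greatest vertices. For double pointed $X$, $Y$, let $X\vee Y$ be obtained by gluing the second point of $X$ to the first point of $Y$, double pointed by the first point of $X$ and the second point of $Y$; for $f:X\to S_{a,b}$ and $g:Y\to S_{b,c}$ let $f*g:X\vee Y\to S_{a,c}$ be the induced map. Let $I_n=\square^1\vee\dots\vee\square^1$ ($n$ factors, $I_0=\square^0$). *Path category.* For a cubical set $S$, $\mathfrak C^\square_{path}(S)$ is the category enriched in preordered sets with object set $S_0$ and $$\mathfrak C^\square_{path}(S)(a,b)=\Big(\coprod_{n\ge0}\mathrm{Hom}(I_n,S_{a,b})\Big)\big/\sim,$$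 where $\sim$ is the equivalence relation generated by $\gamma\circ\varphi\sim\gamma$ for maps of double pointed cubical sets $\varphi:I_n\to I_m$ and $\gamma:I_m\to S_{a,b}$; composition is concatenation. The preorder is the reflexive transitive closure of the relation $[f\circ(\mathrm{id}\vee s\vee\mathrm{id})]\rightsquigarrow[f\circ(\mathrm{id}\vee t\vee\mathrm{id})]$, for $k,j\ge0$ and $f:I_k\vee\square^2\vee I_j\to S_{a,b}$, where $s=\partial_{1,0}*\partial_{2,1}$ and $t=\partial_{2,0}*\partial_{1,1}$ are maps $I_2\to\square^2$. *Rigidification.* Let $N$ be the functor from categories enriched in preordered sets to simplicial categories which takes the nerve of each hom-preorder. The functor $\mathfrak C^\square$ from cubical sets to simplicial categories is the left Kan extension along the Yoneda embedding of $[1]^n\mapsto N(\mathfrak C^\square_{path}(\square^n))$. Each vertex of $S$ gives an object of $\mathfrak C^\square(S)$ (the image of the unique object of $\mathfrak C^\square(\square^0)$), and $\mathfrak C^\square_t(S_{a,b}):=\mathfrak C^\square(S)(a,b)$. There is a unique natural transformation $\mathfrak C^\square\to N\circ\mathfrak C^\square_{path}$ extending the identity on the standard cubes. *Necklaces.* A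 necklace is a double pointed cubical set isomorphic to $\square^{n_1}\vee\dots\vee\square^{n_k}$ with $k\ge 0$ and all $n_i\ge 1$ (it is $\square^0$ for $k=0$). Its vertices are ordered by $\preccurlyeq$: the product order on the vertices of each $\square^{n_i}$, with all the vertices of $\square^{n_i}$ below all those of $\square^{n_j}$ if $i<j$. **Theorem.** 1. For every necklace $T$, the hom-preorders of $\mathfrak C^\square_{path}(T)$ are partial orders, and the canonical simplicial functor $\mathfrak C^\square(T)\to N(\mathfrak C^\square_{path}(T))$ is an isomorphism of simplicial categories. 2. If $T=U\vee V$ with $U,V$ necklaces, the map of simplicial sets $$\mathfrak C^\square_t(V)\times\mathfrak C^\square_t(U)\longrightarrow\mathfrak C^\square_t(T)$$ induced by the inclusions $U\to T$, $V\to T$ and the composition of $\mathfrak C^\square(T)$ is an isomorphism. 3. For every necklace $T$ and all vertices $a\preccurlyeq b$ of $T$, the simplicial set $\mathfrak C^\square(T)(a,b)$ is contractible, i.e. the constant map at some vertex of it is simplicially homotopic to its identity; in particular $\mathfrak C^\square_t(T)$ is contractible. -/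

import Mathlib

open CategoryTheory MonoidalCategory Opposite Limits


/-- The category of small simplicial categories, i.e. categories enriched in simplicial sets. -/
structure SCat where
  carrier : Type
  [str : EnrichedCategory SSet.{0} carrier]

namespace SCat

instance : CoeSort SCat Type := ⟨SCat.carrier⟩

instance (C : SCat) : EnrichedCategory SSet.{0} C := C.str

instance : Category SCat where
  Hom C D := EnrichedFunctor SSet.{0} C D
  id C := EnrichedFunctor.id SSet.{0} C
  comp F G := EnrichedFunctor.comp SSet.{0} F G
  id_comp _ := EnrichedFunctor.ext _ (fun _ => rfl)
    (fun _ _ => (Category.comp_id _).trans (Category.id_comp _))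
  comp_id _ := EnrichedFunctor.ext _ (fun _ => rfl)
    (fun _ _ => (Category.comp_id _).trans (Category.comp_id _))
  assoc _ _ _ := EnrichedFunctor.ext _ (fun _ => rfl)
    (fun _ _ => (Category.comp_id _).trans (Category.assoc _ _ _))

/-- The mapping space `C(x, y)`. -/
abbrev Map (C : SCat) (x y : C) : SSet.{0} := EnrichedCategory.Hom x y

variable {C D E : SCat}

/-- The effect of a simplicial functor on objects. -/
abbrev onObj (F : C ⟶ D) (x : C) : D := EnrichedFunctor.obj F x

/-- The effect of a simplicial functor on mapping spaces. -/
abbrev onMap (F : C ⟶ D) (x y : C) : C.Map x y ⟶ D.Map (onObj F x) (onObj F y) :=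
  EnrichedFunctor.map F x y

section elements

variable {n m : SimplexCategoryᵒᵖ}

/-- The `n`-simplex of a product given by two `n`-simplices. -/
def pr {A B : SSet.{0}} (f : A.obj n) (g : B.obj n) : (A ⊗ B).obj n := (f, g)

/-- The identity of `x`, as a (degenerate) `n`-simplex of `C(x, x)`. -/
def one (n : SimplexCategoryᵒᵖ) (x : C) : (C.Map x x).obj n :=
  (eId SSet.{0} x).app n PUnit.unit

/-- The composite of two `n`-simplices of mapping spaces. -/
def mul {x y z : C} (f : (C.Map x y).obj n) (g : (C.Map y z).obj n) : (C.Map x z).obj n :=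
  (eComp SSet.{0} x y z).app n (pr f g)

lemma one_mul {x y : C} (f : (C.Map x y).obj n) : mul (one n x) f = f :=
  types_congr_hom (congr_app (e_id_comp SSet.{0} x y) n) f

lemma mul_one {x y : C} (f : (C.Map x y).obj n) : mul f (one n y) = f :=
  types_congr_hom (congr_app (e_comp_id SSet.{0} x y) n) f

lemma mul_assoc {w x y z : C} (f : (C.Map w x).obj n) (g : (C.Map x y).obj n)
    (h : (C.Map y z).obj n) : mul (mul f g) h = mul f (mul g h) :=
  types_congr_hom (congr_app (e_assoc SSet.{0} w x y z) n)
    (pr f (pr g h))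

lemma map_one (θ : n ⟶ m) (x : C) : (C.Map x x).map θ (one n x) = one m x :=
  (NatTrans.naturality_apply (eId SSet.{0} x) θ PUnit.unit).symm

lemma map_mul (θ : n ⟶ m) {x y z : C} (f : (C.Map x y).obj n) (g : (C.Map y z).obj n) :
    (C.Map x z).map θ (mul f g) = mul ((C.Map x y).map θ f) ((C.Map y z).map θ g) :=
  (NatTrans.naturality_apply (eComp SSet.{0} x y z) θ
    (pr (A := C.Map x y) (B := C.Map y z) f g)).symm

lemma onMap_one (F : C ⟶ D) (x : C) : (onMap F x x).app n (one n x) = one n (onObj F x) :=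
  types_congr_hom (congr_app (EnrichedFunctor.map_id F x) n) PUnit.unit

lemma onMap_mul (F : C ⟶ D) {x y z : C} (f : (C.Map x y).obj n) (g : (C.Map y z).obj n) :
    (onMap F x z).app n (mul f g) = mul ((onMap F x y).app n f) ((onMap F y z).app n g) :=
  types_congr_hom (congr_app (EnrichedFunctor.map_comp F x y z) n)
    (pr f g)


/-- Transport of simplices of mapping spaces along equalities of objects. -/
def tr {x x' y y' : C} (hx : x = x') (hy : y = y') (f : (C.Map x y).obj n) :
    (C.Map x' y').obj n := by
  subst hx hy; exact f

lemma tr_map (θ : n ⟶ m) {x x' y y' : C} (hx : x = x') (hy : y = y') (f : (C.Map x y).obj n) :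
    (C.Map x' y').map θ (tr hx hy f) = tr hx hy ((C.Map x y).map θ f) := by
  subst hx hy; rfl

lemma tr_one {x x' : C} (hx : x = x') : tr hx hx (one n x) = one n x' := by
  subst hx; rfl

lemma tr_mul {x x' y y' z z' : C} (hx : x = x') (hy : y = y') (hz : z = z')
    (f : (C.Map x y).obj n) (g : (C.Map y z).obj n) :
    tr hx hz (mul f g) = mul (tr hx hy f) (tr hy hz g) := by
  subst hx hy hz; rfl

lemma tr_tr {x x' x'' y y' y'' : C} (hx : x = x') (hy : y = y') (hx' : x' = x'')
    (hy' : y' = y'') (f : (C.Map x y).obj n) :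
    tr hx' hy' (tr hx hy f) = tr (hx.trans hx') (hy.trans hy') f := by
  subst hx hy hx' hy'; rfl

lemma onMap_tr (F : C ⟶ D) {x x' y y' : C} (hx : x = x') (hy : y = y')
    (f : (C.Map x y).obj n) :
    (onMap F x' y').app n (tr hx hy f) =
      tr (congrArg (onObj F) hx) (congrArg (onObj F) hy) ((onMap F x y).app n f) := by
  subst hx hy; rfl

lemma onMap_congr {F G : C ⟶ D} (h : F = G) {x y : C} (f : (C.Map x y).obj n) :
    tr (by rw [h]) (by rw [h]) ((onMap F x y).app n f) = (onMap G x y).app n f := by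
  subst h; rfl

lemma functor_ext {F G : C ⟶ D} (hobj : ∀ x, onObj F x = onObj G x)
    (hmap : ∀ (n : SimplexCategoryᵒᵖ) (x y : C) (f : (C.Map x y).obj n),
      tr (hobj x) (hobj y) ((onMap F x y).app n f) = (onMap G x y).app n f) : F = G := by
  refine EnrichedFunctor.ext _ hobj (fun x y => ?_)
  have key : ∀ (a b c d : D) (h : a = c) (k : b = d) (φ : C.Map x y ⟶ D.Map a b)
      (ψ : C.Map x y ⟶ D.Map c d), (∀ n f, tr h k (φ.app n f) = ψ.app n f) →
      ∀ e : D.Map a b = D.Map c d, φ ≫ eqToHom e = ψ := by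
    rintro a b c d rfl rfl φ ψ H e
    refine (Category.comp_id _).trans ?_
    ext n f
    exact H n f
  exact key _ _ _ _ (hobj x) (hobj y) _ _ (fun n f => hmap n x y f) _

end elements

/-! ### Colimits of simplicial categories

The colimit of a diagram `F` has as objects the colimit of the sets of objects, and the
`n`-simplices of its mapping spaces are formal composites of `n`-simplices of mapping spaces of
the `F j`, modulo the evident relations. -/

namespace Colim

variable {J : Type} [Category.{0} J] (F : J ⥤ SCat)

/-- The objects of the colimit. -/
def Ob : Type :=
  Quot (fun p q : (Σ j, (F.obj j).carrier) =>
    ∃ u : p.1 ⟶ q.1, onObj (F.map u) p.2 = q.2)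

variable {F}

def ob (j : J) (x : F.obj j) : Ob F := Quot.mk _ ⟨j, x⟩

lemma ob_map {j k : J} (u : j ⟶ k) (x : F.obj j) :
    ob k (onObj (F.map u) x) = ob j x :=
  (Quot.sound ⟨u, rfl⟩).symm

variable (F) in
/-- Formal composites of `n`-simplices. -/
inductive Word (n : SimplexCategoryᵒᵖ) : Ob F → Ob F → Type
  | of {a b : Ob F} (j : J) (x y : F.obj j) (hx : ob j x = a) (hy : ob j y = b)
      (f : ((F.obj j).Map x y).obj n) : Word n a b
  | one (a : Ob F) : Word n a a
  | mul {a b c : Ob F} (v : Word n a b) (w : Word n b c) : Word n a c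

/-- The relations between formal composites. -/
inductive Rel (n : SimplexCategoryᵒᵖ) : ∀ {a b : Ob F}, Word F n a b → Word F n a b → Prop
  | map {a b : Ob F} {j k : J} (u : j ⟶ k) (x y : F.obj j) (hx : ob j x = a) (hy : ob j y = b)
      (f : ((F.obj j).Map x y).obj n) :
      Rel n (.of j x y hx hy f)
        (.of k (onObj (F.map u) x) (onObj (F.map u) y) ((ob_map u x).trans hx)
          ((ob_map u y).trans hy) ((onMap (F.map u) x y).app n f))
  | of_one {a : Ob F} (j : J) (x : F.obj j) (hx : ob j x = a) :
      Rel n (.of j x x hx hx (SCat.one n x)) (.one a)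
  | of_mul {a b c : Ob F} (j : J) (x y z : F.obj j) (hx : ob j x = a) (hy : ob j y = b)
      (hz : ob j z = c) (f : ((F.obj j).Map x y).obj n) (g : ((F.obj j).Map y z).obj n) :
      Rel n (.of j x z hx hz (SCat.mul f g)) (.mul (.of j x y hx hy f) (.of j y z hy hz g))
  | one_mul {a b : Ob F} (w : Word F n a b) : Rel n (.mul (.one a) w) w
  | mul_one {a b : Ob F} (w : Word F n a b) : Rel n (.mul w (.one b)) w
  | assoc {a b c d : Ob F} (u : Word F n a b) (v : Word F n b c) (w : Word F n c d) :
      Rel n (.mul (.mul u v) w) (.mul u (.mul v w))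
  | left {a b c : Ob F} {v v' : Word F n a b} (w : Word F n b c) (h : Rel n v v') :
      Rel n (.mul v w) (.mul v' w)
  | right {a b c : Ob F} (v : Word F n a b) {w w' : Word F n b c} (h : Rel n w w') :
      Rel n (.mul v w) (.mul v w')

/-- The simplicial operators on formal composites. -/
def Word.map {n m : SimplexCategoryᵒᵖ} (θ : n ⟶ m) {a b : Ob F} : Word F n a b → Word F m a b
  | .of j x y hx hy f => .of j x y hx hy (((F.obj j).Map x y).map θ f)
  | .one a => .one a
  | .mul v w => .mul (v.map θ) (w.map θ)

lemma Word.map_id {n : SimplexCategoryᵒᵖ} {a b : Ob F} (w : Word F n a b) :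
    w.map (𝟙 n) = w := by
  induction w with
  | of j x y hx hy f => simp [Word.map]
  | one a => rfl
  | mul v w hv hw => simp [Word.map, hv, hw]

lemma Word.map_comp {n m k : SimplexCategoryᵒᵖ} (θ : n ⟶ m) (η : m ⟶ k) {a b : Ob F}
    (w : Word F n a b) : w.map (θ ≫ η) = (w.map θ).map η := by
  induction w with
  | of j x y hx hy f => simp [Word.map]
  | one a => rfl
  | mul v w hv hw => simp [Word.map, hv, hw]

lemma Rel.map_word {n m : SimplexCategoryᵒᵖ} (θ : n ⟶ m) {a b : Ob F} {v w : Word F n a b}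
    (h : Rel n v w) : Rel m (v.map θ) (w.map θ) := by
  induction h with
  | map u x y hx hy f =>
    have := NatTrans.naturality_apply (onMap (F.map u) x y) θ f
    simp only [Word.map]
    rw [← this]
    exact .map u x y hx hy _
  | of_one j x hx =>
    simp only [Word.map]
    rw [SCat.map_one]
    exact .of_one j x hx
  | of_mul j x y z hx hy hz f g =>
    simp only [Word.map]
    rw [SCat.map_mul]
    exact .of_mul j x y z hx hy hz _ _
  | one_mul w => exact .one_mul _
  | mul_one w => exact .mul_one _
  | assoc u v w => exact .assoc _ _ _
  | left w h ih => exact .left _ ih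
  | right v h ih => exact .right _ ih

variable (F) in
/-- The mapping spaces of the colimit. -/
def Mor (a b : Ob F) : SSet.{0} where
  obj n := Quot (Rel (F := F) n (a := a) (b := b))
  map θ := ↾(Quot.map (Word.map θ) (fun _ _ h => h.map_word θ))
  map_id n := by
    ext w
    obtain ⟨w⟩ := w
    exact congrArg (Quot.mk _) w.map_id
  map_comp θ η := by
    ext w
    obtain ⟨w⟩ := w
    exact congrArg (Quot.mk _) (w.map_comp θ η)

variable (F) in
/-- The colimit simplicial category. -/
def pt : SCat where
  carrier := Ob F
  str :=
  { Hom := Mor F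
    id a :=
      { app n := ↾(fun _ => Quot.mk _ (Word.one a))
        naturality n m θ := by ext; rfl }
    comp a b c :=
      { app n := ↾(fun p => Quot.map₂ Word.mul (fun v _ _ h => Rel.right v h)
          (fun _ _ w h => Rel.left w h) p.1 p.2)
        naturality n m θ := by
          ext ⟨⟨v⟩, ⟨w⟩⟩
          rfl }
    id_comp a b := by
      ext n ⟨w⟩
      exact Quot.sound (Rel.one_mul w)
    comp_id a b := by
      ext n ⟨w⟩
      exact Quot.sound (Rel.mul_one w)
    assoc a b c d := by
      ext n ⟨⟨u⟩, ⟨v⟩, ⟨w⟩⟩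
      exact Quot.sound (Rel.assoc u v w) }

/-- The class of a formal composite. -/
def cls {n : SimplexCategoryᵒᵖ} {a b : Ob F} (w : Word F n a b) : ((pt F).Map a b).obj n :=
  Quot.mk _ w

lemma tr_cls_of {n : SimplexCategoryᵒᵖ} {a b a' b' : Ob F} (ha : a = a') (hb : b = b') (j : J)
    (x y : F.obj j) (hx : ob j x = a) (hy : ob j y = b) (f : ((F.obj j).Map x y).obj n) :
    tr (C := pt F) ha hb (cls (.of j x y hx hy f)) =
      cls (.of j x y (hx.trans ha) (hy.trans hb) f) := by
  subst ha hb; rfl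

variable (F) in
/-- The colimit cocone. -/
def cocone : Cocone F where
  pt := pt F
  ι :=
  { app j :=
    { obj x := ob j x
      map x y :=
      { app n := ↾(fun f => cls (Word.of j x y rfl rfl f))
        naturality n m θ := by ext f; rfl }
      map_id x := by
        ext n f
        exact Quot.sound (Rel.of_one j x rfl)
      map_comp x y z := by
        ext n ⟨f, g⟩
        exact Quot.sound (Rel.of_mul j x y z rfl rfl rfl f g) }
    naturality j k u := by
      refine functor_ext (fun x => ob_map u x) (fun n x y f => ?_)
      refine (tr_cls_of (ob_map u x) (ob_map u y) k _ _ rfl rfl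
        ((onMap (F.map u) x y).app n f)).trans ?_
      exact (Quot.sound (Rel.map u x y rfl rfl f)).symm }

variable (s : Cocone F)

/-- The map on objects induced by a cocone. -/
def descOb : Ob F → s.pt :=
  Quot.lift (fun p => onObj (s.ι.app p.1) p.2) (by
    rintro ⟨j, x⟩ ⟨k, y⟩ ⟨u, h⟩
    change j ⟶ k at u
    change onObj (F.map u) x = y at h
    subst h
    exact congrArg (fun G : F.obj j ⟶ s.pt => onObj G x) (s.w u).symm)

/-- Evaluation of formal composites in the apex of a cocone. -/
def eval {n : SimplexCategoryᵒᵖ} {a b : Ob F} :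
    Word F n a b → (s.pt.Map (descOb s a) (descOb s b)).obj n
  | .of j x y hx hy f =>
      tr (congrArg (descOb s) hx) (congrArg (descOb s) hy) ((onMap (s.ι.app j) x y).app n f)
  | .one a => SCat.one n _
  | .mul v w => SCat.mul (eval v) (eval w)

lemma eval_rel {n : SimplexCategoryᵒᵖ} {a b : Ob F} {v w : Word F n a b} (h : Rel n v w) :
    eval s v = eval s w := by
  induction h with
  | map u x y hx hy f =>
    subst hx hy
    exact (onMap_congr (s.w u) f).symm
  | of_one j x hx =>
    subst hx
    exact onMap_one (s.ι.app j) x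
  | of_mul j x y z hx hy hz f g =>
    subst hx hy hz
    exact onMap_mul (s.ι.app j) f g
  | one_mul w => exact SCat.one_mul _
  | mul_one w => exact SCat.mul_one _
  | assoc u v w => exact SCat.mul_assoc _ _ _
  | left w h ih => simp only [eval, ih]
  | right v h ih => simp only [eval, ih]

lemma eval_map {n m : SimplexCategoryᵒᵖ} (θ : n ⟶ m) {a b : Ob F} (w : Word F n a b) :
    eval s (w.map θ) = (s.pt.Map _ _).map θ (eval s w) := by
  induction w with
  | of j x y hx hy f =>
    subst hx hy
    exact NatTrans.naturality_apply (onMap (s.ι.app j) x y) θ f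
  | one a => exact (SCat.map_one θ _).symm
  | mul v w hv hw => simp only [eval, Word.map, hv, hw, SCat.map_mul]

/-- The simplicial functor out of the colimit induced by a cocone. -/
def desc : pt F ⟶ s.pt where
  obj := descOb s
  map a b :=
  { app n := ↾(Quot.lift (eval s) (fun _ _ h => eval_rel s h))
    naturality n m θ := by
      ext ⟨w⟩
      exact eval_map s θ w }
  map_id a := by ext n f; rfl
  map_comp a b c := by
    ext n ⟨⟨v⟩, ⟨w⟩⟩
    rfl

variable (F) in
/-- The universal property. -/
def isColimit : IsColimit (cocone F) where
  desc := desc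
  fac s j := functor_ext (fun x => rfl) (fun n x y f => rfl)
  uniq s m hm := by
    have hobj : ∀ a : Ob F, onObj m a = descOb s a := by
      rintro ⟨j, x⟩
      exact congrArg (fun G : F.obj j ⟶ s.pt => onObj G x) (hm j)
    refine functor_ext hobj (fun n a b q => ?_)
    obtain ⟨w⟩ := q
    clear q
    change tr (hobj a) (hobj b) ((onMap m a b).app n (cls w)) = eval s w
    induction w with
    | of j x y hx hy f =>
      subst hx hy
      exact onMap_congr (hm j) f
    | one a =>
      refine (congrArg (tr (hobj a) (hobj a)) (onMap_one m a)).trans ?_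
      exact tr_one _
    | @mul a b c v w' hv hw =>
      refine (congrArg (tr (hobj a) (hobj c)) (onMap_mul m (cls v) (cls w'))).trans ?_
      rw [tr_mul _ (hobj b), hv, hw]
      rfl

end Colim

instance : HasColimitsOfSize.{0, 0} SCat where
  has_colimits_of_shape _ _ := { has_colimit F := ⟨⟨_, Colim.isColimit F⟩⟩ }

end SCat

/-- A category enriched in preordered sets: each hom-set carries a preorder, and composition is
monotone. -/
structure ProsetCat where
  carrier : Type
  [cat : Category.{0} carrier]
  [preorder : ∀ x y : carrier, Preorder (x ⟶ y)]
  comp_mono : ∀ {x y z : carrier} {f f' : x ⟶ y} {g g' : y ⟶ z},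
    f ≤ f' → g ≤ g' → f ≫ g ≤ f' ≫ g'

namespace ProsetCat

instance : CoeSort ProsetCat Type := ⟨ProsetCat.carrier⟩

instance (P : ProsetCat) : Category.{0} P := P.cat

instance (P : ProsetCat) (x y : P) : Preorder (x ⟶ y) := P.preorder x y

/-- Functors enriched in preordered sets. -/
@[ext]
structure Hom (P Q : ProsetCat) where
  toFunctor : P.carrier ⥤ Q.carrier
  mono : ∀ {x y : P} {f g : x ⟶ y}, f ≤ g → toFunctor.map f ≤ toFunctor.map g

instance : Category ProsetCat where
  Hom := Hom
  id P := ⟨𝟭 P, fun h => h⟩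
  comp F G := ⟨F.toFunctor ⋙ G.toFunctor, fun h => G.mono (F.mono h)⟩

/-- The hom-posets of `P` are partially ordered. -/
def IsPosetCat (P : ProsetCat) : Prop :=
  ∀ (x y : P) (f g : x ⟶ y), f ≤ g → g ≤ f → f = g

lemma nerve_ext {A : Type} [Preorder A] {n : SimplexCategoryᵒᵖ} {f g : (nerve A).obj n}
    (h : ∀ i, Functor.obj f i = Functor.obj g i) : f = g :=
  nerve.ext_of_isThin (funext h)

/-- The nerve of `P`: the simplicial category with the same objects, whose mapping spaces are the
nerves of the hom-prosets of `P`. -/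
def nerveObj (P : ProsetCat) : SCat where
  carrier := P
  str :=
  { Hom x y := nerve (x ⟶ y)
    id x :=
      { app n := ↾(fun _ => (Functor.const _).obj (𝟙 x))
        naturality n m θ := by ext; rfl }
    comp x y z :=
      { app n := ↾(fun p =>
          { obj := fun i => Functor.obj p.1 i ≫ Functor.obj p.2 i
            map := fun u => homOfLE (P.comp_mono (CategoryTheory.Functor.map p.1 u).le
              (CategoryTheory.Functor.map p.2 u).le) })
        naturality n m θ := by ext; rfl }
    id_comp x y := by
      ext n f i
      exact Category.id_comp (Functor.obj f i)
    comp_id x y := by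
      ext n f i
      exact Category.comp_id (Functor.obj f i)
    assoc w x y z := by
      ext n ⟨f, g, h⟩ i
      exact Category.assoc (Functor.obj f i) (Functor.obj g i) (Functor.obj h i) }

/-- The nerve, as a functor from categories enriched in preordered sets to simplicial categories. -/
def nerveFunctor : ProsetCat ⥤ SCat where
  obj := nerveObj
  map {P Q} F :=
  { obj (x : P) := F.toFunctor.obj x
    map (x y : P) := nerveMap (Monotone.functor (f := fun f : x ⟶ y => F.toFunctor.map f)
      (fun _ _ h => F.mono h))
    map_id (x : P) := by
      ext n f
      refine nerve_ext (A := F.toFunctor.obj x ⟶ F.toFunctor.obj x) (fun i => ?_)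
      exact F.toFunctor.map_id x
    map_comp (x y z : P) := by
      ext n ⟨f, g⟩
      refine nerve_ext (A := F.toFunctor.obj x ⟶ F.toFunctor.obj z) (fun i => ?_)
      exact F.toFunctor.map_comp (Functor.obj f i) (Functor.obj g i) }
  map_id P := SCat.functor_ext (fun _ => rfl) (fun _ _ _ _ => rfl)
  map_comp F G := SCat.functor_ext (fun _ => rfl) (fun _ _ _ _ => rfl)

end ProsetCat

/-! ### The cube category and cubical sets -/

/-- The maps `[1]^m → [1]^n` generated under composition by faces, degeneracies and negative
connections (they are all monotone). Here `[1] = {0 ≤ 1}` is `Bool`. -/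
inductive IsCubical : ∀ {m n : ℕ}, ((Fin m → Bool) → (Fin n → Bool)) → Prop
  | id (n : ℕ) : IsCubical (fun x : Fin n → Bool => x)
  | comp {m n k : ℕ} {f : (Fin m → Bool) → (Fin n → Bool)} {g : (Fin n → Bool) → (Fin k → Bool)}
      (hf : IsCubical f) (hg : IsCubical g) : IsCubical (fun x => g (f x))
  /-- insert `ε` as `i`-th coordinate -/
  | face {n : ℕ} (i : Fin (n + 1)) (ε : Bool) :
      IsCubical (fun x : Fin n → Bool => (i.insertNth ε x : Fin (n + 1) → Bool))
  /-- forget the `i`-th coordinate -/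
  | degeneracy {n : ℕ} (i : Fin (n + 1)) :
      IsCubical (fun x : Fin (n + 1) → Bool => (i.removeNth x : Fin n → Bool))
  /-- replace the coordinates `i` and `i + 1` by their maximum -/
  | connection {n : ℕ} (i : Fin (n + 1)) :
      IsCubical (fun (x : Fin (n + 2) → Bool) (j : Fin (n + 1)) =>
        if j < i then x j.castSucc else if j = i then max (x j.castSucc) (x j.succ) else x j.succ)

/-- The category `□`, with objects `[1]^n`. -/
structure Cube where
  dim : ℕ

namespace Cube

instance : Category Cube where
  Hom m n := { f : (Fin m.dim → Bool) → (Fin n.dim → Bool) // IsCubical f }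
  id n := ⟨_, .id n.dim⟩
  comp f g := ⟨_, .comp f.2 g.2⟩

/-- The face `∂_{i, ε} : [1]^n → [1]^(n+1)` (coordinates are numbered from `0`). -/
def face {n : ℕ} (i : Fin (n + 1)) (ε : Bool) : (⟨n⟩ : Cube) ⟶ ⟨n + 1⟩ := ⟨_, .face i ε⟩

lemma isCubical_const : ∀ {n : ℕ} (v : Fin n → Bool), IsCubical (fun _ : Fin 0 → Bool => v)
  | 0, v => by
    have : (fun _ : Fin 0 → Bool => v) = (fun x => x) := by
      funext x; exact Subsingleton.elim _ _
    rw [this]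
    exact .id 0
  | n + 1, v => by
    have := IsCubical.comp (isCubical_const (Fin.tail v)) (.face 0 (v 0))
    simpa [Fin.cons_self_tail] using this

/-- The vertex `v` of the `n`-cube. -/
def vertex {n : ℕ} (v : Fin n → Bool) : (⟨0⟩ : Cube) ⟶ ⟨n⟩ := ⟨_, isCubical_const v⟩

@[ext]
lemma hom_ext {m n : Cube} {f g : m ⟶ n} (h : ∀ x, f.1 x = g.1 x) : f = g :=
  Subtype.ext (funext h)

end Cube

/-- Cubical sets. -/
abbrev CSet := Cubeᵒᵖ ⥤ Type

namespace CSet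

/-- The standard `n`-cube. -/
abbrev cube (n : ℕ) : CSet := yoneda.obj (⟨n⟩ : Cube)

/-- The set of vertices. -/
abbrev Vertex (S : CSet) : Type := S.obj (op ⟨0⟩)

/-- The map `□^0 → S` picking a vertex. -/
def point {S : CSet} (a : S.Vertex) : cube 0 ⟶ S := yonedaEquiv.symm a

lemma point_comp {S T : CSet} (a : S.Vertex) (f : S ⟶ T) : point a ≫ f = point (f.app _ a) := by
  apply yonedaEquiv.injective
  simp [point, yonedaEquiv_comp]

lemma point_injective {S : CSet} {a b : S.Vertex} (h : point a = point b) : a = b :=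
  yonedaEquiv.symm.injective h

@[simp]
lemma point_id : point (𝟙 (⟨0⟩ : Cube) : (cube 0).Vertex) = 𝟙 (cube 0) := by
  apply yonedaEquiv.injective
  simp [point, yonedaEquiv]

end CSet

/-- Double pointed cubical sets `S_{a,b}`. -/
structure CSet2 where
  carrier : CSet
  src : carrier.Vertex
  tgt : carrier.Vertex

namespace CSet2

/-- Maps of double pointed cubical sets. -/
@[ext]
structure Hom (X Y : CSet2) where
  hom : X.carrier ⟶ Y.carrier
  map_src : hom.app _ X.src = Y.src
  map_tgt : hom.app _ X.tgt = Y.tgt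

instance : Category CSet2 where
  Hom := Hom
  id X := ⟨𝟙 _, rfl, rfl⟩
  comp f g := ⟨f.hom ≫ g.hom, by simp [f.map_src, g.map_src], by simp [f.map_tgt, g.map_tgt]⟩

@[simp] lemma id_hom (X : CSet2) : (𝟙 X : X ⟶ X).hom = 𝟙 X.carrier := rfl

@[simp] lemma comp_hom {X Y Z : CSet2} (f : X ⟶ Y) (g : Y ⟶ Z) : (f ≫ g).hom = f.hom ≫ g.hom := rfl

@[ext]
lemma hom_ext {X Y : CSet2} {f g : X ⟶ Y} (h : f.hom = g.hom) : f = g := Hom.ext h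

/-- The `n`-cube, double pointed by its least and greatest vertices. -/
def cube (n : ℕ) : CSet2 where
  carrier := CSet.cube n
  src := Cube.vertex (fun _ => false)
  tgt := Cube.vertex (fun _ => true)

/-- The concatenation product `X ∨ Y` of double pointed cubical sets: the pushout identifying the
second point of `X` with the first point of `Y`. -/
noncomputable def wedge (X Y : CSet2) : CSet2 where
  carrier := pushout (CSet.point X.tgt) (CSet.point Y.src)
  src := (pushout.inl (CSet.point X.tgt) (CSet.point Y.src)).app _ X.src
  tgt := (pushout.inr (CSet.point X.tgt) (CSet.point Y.src)).app _ Y.tgt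

/-- The inclusion of cubical sets `X → X ∨ Y`. -/
noncomputable def inl (X Y : CSet2) : X.carrier ⟶ (wedge X Y).carrier := pushout.inl _ _

/-- The inclusion of cubical sets `Y → X ∨ Y`. -/
noncomputable def inr (X Y : CSet2) : Y.carrier ⟶ (wedge X Y).carrier := pushout.inr _ _

lemma inl_tgt (X Y : CSet2) : (inl X Y).app _ X.tgt = (inr X Y).app _ Y.src := by
  apply CSet.point_injective
  refine (CSet.point_comp X.tgt (inl X Y)).symm.trans
    (Eq.trans ?_ (CSet.point_comp Y.src (inr X Y)))
  exact pushout.condition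

lemma wedge_hom_ext {X Y : CSet2} {Z : CSet} {f g : (wedge X Y).carrier ⟶ Z}
    (h₁ : inl X Y ≫ f = inl X Y ≫ g) (h₂ : inr X Y ≫ f = inr X Y ≫ g) : f = g :=
  pushout.hom_ext h₁ h₂

/-- The map of cubical sets out of `X ∨ Y` given by two maps which agree at the junction. -/
noncomputable def glue {X Y : CSet2} {Z : CSet} (f : X.carrier ⟶ Z) (g : Y.carrier ⟶ Z)
    (h : f.app _ X.tgt = g.app _ Y.src) : (wedge X Y).carrier ⟶ Z :=
  pushout.desc f g (by rw [CSet.point_comp, CSet.point_comp, h])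

section
variable {X Y : CSet2} {Z Z' : CSet} (f : X.carrier ⟶ Z) (g : Y.carrier ⟶ Z)
  (h : f.app _ X.tgt = g.app _ Y.src)

@[simp]
lemma inl_glue : inl X Y ≫ glue f g h = f := pushout.inl_desc _ _ _

@[simp]
lemma inr_glue : inr X Y ≫ glue f g h = g := pushout.inr_desc _ _ _

@[simp]
lemma inl_glue_assoc (k : Z ⟶ Z') : inl X Y ≫ glue f g h ≫ k = f ≫ k := by
  rw [← Category.assoc, inl_glue]

@[simp]
lemma inr_glue_assoc (k : Z ⟶ Z') : inr X Y ≫ glue f g h ≫ k = g ≫ k := by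
  rw [← Category.assoc, inr_glue]

lemma glue_inl (x : X.carrier.Vertex) : (glue f g h).app _ ((inl X Y).app _ x) = f.app _ x :=
  types_congr_hom (congr_app (inl_glue f g h) _) x

lemma glue_inr (y : Y.carrier.Vertex) : (glue f g h).app _ ((inr X Y).app _ y) = g.app _ y :=
  types_congr_hom (congr_app (inr_glue f g h) _) y

end

/-- The map `f * g : X ∨ Y → S_{a,c}` determined by `f : X → S_{a,b}` and `g : Y → S_{b,c}`. -/
noncomputable def star {X Y : CSet2} {S : CSet} {a b c : S.Vertex}
    (f : X ⟶ ⟨S, a, b⟩) (g : Y ⟶ ⟨S, b, c⟩) : wedge X Y ⟶ ⟨S, a, c⟩ where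
  hom := glue f.hom g.hom (f.map_tgt.trans g.map_src.symm)
  map_src := (glue_inl _ _ _ _).trans f.map_src
  map_tgt := (glue_inr _ _ _ _).trans g.map_tgt

@[simp]
lemma star_hom {X Y : CSet2} {S : CSet} {a b c : S.Vertex}
    (f : X ⟶ ⟨S, a, b⟩) (g : Y ⟶ ⟨S, b, c⟩) :
    (star f g).hom = glue f.hom g.hom (f.map_tgt.trans g.map_src.symm) := rfl

lemma wedgeMap_aux {X X' Y Y' : CSet2} (f : X ⟶ X') (g : Y ⟶ Y') :
    (f.hom ≫ inl X' Y').app _ X.tgt = (g.hom ≫ inr X' Y').app _ Y.src :=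
  (congrArg ((inl X' Y').app _) f.map_tgt).trans
    ((inl_tgt X' Y').trans (congrArg ((inr X' Y').app _) g.map_src.symm))

/-- The map `f ∨ g`. -/
noncomputable def wedgeMap {X X' Y Y' : CSet2} (f : X ⟶ X') (g : Y ⟶ Y') :
    wedge X Y ⟶ wedge X' Y' where
  hom := glue (f.hom ≫ inl X' Y') (g.hom ≫ inr X' Y') (wedgeMap_aux f g)
  map_src := (glue_inl _ _ _ _).trans (congrArg ((inl X' Y').app _) f.map_src)
  map_tgt := (glue_inr _ _ _ _).trans (congrArg ((inr X' Y').app _) g.map_tgt)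

section
variable {X X' Y Y' : CSet2} (f : X ⟶ X') (g : Y ⟶ Y')

@[simp]
lemma inl_wedgeMap : inl X Y ≫ (wedgeMap f g).hom = f.hom ≫ inl X' Y' :=
  inl_glue _ _ (wedgeMap_aux f g)

@[simp]
lemma inr_wedgeMap : inr X Y ≫ (wedgeMap f g).hom = g.hom ≫ inr X' Y' :=
  inr_glue _ _ (wedgeMap_aux f g)

@[simp]
lemma inl_wedgeMap_assoc {Z : CSet} (k : (wedge X' Y').carrier ⟶ Z) :
    inl X Y ≫ (wedgeMap f g).hom ≫ k = f.hom ≫ inl X' Y' ≫ k := by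
  rw [← Category.assoc, inl_wedgeMap, Category.assoc]

@[simp]
lemma inr_wedgeMap_assoc {Z : CSet} (k : (wedge X' Y').carrier ⟶ Z) :
    inr X Y ≫ (wedgeMap f g).hom ≫ k = g.hom ≫ inr X' Y' ≫ k := by
  rw [← Category.assoc, inr_wedgeMap, Category.assoc]

end

lemma wedgeMap_comp {X X' X'' Y Y' Y'' : CSet2} (f : X ⟶ X') (f' : X' ⟶ X'') (g : Y ⟶ Y')
    (g' : Y' ⟶ Y'') : wedgeMap f g ≫ wedgeMap f' g' = wedgeMap (f ≫ f') (g ≫ g') := by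
  apply hom_ext
  apply wedge_hom_ext <;> simp

@[simp]
lemma wedgeMap_id (X Y : CSet2) : wedgeMap (𝟙 X) (𝟙 Y) = 𝟙 (wedge X Y) := by
  apply hom_ext
  apply wedge_hom_ext <;> simp

lemma wedgeMap_star {X X' Y Y' : CSet2} {S : CSet} {a b c : S.Vertex} (f : X ⟶ X') (g : Y ⟶ Y')
    (h : X' ⟶ ⟨S, a, b⟩) (k : Y' ⟶ ⟨S, b, c⟩) :
    wedgeMap f g ≫ star h k = star (f ≫ h) (g ≫ k) := by
  apply hom_ext
  apply wedge_hom_ext <;> simp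

section
variable (X Y Z : CSet2)

lemma assoc_aux₁ : (inl X (wedge Y Z)).app _ X.tgt =
    (inl Y Z ≫ inr X (wedge Y Z)).app _ Y.src := inl_tgt X (wedge Y Z)

lemma assoc_aux₂ : (inr X Y ≫ inl (wedge X Y) Z).app _ Y.tgt =
    (inr (wedge X Y) Z).app _ Z.src := inl_tgt (wedge X Y) Z

lemma assoc_aux : (glue (inl X (wedge Y Z)) (inl Y Z ≫ inr X (wedge Y Z))
    (assoc_aux₁ X Y Z)).app _ (wedge X Y).tgt = (inr Y Z ≫ inr X (wedge Y Z)).app _ Z.src :=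
  (glue_inr (inl X (wedge Y Z)) (inl Y Z ≫ inr X (wedge Y Z)) (assoc_aux₁ X Y Z) Y.tgt).trans
    (congrArg ((inr X (wedge Y Z)).app _) (inl_tgt Y Z))

lemma assoc_aux' : (inl X Y ≫ inl (wedge X Y) Z).app _ X.tgt =
    (glue (inr X Y ≫ inl (wedge X Y) Z) (inr (wedge X Y) Z) (assoc_aux₂ X Y Z)).app _
      (wedge Y Z).src :=
  (congrArg ((inl (wedge X Y) Z).app _) (inl_tgt X Y)).trans
    (glue_inl (inr X Y ≫ inl (wedge X Y) Z) (inr (wedge X Y) Z) (assoc_aux₂ X Y Z)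
      Y.src).symm

end

/-- The associativity isomorphism of the concatenation product. -/
noncomputable def assocIso (X Y Z : CSet2) :
    wedge (wedge X Y) Z ≅ wedge X (wedge Y Z) where
  hom :=
  { hom := glue (glue (inl X (wedge Y Z)) (inl Y Z ≫ inr X (wedge Y Z)) (assoc_aux₁ X Y Z))
      (inr Y Z ≫ inr X (wedge Y Z)) (assoc_aux X Y Z)
    map_src := (glue_inl _ _ (assoc_aux X Y Z) _).trans
      (glue_inl (inl X (wedge Y Z)) (inl Y Z ≫ inr X (wedge Y Z)) (assoc_aux₁ X Y Z) X.src)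
    map_tgt := glue_inr _ _ (assoc_aux X Y Z) _ }
  inv :=
  { hom := glue (inl X Y ≫ inl (wedge X Y) Z)
      (glue (inr X Y ≫ inl (wedge X Y) Z) (inr (wedge X Y) Z) (assoc_aux₂ X Y Z))
      (assoc_aux' X Y Z)
    map_src := glue_inl _ _ (assoc_aux' X Y Z) _
    map_tgt := (glue_inr _ _ (assoc_aux' X Y Z) _).trans
      (glue_inr (inr X Y ≫ inl (wedge X Y) Z) (inr (wedge X Y) Z) (assoc_aux₂ X Y Z) Z.tgt) }
  hom_inv_id := by
    apply hom_ext
    apply wedge_hom_ext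
    · apply wedge_hom_ext <;> simp
    · simp
  inv_hom_id := by
    apply hom_ext
    apply wedge_hom_ext
    · simp
    · apply wedge_hom_ext <;> simp

lemma assocIso_hom_star {X Y Z : CSet2} {S : CSet} {a b c d : S.Vertex} (f : X ⟶ ⟨S, a, b⟩)
    (g : Y ⟶ ⟨S, b, c⟩) (h : Z ⟶ ⟨S, c, d⟩) :
    (assocIso X Y Z).hom ≫ star f (star g h) = star (star f g) h := by
  apply hom_ext
  apply wedge_hom_ext
  · apply wedge_hom_ext <;> simp [assocIso]
  · simp [assocIso]

lemma assocIso_hom_wedgeMap {X Y Z X' Y' Z' : CSet2} (f : X ⟶ X') (g : Y ⟶ Y') (h : Z ⟶ Z') :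
    (assocIso X Y Z).hom ≫ wedgeMap f (wedgeMap g h) =
      wedgeMap (wedgeMap f g) h ≫ (assocIso X' Y' Z').hom := by
  apply hom_ext
  apply wedge_hom_ext
  · apply wedge_hom_ext <;> simp [assocIso]
  · simp [assocIso]

lemma point_eq {X : CSet} (a : X.Vertex) : (CSet.point a).app _ (𝟙 (⟨0⟩ : Cube)) = a :=
  yonedaEquiv.apply_symm_apply a

lemma vertex_zero (v : Fin 0 → Bool) : Cube.vertex v = 𝟙 (⟨0⟩ : Cube) :=
  Cube.hom_ext (fun _ => Subsingleton.elim _ _)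

/-- The constant map at a vertex, from the unit `□^0` of the concatenation product. -/
def const {S : CSet} (a : S.Vertex) : cube 0 ⟶ ⟨S, a, a⟩ where
  hom := CSet.point a
  map_src := (congrArg ((CSet.point a).app _) (vertex_zero _)).trans (point_eq a)
  map_tgt := (congrArg ((CSet.point a).app _) (vertex_zero _)).trans (point_eq a)

/-- Maps out of the unit are determined by the vertex. -/
lemma unit_hom_ext {S : CSet} {a b : S.Vertex} (f : cube 0 ⟶ ⟨S, a, b⟩) :
    f.hom = CSet.point a := by
  refine yonedaEquiv.injective (Eq.trans ?_ (yonedaEquiv.apply_symm_apply a).symm)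
  exact (congrArg (f.hom.app _) (vertex_zero _).symm).trans f.map_src

/-- The right unit isomorphism of the concatenation product. -/
noncomputable def rightUnitIso (X : CSet2) : wedge X (cube 0) ≅ X where
  hom := star (𝟙 X) (const X.tgt)
  inv := ⟨inl X (cube 0), rfl, (inl_tgt X (cube 0)).trans
    (congrArg ((inr X (cube 0)).app _) ((vertex_zero _).trans (vertex_zero _).symm))⟩
  hom_inv_id := by
    apply hom_ext
    apply wedge_hom_ext
    · simp
    · simp only [comp_hom, id_hom, star_hom, inr_glue_assoc, Category.comp_id]
      refine (CSet.point_comp _ _).trans ?_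
      rw [inl_tgt]
      exact (unit_hom_ext (a := (inr X (cube 0)).app _ (cube 0).src)
        (b := (inr X (cube 0)).app _ (cube 0).tgt) ⟨inr X (cube 0), rfl, rfl⟩).symm
  inv_hom_id := by
    apply hom_ext
    simp

/-- The cubical set `I_n`, the `n`-fold concatenation product of `□^1`. -/
noncomputable def chain : ℕ → CSet2
  | 0 => cube 0
  | n + 1 => wedge (chain n) (cube 1)

/-- The isomorphism induced by two isomorphisms. -/
@[simps]
noncomputable def wedgeIso {X X' Y Y' : CSet2} (e : X ≅ X') (e' : Y ≅ Y') :
    wedge X Y ≅ wedge X' Y' where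
  hom := wedgeMap e.hom e'.hom
  inv := wedgeMap e.inv e'.inv
  hom_inv_id := by simp [wedgeMap_comp]
  inv_hom_id := by simp [wedgeMap_comp]

/-- The identification `I_{n+m} = I_n ∨ I_m`. -/
noncomputable def split (n : ℕ) : ∀ m : ℕ, chain (n + m) ≅ wedge (chain n) (chain m)
  | 0 => (rightUnitIso (chain n)).symm
  | m + 1 => wedgeIso (split n m) (Iso.refl (cube 1)) ≪≫ assocIso (chain n) (chain m) (cube 1)

end CSet2

/-! ### The path category of a cubical set -/

namespace CSet2

/-- The face `∂_{i, ε} : □^n → □^(n+1)` of cubical sets. -/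
def faceMap {n : ℕ} (i : Fin (n + 1)) (ε : Bool) : CSet.cube n ⟶ CSet.cube (n + 1) :=
  yoneda.map (Cube.face i ε)

/-- The map `I_2 → □^2` given by the edges `∂_{1,0}` and `∂_{2,1}`. -/
noncomputable def sourceSquare : chain 2 ⟶ cube 2 :=
  star (b := Cube.vertex ![false, true])
    (star (const (cube 2).src) ⟨faceMap 0 false, by
      apply Cube.hom_ext; intro x; funext i; fin_cases i <;> rfl, by
      apply Cube.hom_ext; intro x; funext i; fin_cases i <;> rfl⟩)
    ⟨faceMap 1 true, by
      apply Cube.hom_ext; intro x; funext i; fin_cases i <;> rfl, by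
      apply Cube.hom_ext; intro x; funext i; fin_cases i <;> rfl⟩

/-- The map `I_2 → □^2` given by the edges `∂_{2,0}` and `∂_{1,1}`. -/
noncomputable def targetSquare : chain 2 ⟶ cube 2 :=
  star (b := Cube.vertex ![true, false])
    (star (const (cube 2).src) ⟨faceMap 1 false, by
      apply Cube.hom_ext; intro x; funext i; fin_cases i <;> rfl, by
      apply Cube.hom_ext; intro x; funext i; fin_cases i <;> rfl⟩)
    ⟨faceMap 0 true, by
      apply Cube.hom_ext; intro x; funext i; fin_cases i <;> rfl, by
      apply Cube.hom_ext; intro x; funext i; fin_cases i <;> rfl⟩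

/-- The necklace `I_k ∨ □^2 ∨ I_j`. -/
noncomputable abbrev squareChain (k j : ℕ) : CSet2 := wedge (wedge (chain k) (cube 2)) (chain j)

/-- Given `q : I_2 → □^2`, the map `id ∨ q ∨ id : I_{k+2+j} → I_k ∨ □^2 ∨ I_j`. -/
noncomputable def insertSquare (q : chain 2 ⟶ cube 2) (k j : ℕ) :
    chain (k + 2 + j) ⟶ squareChain k j :=
  (split (k + 2) j).hom ≫ wedgeMap ((split k 2).hom ≫ wedgeMap (𝟙 _) q) (𝟙 _)

lemma wedgeMap_comp_assoc {X X' X'' Y Y' Y'' Z : CSet2} (f : X ⟶ X') (f' : X' ⟶ X'')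
    (g : Y ⟶ Y') (g' : Y' ⟶ Y'') (h : wedge X'' Y'' ⟶ Z) :
    wedgeMap f g ≫ wedgeMap f' g' ≫ h = wedgeMap (f ≫ f') (g ≫ g') ≫ h := by
  rw [← wedgeMap_comp, Category.assoc]

lemma assocIso_hom_wedgeMap_assoc {X Y Z X' Y' Z' W : CSet2} (f : X ⟶ X') (g : Y ⟶ Y')
    (h : Z ⟶ Z') (k : wedge X' (wedge Y' Z') ⟶ W) :
    (assocIso X Y Z).hom ≫ wedgeMap f (wedgeMap g h) ≫ k =
      wedgeMap (wedgeMap f g) h ≫ (assocIso X' Y' Z').hom ≫ k := by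
  rw [← Category.assoc, assocIso_hom_wedgeMap, Category.assoc]

lemma assocIso_inv_wedgeMap_assoc {X Y Z X' Y' Z' W : CSet2} (f : X ⟶ X') (g : Y ⟶ Y')
    (h : Z ⟶ Z') (k : wedge (wedge X' Y') Z' ⟶ W) :
    (assocIso X Y Z).inv ≫ wedgeMap (wedgeMap f g) h ≫ k =
      wedgeMap f (wedgeMap g h) ≫ (assocIso X' Y' Z').inv ≫ k := by
  rw [Iso.inv_comp_eq, assocIso_hom_wedgeMap_assoc, Iso.hom_inv_id_assoc]

lemma assocIso_inv_star {X Y Z : CSet2} {S : CSet} {a b c d : S.Vertex} (f : X ⟶ ⟨S, a, b⟩)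
    (g : Y ⟶ ⟨S, b, c⟩) (h : Z ⟶ ⟨S, c, d⟩) :
    (assocIso X Y Z).inv ≫ star (star f g) h = star f (star g h) := by
  rw [Iso.inv_comp_eq, assocIso_hom_star]

end CSet2

open CSet2

/-- The set of paths in `S` joining `a` to `b`: maps `I_n → S_{a,b}`, modulo the equivalence
relation generated by reparametrizations `I_n → I_m`. -/
def CPath (S : CSet) (a b : S.Vertex) : Type :=
  Quot (fun p q : (Σ n : ℕ, (chain n ⟶ (⟨S, a, b⟩ : CSet2))) =>
    ∃ φ : chain p.1 ⟶ chain q.1, p.2 = φ ≫ q.2)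

namespace CPath

variable {S T : CSet} {a b c d : S.Vertex}

/-- The class of a map `I_n → S_{a,b}`. -/
def mk {n : ℕ} (γ : chain n ⟶ (⟨S, a, b⟩ : CSet2)) : CPath S a b := Quot.mk _ ⟨n, γ⟩

lemma mk_comp {n m : ℕ} (φ : chain n ⟶ chain m) (γ : chain m ⟶ (⟨S, a, b⟩ : CSet2)) :
    mk (φ ≫ γ) = mk γ := Quot.sound ⟨φ, rfl⟩

lemma exists_rep (p : CPath S a b) : ∃ (n : ℕ) (γ : chain n ⟶ (⟨S, a, b⟩ : CSet2)), p = mk γ := by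
  obtain ⟨n, γ⟩ := p
  exact ⟨n, γ, rfl⟩

/-- The constant path. -/
def refl (a : S.Vertex) : CPath S a a := mk (n := 0) (const a)

/-- The concatenation `γ * β : I_{n+m} = I_n ∨ I_m → S_{a,c}`. -/
noncomputable def concat {n m : ℕ} (γ : chain n ⟶ (⟨S, a, b⟩ : CSet2))
    (β : chain m ⟶ (⟨S, b, c⟩ : CSet2)) : chain (n + m) ⟶ (⟨S, a, c⟩ : CSet2) :=
  (split n m).hom ≫ star γ β

/-- Composition of paths. -/
noncomputable def comp (p : CPath S a b) (q : CPath S b c) : CPath S a c :=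
  Quot.map₂ (fun γ β => ⟨γ.1 + β.1, concat γ.2 β.2⟩)
    (by
      rintro ⟨n, γ⟩ ⟨m, β⟩ ⟨m', β'⟩ ⟨φ, h⟩
      dsimp only at φ h
      subst h
      exact ⟨(split n m).hom ≫ wedgeMap (𝟙 _) φ ≫ (split n m').inv, by
        simp [concat, wedgeMap_star]⟩)
    (by
      rintro ⟨n, γ⟩ ⟨n', γ'⟩ ⟨m, β⟩ ⟨φ, h⟩
      dsimp only at φ h
      subst h
      exact ⟨(split n m).hom ≫ wedgeMap φ (𝟙 _) ≫ (split n' m).inv, by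
        simp [concat, wedgeMap_star]⟩) p q

lemma mk_comp_mk {n m : ℕ} (γ : chain n ⟶ (⟨S, a, b⟩ : CSet2))
    (β : chain m ⟶ (⟨S, b, c⟩ : CSet2)) : comp (mk γ) (mk β) = mk (concat γ β) := rfl

lemma comp_refl (p : CPath S a b) : comp p (refl b) = p := by
  obtain ⟨n, γ, rfl⟩ := exists_rep p
  refine congrArg mk (?_ : concat (m := 0) γ (const b) = γ)
  exact CSet2.hom_ext (inl_glue γ.hom (const b).hom (γ.map_tgt.trans (const b).map_src.symm))

lemma refl_comp (p : CPath S a b) : comp (refl a) p = p := by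
  obtain ⟨n, γ, rfl⟩ := exists_rep p
  let u : wedge (chain 0) (chain n) ⟶ chain n := star (const (chain n).src) (𝟙 _)
  have h₀ := (const (chain n).src).map_tgt.trans (CSet2.Hom.map_src (𝟙 (chain n))).symm
  have hu : u ≫ γ = star (const a) γ := by
    apply CSet2.hom_ext
    apply wedge_hom_ext
    · refine Eq.trans ?_ (inl_glue (const a).hom γ.hom
        ((const a).map_tgt.trans γ.map_src.symm)).symm
      refine (inl_glue_assoc (const (chain n).src).hom (𝟙 (chain n).carrier) h₀ γ.hom).trans ?_
      exact (CSet.point_comp _ _).trans (congrArg CSet.point γ.map_src)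
    · refine Eq.trans ?_ (inr_glue (const a).hom γ.hom
        ((const a).map_tgt.trans γ.map_src.symm)).symm
      refine (inr_glue_assoc (const (chain n).src).hom (𝟙 (chain n).carrier) h₀ γ.hom).trans ?_
      exact Category.id_comp _
  refine Eq.trans ?_ (mk_comp ((split 0 n).hom ≫ u) γ)
  exact congrArg mk ((congrArg ((split 0 n).hom ≫ ·) hu.symm).trans (Category.assoc _ _ _).symm)

lemma comp_assoc (p : CPath S a b) (q : CPath S b c) (r : CPath S c d) :
    comp (comp p q) r = comp p (comp q r) := by
  obtain ⟨n, γ, rfl⟩ := exists_rep p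
  obtain ⟨m, β, rfl⟩ := exists_rep q
  obtain ⟨k, δ, rfl⟩ := exists_rep r
  simp only [mk_comp_mk]
  refine Eq.trans ?_ (mk_comp ((split (n + m) k).hom ≫ wedgeMap (split n m).hom (𝟙 _) ≫
    (assocIso _ _ _).hom ≫ wedgeMap (𝟙 _) (split m k).inv ≫ (split n (m + k)).inv) _)
  congr 1
  simp [concat, wedgeMap_star, assocIso_hom_star]

/-- The relation `⇝` generated by the squares of `S`: `[s_{k,n} ≫ f] ⇝ [t_{k,n} ≫ f]` for
`f : I_k ∨ □^2 ∨ I_j → S_{a,b}`, where `n = k + 2 + j`. -/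
def Step (p q : CPath S a b) : Prop :=
  ∃ (k j : ℕ) (f : squareChain k j ⟶ (⟨S, a, b⟩ : CSet2)),
    p = mk (insertSquare sourceSquare k j ≫ f) ∧ q = mk (insertSquare targetSquare k j ≫ f)

/-- The preorder on paths is the reflexive transitive closure of `⇝`. -/
instance : Preorder (CPath S a b) where
  le := Relation.ReflTransGen Step
  le_refl _ := .refl
  le_trans _ _ _ := .trans

lemma mk_square_concat (q : chain 2 ⟶ cube 2) {k j m : ℕ}
    (f : squareChain k j ⟶ (⟨S, a, b⟩ : CSet2)) (β : chain m ⟶ (⟨S, b, c⟩ : CSet2)) :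
    mk (concat (insertSquare q k j ≫ f) β) = mk (insertSquare q k (j + m) ≫
      wedgeMap (𝟙 (wedge (chain k) (cube 2))) (split j m).hom ≫ (assocIso _ _ _).inv ≫
        star f β) := by
  refine Eq.trans ?_ (mk_comp ((split (k + 2 + j) m).hom ≫
    wedgeMap (split (k + 2) j).hom (𝟙 _) ≫ (assocIso _ _ _).hom ≫
    wedgeMap (𝟙 _) (split j m).inv ≫ (split (k + 2) (j + m)).inv) _)
  congr 1
  have h := assocIso_hom_wedgeMap_assoc ((split k 2).hom ≫ wedgeMap (𝟙 (chain k)) q)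
    (𝟙 (chain j)) (𝟙 (chain m)) ((assocIso _ _ _).inv ≫ star f β)
  simp only [wedgeMap_id] at h
  simp [concat, insertSquare, wedgeMap_comp_assoc, h, wedgeMap_star]

lemma mk_concat_square (q : chain 2 ⟶ cube 2) {k j m : ℕ}
    (γ : chain m ⟶ (⟨S, a, b⟩ : CSet2)) (f : squareChain k j ⟶ (⟨S, b, c⟩ : CSet2)) :
    mk (concat γ (insertSquare q k j ≫ f)) = mk (insertSquare q (m + k) j ≫
      wedgeMap (wedgeMap (split m k).hom (𝟙 _) ≫ (assocIso _ _ _).hom) (𝟙 _) ≫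
        (assocIso _ _ _).hom ≫ star γ f) := by
  refine Eq.trans ?_ (mk_comp ((split m (k + 2 + j)).hom ≫
    wedgeMap (𝟙 _) (split (k + 2) j).hom ≫ (assocIso _ _ _).inv ≫
    wedgeMap (wedgeMap (𝟙 _) (split k 2).hom ≫ (assocIso _ _ _).inv ≫
      wedgeMap (split m k).inv (𝟙 _) ≫ (split (m + k) 2).inv) (𝟙 _) ≫
    (split (m + k + 2) j).inv) _)
  congr 1
  have h := assocIso_inv_wedgeMap_assoc (𝟙 (chain m)) (𝟙 (chain k)) q
    (assocIso (chain m) (chain k) (cube 2)).hom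
  have h' := assocIso_inv_wedgeMap_assoc (𝟙 (chain m)) ((split k 2).hom ≫ wedgeMap (𝟙 _) q)
    (𝟙 (chain j)) ((assocIso _ _ _).hom ≫ star γ f)
  simp only [Iso.inv_hom_id, Iso.inv_hom_id_assoc, Category.comp_id, wedgeMap_id] at h h'
  simp [concat, insertSquare, wedgeMap_comp_assoc, wedgeMap_comp, h]
  rw [h']
  simp [wedgeMap_star]

lemma comp_le_comp {p p' : CPath S a b} {q q' : CPath S b c} (hp : p ≤ p') (hq : q ≤ q') :
    comp p q ≤ comp p' q' := by
  have h₁ : comp p q ≤ comp p' q := by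
    refine Relation.ReflTransGen.lift (r := Step) (p := Step) (fun t => comp t q) ?_ _ _ hp
    rintro _ _ ⟨k, j, f, rfl, rfl⟩
    obtain ⟨m, β, rfl⟩ := exists_rep q
    exact ⟨k, j + m, _, mk_square_concat _ f β, mk_square_concat _ f β⟩
  have h₂ : comp p' q ≤ comp p' q' := by
    refine Relation.ReflTransGen.lift (r := Step) (p := Step) (fun t => comp p' t) ?_ _ _ hq
    rintro _ _ ⟨k, j, f, rfl, rfl⟩
    obtain ⟨m, γ, rfl⟩ := exists_rep p'
    exact ⟨m + k, j, _, mk_concat_square _ γ f, mk_concat_square _ γ f⟩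
  exact h₁.trans h₂

/-- The image of a path under a map of cubical sets. -/
noncomputable def map (f : S ⟶ T) (p : CPath S a b) : CPath T (f.app _ a) (f.app _ b) :=
  Quot.map (fun γ => ⟨γ.1, γ.2 ≫ ⟨f, rfl, rfl⟩⟩) (by
    rintro ⟨n, γ⟩ ⟨m, γ'⟩ ⟨φ, h⟩
    dsimp only at φ h
    subst h
    exact ⟨φ, Category.assoc _ _ _⟩) p

lemma map_mono (f : S ⟶ T) {p q : CPath S a b} (h : p ≤ q) : map f p ≤ map f q := by
  refine Relation.ReflTransGen.lift (r := Step) (p := Step) (map f) ?_ _ _ h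
  rintro _ _ ⟨k, j, g, rfl, rfl⟩
  exact ⟨k, j, g ≫ ⟨f, rfl, rfl⟩, congrArg mk (Category.assoc _ _ _),
    congrArg mk (Category.assoc _ _ _)⟩

lemma map_refl (f : S ⟶ T) (a : S.Vertex) : map f (refl a) = refl (f.app _ a) :=
  congrArg (mk (n := 0)) (CSet2.hom_ext (CSet.point_comp a f :))

lemma map_comp (f : S ⟶ T) (p : CPath S a b) (q : CPath S b c) :
    map f (comp p q) = comp (map f p) (map f q) := by
  obtain ⟨n, γ, rfl⟩ := exists_rep p
  obtain ⟨m, β, rfl⟩ := exists_rep q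
  refine congrArg (mk (n := n + m)) (CSet2.hom_ext ?_)
  change ((split n m).hom.hom ≫ (star γ β).hom) ≫ f = (split n m).hom.hom ≫ _
  rw [Category.assoc]
  congr 1
  have h := γ.map_tgt.trans β.map_src.symm
  have h' : (γ.hom ≫ f).app _ (chain n).tgt = (β.hom ≫ f).app _ (chain m).src :=
    congrArg (f.app _) h
  apply wedge_hom_ext
  · exact (inl_glue_assoc γ.hom β.hom h f).trans (inl_glue (γ.hom ≫ f) (β.hom ≫ f) h').symm
  · exact (inr_glue_assoc γ.hom β.hom h f).trans (inr_glue (γ.hom ≫ f) (β.hom ≫ f) h').symm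

end CPath

namespace CSet

/-- The path category of `S`: its objects are the vertices of `S`, its morphisms are the paths. -/
noncomputable def pathObj (S : CSet) : ProsetCat where
  carrier := S.Vertex
  cat :=
  { Hom := CPath S
    id := CPath.refl
    comp := CPath.comp
    id_comp := CPath.refl_comp
    comp_id := CPath.comp_refl
    assoc := CPath.comp_assoc }
  preorder a b := inferInstanceAs (Preorder (CPath S a b))
  comp_mono := CPath.comp_le_comp

/-- The functor of path categories induced by a map of cubical sets. -/
noncomputable def pathMap {S T : CSet} (f : S ⟶ T) : pathObj S ⟶ pathObj T where
  toFunctor :=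
  { obj (a : S.Vertex) := (f.app _ a : T.Vertex)
    map p := CPath.map f p
    map_id a := CPath.map_refl f a
    map_comp p q := CPath.map_comp f p q }
  mono h := CPath.map_mono f h

/-- The functor `𝔆_path` from cubical sets to categories enriched in preordered sets. -/
noncomputable def pathCat : CSet ⥤ ProsetCat where
  obj := pathObj
  map := pathMap
  map_id S := by
    refine ProsetCat.Hom.ext (Functor.hext (fun _ => rfl) (fun a b p => heq_of_eq ?_))
    obtain ⟨n, γ, rfl⟩ := CPath.exists_rep p
    exact congrArg CPath.mk (Category.comp_id γ)
  map_comp f g := by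
    refine ProsetCat.Hom.ext (Functor.hext (fun _ => rfl) (fun a b p => heq_of_eq ?_))
    obtain ⟨n, γ, rfl⟩ := CPath.exists_rep p
    exact congrArg CPath.mk (CSet2.hom_ext (Category.assoc _ _ _).symm)

/-! ### The rigidification functor -/

/-- The functor `□^n ↦ N(𝔆_path(□^n))`. -/
noncomputable def cubePath : Cube ⥤ SCat := yoneda ⋙ pathCat ⋙ ProsetCat.nerveFunctor

/-- The rigidification functor `𝔆^□`, the left Kan extension along the Yoneda embedding of
`□^n ↦ N(𝔆_path(□^n))`. -/
noncomputable def rigid : CSet ⥤ SCat := (yoneda : Cube ⥤ CSet).leftKanExtension cubePath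

/-- The unit of the Kan extension. -/
noncomputable def rigidUnit : cubePath ⟶ yoneda ⋙ rigid :=
  (yoneda : Cube ⥤ CSet).leftKanExtensionUnit cubePath

instance : rigid.IsLeftKanExtension rigidUnit :=
  inferInstanceAs (((yoneda : Cube ⥤ CSet).leftKanExtension cubePath).IsLeftKanExtension
    ((yoneda : Cube ⥤ CSet).leftKanExtensionUnit cubePath))

/-- The canonical simplicial functor `𝔆^□(S) → N(𝔆_path(S))`, the unique natural one which
restricts to the identity on the standard cubes. -/
noncomputable def comparison : rigid ⟶ pathCat ⋙ ProsetCat.nerveFunctor :=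
  rigid.descOfIsLeftKanExtension rigidUnit _ (𝟙 cubePath)

/-- The object of `𝔆^□(S)` corresponding to a vertex of `S`. -/
noncomputable def vertexObj {S : CSet} (a : S.Vertex) : rigid.obj S :=
  SCat.onObj (rigid.map (point a)) (SCat.onObj (rigidUnit.app ⟨0⟩) (𝟙 (⟨0⟩ : Cube)))

lemma onObj_vertexObj {S T : CSet} (f : S ⟶ T) (a : S.Vertex) :
    SCat.onObj (rigid.map f) (vertexObj a) = vertexObj (f.app _ a) := by
  have h : rigid.map (point a) ≫ rigid.map f = rigid.map (point (f.app _ a)) := by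
    rw [← Functor.map_comp, point_comp]
  exact congrArg (fun G : rigid.obj (cube 0) ⟶ rigid.obj T =>
    SCat.onObj G (SCat.onObj (rigidUnit.app ⟨0⟩) (𝟙 (⟨0⟩ : Cube)))) h

/-- The mapping space `𝔆^□(S)(a, b)`. -/
noncomputable def rigidMap (S : CSet) (a b : S.Vertex) : SSet.{0} :=
  (rigid.obj S).Map (vertexObj a) (vertexObj b)

/-- Composition `𝔆^□(S)(a, b) × 𝔆^□(S)(b, c) → 𝔆^□(S)(a, c)`, in diagrammatic order. -/
noncomputable def rigidComp (S : CSet) (a b c : S.Vertex) :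
    rigidMap S a b ⊗ rigidMap S b c ⟶ rigidMap S a c :=
  eComp SSet.{0} (vertexObj a) (vertexObj b) (vertexObj c)

end CSet

namespace CSet2

/-- The simplicial set `𝔆^□_t(S_{a,b}) = 𝔆^□(S)(a, b)`. -/
noncomputable def rigidT (X : CSet2) : SSet.{0} := CSet.rigidMap X.carrier X.src X.tgt

lemma rigidT_aux {X Y : CSet2} (f : X ⟶ Y) :
    (CSet.rigid.obj Y.carrier).Map (SCat.onObj (CSet.rigid.map f.hom) (CSet.vertexObj X.src))
      (SCat.onObj (CSet.rigid.map f.hom) (CSet.vertexObj X.tgt)) = rigidT Y := by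
  rw [CSet.onObj_vertexObj, CSet.onObj_vertexObj, f.map_src, f.map_tgt]
  rfl

/-- The map `𝔆^□_t(X) → 𝔆^□_t(Y)` induced by a map of double pointed cubical sets. The `eqToHom`
is the identification of the images in `𝔆^□(Y)` of the distinguished vertices of `X` with the
distinguished vertices of `Y`. -/
noncomputable def rigidTMap {X Y : CSet2} (f : X ⟶ Y) : rigidT X ⟶ rigidT Y :=
  SCat.onMap (CSet.rigid.map f.hom) (CSet.vertexObj X.src) (CSet.vertexObj X.tgt) ≫
    eqToHom (rigidT_aux f)

/-- The junction vertex of `U ∨ V`. -/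
noncomputable def mid (U V : CSet2) : (wedge U V).carrier.Vertex := (inl U V).app _ U.tgt

/-- The map `𝔆^□_t(V) × 𝔆^□_t(U) → 𝔆^□_t(U ∨ V)` given by the inclusions of `U` and `V` in `U ∨ V`
followed by the composition of `𝔆^□(U ∨ V)`. -/
noncomputable def compMap (U V : CSet2) : rigidT V ⊗ rigidT U ⟶ rigidT (wedge U V) :=
  (β_ (rigidT V) (rigidT U)).hom ≫
    (rigidTMap (Y := ⟨(wedge U V).carrier, (wedge U V).src, mid U V⟩) ⟨inl U V, rfl, rfl⟩ ⊗ₘ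
      rigidTMap (Y := ⟨(wedge U V).carrier, mid U V, (wedge U V).tgt⟩)
        ⟨inr U V, (inl_tgt U V).symm, rfl⟩) ≫
      CSet.rigidComp (wedge U V).carrier (wedge U V).src (mid U V) (wedge U V).tgt

/-! ### Necklaces -/

/-- The necklace `□^{n₁} ∨ ⋯ ∨ □^{n_k}`; for `k = 0` it is `□^0`. -/
noncomputable def necklace : List ℕ → CSet2
  | [] => cube 0
  | n :: l => wedge (cube n) (necklace l)

/-- A double pointed cubical set is a necklace if it is isomorphic to a concatenation product of
cubes of positive dimension. -/
def IsNecklace (T : CSet2) : Prop :=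
  ∃ l : List ℕ, (∀ n ∈ l, 0 < n) ∧ Nonempty (T ≅ necklace l)

/-- The order on the vertices of a wedge `X ∨ Y`: the order of `X` on the vertices of `X`, the
order of `Y` on the vertices of `Y`, and the vertices of `X` are below those of `Y`. -/
inductive WedgeLE {X Y : CSet2} (r : X.carrier.Vertex → X.carrier.Vertex → Prop)
    (s : Y.carrier.Vertex → Y.carrier.Vertex → Prop) :
    (wedge X Y).carrier.Vertex → (wedge X Y).carrier.Vertex → Prop
  | left {a b : X.carrier.Vertex} (h : r a b) :
      WedgeLE r s ((inl X Y).app _ a) ((inl X Y).app _ b)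
  | right {a b : Y.carrier.Vertex} (h : s a b) :
      WedgeLE r s ((inr X Y).app _ a) ((inr X Y).app _ b)
  | cross (a : X.carrier.Vertex) (b : Y.carrier.Vertex) :
      WedgeLE r s ((inl X Y).app _ a) ((inr X Y).app _ b)

/-- The product order on the vertices of the cube `□^n`. -/
def CubeLE (n : ℕ) (a b : (cube n).carrier.Vertex) : Prop :=
  ∀ (x : Fin 0 → Bool) (i : Fin n), Subtype.val a x i ≤ Subtype.val b x i

/-- The order on the vertices of `□^{n₁} ∨ ⋯ ∨ □^{n_k}`. -/
def NecklaceLE : ∀ l : List ℕ,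
    (necklace l).carrier.Vertex → (necklace l).carrier.Vertex → Prop
  | [] => CubeLE 0
  | n :: l => WedgeLE (X := cube n) (Y := necklace l) (CubeLE n) (NecklaceLE l)

/-- The order `≼` on the vertices of a necklace. -/
def VertexLE (T : CSet2) (a b : T.carrier.Vertex) : Prop :=
  ∃ (l : List ℕ) (_ : ∀ n ∈ l, 0 < n) (e : T ≅ necklace l),
    NecklaceLE l (e.hom.hom.app _ a) (e.hom.hom.app _ b)

end CSet2

/-- A simplicial set `X` is contractible if a constant map `X → X` is simplicially homotopic to the
identity of `X`. -/
def SSetContractible (X : SSet.{0}) : Prop :=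
  ∃ x : X.obj (op (SimplexCategory.mk 0)), Nonempty (SSet.Homotopy (SSet.const x) (𝟙 X))

/-! ### Wedges -/

namespace Cube

/-! On a standard cube the comparison is an isomorphism for formal reasons: the Yoneda embedding is
fully faithful, so the unit of the Kan extension is invertible, and the comparison is its inverse.
What remains is to understand paths in a cube and to pass from two factors to their wedge.

In a cube, a nonconstant edge raises exactly one coordinate from 0 to 1, so a path is an order in
which coordinates are raised. Cubical maps never reverse the order of coordinates
(`IsCubical.le_of_ne`). Hence a square is either degenerate, and its two boundary paths coincide, or
it exchanges the raising of two coordinates i < j, the source raising j first and the target i first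
(`square_cases`). Let a nonconstant edge weigh the `height` of its target, the sum of the indices of
the coordinates equal to 1. The total weight drops strictly along a nondegenerate step, whence
antisymmetry (`cube_antisymm`). This weight is invariant under reparametrization because the weights
along a chain come from a potential on its vertices (`exists_potential`). Moreover every path is
bounded below by one that starts by raising the largest coordinate to be changed
(`exists_raise_le`), and induction produces a least path (`exists_least_cube`).

Every cube of a wedge X ∨ Y lies in X or in Y. Paths are generated by morphisms of cubes, and so are
the n-simplices of the mapping spaces of the rigidification, which is a pointwise colimit. If
nothing nontrivial leaves the last point of X or enters the first point of Y, a composite of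
generators is a morphism of X, or of Y, or one of X followed through the junction by one of Y
(`normal_of_generated`); `VertexCat` makes one argument serve for paths and for simplices. For paths
the decomposition is unique and compatible with the order, since each factor is recovered by
collapsing the other (`cross_injective`, `cross_le_cross_iff`). Thus bijectivity of the comparison,
antisymmetry and the end point conditions pass together from X and Y to X ∨ Y, which is why `Good`
bundles them. Induction on the number of cubes gives the first assertion, and the normal form of
simplices from the first to the last point gives the second.

The mapping spaces are now nerves of posets of paths. Least paths of cubes concatenate to a least
path between comparable vertices of a necklace (`exists_least_necklace`), and the nerve of a
preorder contracts onto a least element (`nerve_contractible`). -/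

lemma isCubical_toZero : ∀ (m : ℕ), IsCubical (fun _ : Fin m → Bool => (Fin.elim0 : Fin 0 → Bool))
  | 0 => by
    have : (fun _ : Fin 0 → Bool => (Fin.elim0 : Fin 0 → Bool)) = (fun x => x) := by
      funext x; exact Subsingleton.elim _ _
    rw [this]
    exact .id 0
  | m + 1 => IsCubical.comp (.degeneracy 0) (isCubical_toZero m)

/-- The map to the terminal object `[1]^0`. -/
def toZero (m : Cube) : m ⟶ (⟨0⟩ : Cube) := ⟨_, isCubical_toZero m.dim⟩

lemma hom_zero_ext {m : Cube} (f g : m ⟶ (⟨0⟩ : Cube)) : f = g :=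
  hom_ext (fun _ => funext (fun i => i.elim0))

end Cube

/-! ### Constant maps -/

namespace CSet

/-- The map to the terminal cubical set `□^0`. -/
def toPoint (S : CSet) : S ⟶ cube 0 where
  app n := ↾(fun _ => Cube.toZero n.unop)
  naturality _ _ _ := by ext; exact Cube.hom_zero_ext _ _

lemma toPoint_ext {S : CSet} (f g : S ⟶ cube 0) : f = g := by
  ext n x
  exact Cube.hom_zero_ext _ _

/-- The constant map at a vertex. -/
def constMap (S : CSet) {T : CSet} (a : T.Vertex) : S ⟶ T := toPoint S ≫ point a

lemma comp_constMap {S S' T : CSet} (f : S ⟶ S') (a : T.Vertex) :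
    f ≫ constMap S' a = constMap S a := by
  rw [constMap, constMap, ← Category.assoc, toPoint_ext (f ≫ toPoint S')]

lemma constMap_comp (S : CSet) {T T' : CSet} (a : T.Vertex) (f : T ⟶ T') :
    constMap S a ≫ f = constMap S (f.app _ a) := by
  rw [constMap, constMap, Category.assoc, point_comp]

lemma constMap_app (S : CSet) {T : CSet} (a : T.Vertex) (v : S.Vertex) :
    (constMap S a).app _ v = a := by
  refine Eq.trans ?_ (point_eq a)
  exact congrArg ((point a).app _) (Cube.hom_zero_ext _ _)

end CSet

namespace CSet2

/-! ### Retractions of a wedge onto its two factors -/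

section collapse
variable (X Y : CSet2)

/-- The map `X ∨ Y → X` collapsing `Y` to a point. -/
noncomputable def collapseRight : (wedge X Y).carrier ⟶ X.carrier :=
  glue (𝟙 _) (CSet.constMap _ X.tgt) (CSet.constMap_app _ _ _).symm

/-- The map `X ∨ Y → Y` collapsing `X` to a point. -/
noncomputable def collapseLeft : (wedge X Y).carrier ⟶ Y.carrier :=
  glue (CSet.constMap _ Y.src) (𝟙 _) (CSet.constMap_app _ _ _)

lemma inl_collapseRight : inl X Y ≫ collapseRight X Y = 𝟙 _ := inl_glue _ _ _
lemma inr_collapseRight : inr X Y ≫ collapseRight X Y = CSet.constMap _ X.tgt := inr_glue _ _ _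
lemma inl_collapseLeft : inl X Y ≫ collapseLeft X Y = CSet.constMap _ Y.src := inl_glue _ _ _
lemma inr_collapseLeft : inr X Y ≫ collapseLeft X Y = 𝟙 _ := inr_glue _ _ _

variable {X Y}

@[simp]
lemma collapseRight_inl (a : X.carrier.Vertex) :
    (collapseRight X Y).app _ ((inl X Y).app _ a) = a := glue_inl _ _ _ _
@[simp]
lemma collapseRight_inr (b : Y.carrier.Vertex) :
    (collapseRight X Y).app _ ((inr X Y).app _ b) = X.tgt :=
  (glue_inr _ _ _ _).trans (CSet.constMap_app _ _ _)
@[simp]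
lemma collapseLeft_inl (a : X.carrier.Vertex) :
    (collapseLeft X Y).app _ ((inl X Y).app _ a) = Y.src :=
  (glue_inl _ _ _ _).trans (CSet.constMap_app _ _ _)
@[simp]
lemma collapseLeft_inr (b : Y.carrier.Vertex) :
    (collapseLeft X Y).app _ ((inr X Y).app _ b) = b := glue_inr _ _ _ _

lemma inl_injective {a a' : X.carrier.Vertex}
    (h : (inl X Y).app _ a = (inl X Y).app _ a') : a = a' := by
  simpa only [collapseRight_inl] using congrArg ((collapseRight X Y).app _) h

lemma inr_injective {b b' : Y.carrier.Vertex}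
    (h : (inr X Y).app _ b = (inr X Y).app _ b') : b = b' := by
  simpa only [collapseLeft_inr] using congrArg ((collapseLeft X Y).app _) h

/-- The factors meet only at the junction: collapsing `Y` sends the common vertex both to `a` and to
the last point of `X`. -/
lemma eq_tgt_of_inl_eq_inr {a : X.carrier.Vertex} {b : Y.carrier.Vertex}
    (h : (inl X Y).app _ a = (inr X Y).app _ b) : a = X.tgt := by
  simpa only [collapseRight_inl, collapseRight_inr] using congrArg ((collapseRight X Y).app _) h

lemma eq_src_of_inl_eq_inr {a : X.carrier.Vertex} {b : Y.carrier.Vertex}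
    (h : (inl X Y).app _ a = (inr X Y).app _ b) : b = Y.src := by
  simpa only [collapseLeft_inl, collapseLeft_inr] using
    (congrArg ((collapseLeft X Y).app _) h).symm

/-- Every cube of a wedge lies in one of the two parts. -/
lemma exists_of_wedge {k : Cubeᵒᵖ} (x : (wedge X Y).carrier.obj k) :
    (∃ y, (inl X Y).app k y = x) ∨ ∃ y, (inr X Y).app k y = x := by
  have h : IsPushout (CSet.point X.tgt) (CSet.point Y.src) (inl X Y) (inr X Y) :=
    IsPushout.of_hasPushout _ _
  -- Evaluation at a cube preserves pushouts, so the claim is one about pushouts of sets.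
  exact Types.eq_or_eq_of_isPushout (h.map ((evaluation Cubeᵒᵖ Type).obj k)) x

lemma exists_factor_wedge {n : ℕ} (x : CSet.cube n ⟶ (wedge X Y).carrier) :
    (∃ y, y ≫ inl X Y = x) ∨ ∃ y, y ≫ inr X Y = x := by
  obtain ⟨y, hy⟩ | ⟨y, hy⟩ := exists_of_wedge (yonedaEquiv x)
  · refine Or.inl ⟨yonedaEquiv.symm y, yonedaEquiv.injective ?_⟩
    rw [yonedaEquiv_comp, Equiv.apply_symm_apply, hy]
  · refine Or.inr ⟨yonedaEquiv.symm y, yonedaEquiv.injective ?_⟩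
    rw [yonedaEquiv_comp, Equiv.apply_symm_apply, hy]

end collapse

end CSet2

/-! ### Paths as sequences of edges -/

namespace CPath

variable {S T : CSet} {a b c d : S.Vertex}

/-- The path consisting of one edge. -/
noncomputable def edge (e : cube 1 ⟶ (⟨S, a, b⟩ : CSet2)) : CPath S a b :=
  mk (n := 1) (star (X := cube 0) (const a) e)

/-- Lets paths grow one edge at a time. `chain (n + 1)` is by definition a wedge with one edge,
whereas `chain 1` carries an extra unit `□^0` at its start, which has to be absorbed. -/
lemma mk_star {n : ℕ} (γ : chain n ⟶ (⟨S, a, b⟩ : CSet2)) (e : cube 1 ⟶ (⟨S, b, c⟩ : CSet2)) :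
    mk (n := n + 1) (star γ e) = comp (mk γ) (edge e) := by
  refine congrArg (mk (n := n + 1)) ?_
  have h : (split n 0).hom ≫ star γ (const b) = γ :=
    CSet2.hom_ext (inl_glue γ.hom (const b).hom (γ.map_tgt.trans (const b).map_src.symm))
  change star γ e = (wedgeMap (split n 0).hom (𝟙 _) ≫ (assocIso _ _ _).hom) ≫
    star γ (star (const b) e)
  refine Eq.trans ?_ (Category.assoc _ _ _).symm
  refine Eq.trans ?_ (congrArg (wedgeMap (split n 0).hom (𝟙 _) ≫ ·)
    (assocIso_hom_star γ (const b) e)).symm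
  refine Eq.trans ?_ (wedgeMap_star _ _ _ _).symm
  exact (congrArg₂ star h (Category.id_comp e)).symm

/-- A map out of a wedge is determined by its two restrictions. -/
lemma eq_star {X Y : CSet2} (f : wedge X Y ⟶ (⟨S, a, b⟩ : CSet2)) :
    ∃ (v : S.Vertex) (g : X ⟶ ⟨S, a, v⟩) (h : Y ⟶ ⟨S, v, b⟩), f = star g h := by
  have h : (inl X Y ≫ f.hom).app _ X.tgt = (inr X Y ≫ f.hom).app _ Y.src :=
    congrArg (f.hom.app _) (inl_tgt X Y)
  refine ⟨f.hom.app _ ((inl X Y).app _ X.tgt), ⟨inl X Y ≫ f.hom, f.map_src, rfl⟩,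
    ⟨inr X Y ≫ f.hom, h.symm, f.map_tgt⟩, CSet2.hom_ext (wedge_hom_ext ?_ ?_)⟩
  · exact (inl_glue _ _ h).symm
  · exact (inr_glue _ _ h).symm

lemma mk_chain_zero (γ : chain 0 ⟶ (⟨S, a, b⟩ : CSet2)) : ∃ h : a = b, mk γ = h ▸ refl a := by
  have h : a = b := γ.map_src.symm.trans
    ((congrArg (γ.hom.app _) (Cube.hom_zero_ext _ _)).trans γ.map_tgt)
  subst h
  exact ⟨rfl, congrArg (mk (n := 0)) (CSet2.hom_ext (unit_hom_ext γ))⟩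

@[elab_as_elim]
lemma induction_snoc {motive : ∀ {b : S.Vertex}, CPath S a b → Prop} (h_refl : motive (refl a))
    (snoc : ∀ {b c : S.Vertex} (p : CPath S a b) (e : cube 1 ⟶ (⟨S, b, c⟩ : CSet2)),
      motive p → motive (comp p (edge e))) (p : CPath S a b) : motive p := by
  obtain ⟨n, γ, rfl⟩ := exists_rep p
  induction n generalizing b with
  | zero =>
    obtain ⟨rfl, h⟩ := mk_chain_zero γ
    rw [h]
    exact h_refl
  | succ n ih =>
    obtain ⟨v, g, e, rfl⟩ := eq_star γ
    rw [mk_star]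
    exact snoc _ _ (ih g)

-- Deduced from `induction_snoc`: the motive is proved for `comp p q`, for every `q` satisfying it,
-- with `p` growing at its end.
@[elab_as_elim]
lemma induction_cons {motive : ∀ {a : S.Vertex}, CPath S a b → Prop} (h_refl : motive (refl b))
    (cons : ∀ {a c : S.Vertex} (e : cube 1 ⟶ (⟨S, a, c⟩ : CSet2)) (p : CPath S c b),
      motive p → motive (comp (edge e) p)) (p : CPath S a b) : motive p := by
  have key : ∀ {c : S.Vertex} (p : CPath S a c) (q : CPath S c b), motive q →
      motive (comp p q) := by
    intro c p
    induction p using induction_snoc with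
    | h_refl => intro q hq; rwa [refl_comp]
    | snoc p e ih => intro q hq; rw [comp_assoc]; exact ih _ (cons e q hq)
  simpa only [comp_refl] using key p (refl b) h_refl

/-- The path `I_2 → □^2 → S` through `q : I_2 → □^2`. -/
lemma step_iff (p q : CPath S a b) : Step p q ↔
    ∃ (u v : S.Vertex) (p₁ : CPath S a u) (x : cube 2 ⟶ (⟨S, u, v⟩ : CSet2)) (p₂ : CPath S v b),
      p = comp (comp p₁ (mk (sourceSquare ≫ x))) p₂ ∧
      q = comp (comp p₁ (mk (targetSquare ≫ x))) p₂ := by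
  -- Both directions rest on this: a square flanked by two chains gives a composite of three paths.
  have key : ∀ {u v : S.Vertex} {k j : ℕ} (s : chain 2 ⟶ cube 2) (g : chain k ⟶ ⟨S, a, u⟩)
      (x : cube 2 ⟶ ⟨S, u, v⟩) (h : chain j ⟶ ⟨S, v, b⟩),
      mk (insertSquare s k j ≫ star (star g x) h) = comp (comp (mk g) (mk (s ≫ x))) (mk h) := by
    intro u v k j s g x h
    rw [mk_comp_mk, mk_comp_mk]
    congr 1
    simp [concat, insertSquare, wedgeMap_star]
  constructor
  · rintro ⟨k, j, f, rfl, rfl⟩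
    obtain ⟨v, f', h, rfl⟩ := eq_star f
    obtain ⟨u, g, x, rfl⟩ := eq_star f'
    exact ⟨u, v, mk g, x, mk h, key _ _ _ _, key _ _ _ _⟩
  · rintro ⟨u, v, p₁, x, p₂, rfl, rfl⟩
    obtain ⟨k, g, rfl⟩ := exists_rep p₁
    obtain ⟨j, h, rfl⟩ := exists_rep p₂
    exact ⟨k, j, star (star g x) h, (key _ _ _ _).symm, (key _ _ _ _).symm⟩

/-- A constant edge factors through the reparametrization `I_1 → I_0`. -/
lemma edge_eq_refl (e : cube 1 ⟶ (⟨S, a, a⟩ : CSet2))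
    (h : e.hom = CSet.constMap _ a) : edge e = refl a := by
  let φ : chain 1 ⟶ chain 0 := ⟨CSet.toPoint _, Cube.hom_zero_ext _ _, Cube.hom_zero_ext _ _⟩
  refine Eq.trans (congrArg (mk (n := 1)) (CSet2.hom_ext ?_)) (mk_comp φ (const a))
  have h₀ := (const a).map_tgt.trans e.map_src.symm
  refine wedge_hom_ext ((inl_glue _ _ h₀).trans ?_) ((inr_glue _ _ h₀).trans ?_)
  · exact (Category.id_comp _).symm.trans ((congrArg (· ≫ CSet.point a) (CSet.toPoint_ext (𝟙 _)
      (inl (cube 0) (cube 1) ≫ CSet.toPoint _))).trans (Category.assoc _ _ _))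
  · rw [h]
    exact (CSet.comp_constMap _ _).symm

end CPath

/-! ### Maps between cubes -/

namespace IsCubical

lemma monotone {m n : ℕ} {f : (Fin m → Bool) → (Fin n → Bool)} (hf : IsCubical f) :
    Monotone f := by
  induction hf with
  | id n => exact monotone_id
  | comp _ _ ihf ihg => exact ihg.comp ihf
  | face i ε =>
    intro x y h j
    induction j using i.succAboveCases with
    | x => simp
    | p j => simpa using h j
  | degeneracy i => exact fun x y h j => h _
  | connection i =>
    intro x y h j
    dsimp only
    split_ifs
    · exact h _
    · exact max_le_max (h _) (h _)
    · exact h _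

/-- Each coordinate of the source of a cubical map affects at most one coordinate of the target,
and the correspondence between them is monotone. -/
lemma le_of_ne {m n : ℕ} {f : (Fin m → Bool) → (Fin n → Bool)} (hf : IsCubical f)
    {p q : Fin m} (hpq : p ≤ q) {x x' y y' : Fin m → Bool} (hx : ∀ r, r ≠ p → x r = x' r)
    (hy : ∀ r, r ≠ q → y r = y' r) {k l : Fin n} (hk : f x k ≠ f x' k) (hl : f y l ≠ f y' l) :
    k ≤ l := by
  induction hf with
  | id n =>
    obtain rfl : k = p := by by_contra h; exact hk (hx k h)
    obtain rfl : l = q := by by_contra h; exact hl (hy l h)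
    exact hpq
  | @comp m n k' f g hf hg ihf ihg =>
    obtain ⟨i, hi⟩ : ∃ i, f x i ≠ f x' i := by
      by_contra! h
      exact hk (congrFun (congrArg g (funext h)) k)
    obtain ⟨j, hj⟩ : ∃ j, f y j ≠ f y' j := by
      by_contra! h
      exact hl (congrFun (congrArg g (funext h)) l)
    -- The case `p = q` of the induction hypothesis shows that `f x` and `f x'` differ only in the
    -- coordinate `i`, and `f y` and `f y'` only in `j`; so the hypothesis on `g` applies.
    refine ihg (ihf hpq hx hy hi hj) (x := f x) (x' := f x') (y := f y) (y' := f y')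
      (fun r hr => ?_) (fun r hr => ?_) hk hl
    · by_contra h
      exact hr (le_antisymm (ihf le_rfl hx hx h hi) (ihf le_rfl hx hx hi h))
    · by_contra h
      exact hr (le_antisymm (ihf le_rfl hy hy h hj) (ihf le_rfl hy hy hj h))
  | face i ε =>
    induction k using i.succAboveCases with
    | x => simp at hk
    | p k =>
      induction l using i.succAboveCases with
      | x => simp at hl
      | p l =>
        simp only [Fin.insertNth_apply_succAbove] at hk hl
        obtain rfl : k = p := by by_contra h; exact hk (hx k h)
        obtain rfl : l = q := by by_contra h; exact hl (hy l h)
        exact (Fin.strictMono_succAbove i).monotone hpq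
  | degeneracy i =>
    have hk' : i.succAbove k = p := by by_contra h; exact hk (hx _ h)
    have hl' : i.succAbove l = q := by by_contra h; exact hl (hy _ h)
    rw [← hk', ← hl'] at hpq
    exact (Fin.strictMono_succAbove i).le_iff_le.1 hpq
  | @connection n i =>
    -- Output `k` of a connection depends on input `k` when `k ≤ i` and on input `k + 1` when `i ≤
    -- k`, hence on both for `k = i`.
    have key : ∀ {p : Fin (n + 2)} {x x' : Fin (n + 2) → Bool} {k : Fin (n + 1)},
        (∀ r, r ≠ p → x r = x' r) →
        (if k < i then x k.castSucc else if k = i then max (x k.castSucc) (x k.succ)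
          else x k.succ) ≠
        (if k < i then x' k.castSucc else if k = i then max (x' k.castSucc) (x' k.succ)
          else x' k.succ) →
        (k.castSucc = p ∧ k ≤ i) ∨ (k.succ = p ∧ i ≤ k) := by
      intro p x x' k hx hk
      by_contra! h
      split_ifs at hk with h₁ h₂
      · exact hk (hx _ (fun h' => absurd h₁.le (not_le.2 (h.1 h'))))
      · exact hk (congrArg₂ max (hx _ (fun h' => (h.1 h').ne' h₂)) (hx _ (fun h' => (h.2 h').ne h₂)))
      · exact hk (hx _ (fun h' => h₁ (h.2 h')))
    have hk' := key hx hk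
    have hl' := key hy hl
    simp only [Fin.ext_iff, Fin.le_def, Fin.val_castSucc, Fin.val_succ] at hk' hl' hpq ⊢
    omega

/-- The inclusion of an edge. -/
lemma edge {n : ℕ} (i : Fin n) (a : Fin n → Bool) :
    IsCubical (fun (x : Fin 1 → Bool) (k : Fin n) => if k = i then x 0 else a k) := by
  induction n with
  | zero => exact i.elim0
  | succ n ih =>
    -- A coordinate other than `i` is constant along the edge and can be inserted last, by a face.
    -- This stops at the identity of `□^1`.
    by_cases h : ∃ k, k ≠ i
    · obtain ⟨k, hk⟩ := h
      obtain ⟨i, rfl⟩ := Fin.exists_succAbove_eq hk.symm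
      convert! (ih i (k.removeNth a)).comp (.face k (a k)) using 1
      funext x j
      induction j using k.succAboveCases with
      | x => simp [hk]
      | p j => simp [Fin.removeNth]
    · push Not at h
      have hn : n = 0 := by
        by_contra hn
        have : Nontrivial (Fin (n + 1)) := Fin.nontrivial_iff_two_le.2 (by omega)
        obtain ⟨k, hk⟩ := exists_ne i
        exact hk (h k)
      subst hn
      convert! IsCubical.id 1 using 1
      funext x j
      simp [h j, ← h 0]

/-- The inclusion of a square. -/
lemma square {n : ℕ} {i j : Fin n} (hij : i < j) (a : Fin n → Bool) :
    IsCubical (fun (x : Fin 2 → Bool) (k : Fin n) =>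
      if k = i then x 0 else if k = j then x 1 else a k) := by
  induction n with
  | zero => exact i.elim0
  | succ n ih =>
    -- The constant coordinates are again inserted by faces, until only `i < j` remain and the map
    -- is the identity of `□^2`.
    by_cases h : ∃ k, k ≠ i ∧ k ≠ j
    · obtain ⟨k, hki, hkj⟩ := h
      obtain ⟨i, rfl⟩ := Fin.exists_succAbove_eq hki.symm
      obtain ⟨j, rfl⟩ := Fin.exists_succAbove_eq hkj.symm
      convert! (ih ((Fin.strictMono_succAbove k).lt_iff_lt.1 hij) (k.removeNth a)).comp
        (.face k (a k)) using 1
      funext x l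
      induction l using k.succAboveCases with
      | x => simp [hki, hkj]
      | p l => simp [Fin.removeNth]
    · push Not at h
      have hn : n = 1 := by
        have h0 := h 0
        have h1 := h (Fin.last n)
        have hij' : (i : ℕ) < j := hij
        have hj := j.2
        rcases Nat.lt_or_ge n 2 with hn | hn
        · omega
        · have h2 := h ⟨1, by omega⟩
          simp only [Fin.ext_iff, Fin.val_zero, Fin.val_last, ne_eq] at h0 h1 h2
          omega
      subst hn
      obtain rfl : i = 0 := by have := j.2; have : (i : ℕ) < j := hij; ext; simp; omega
      obtain rfl : j = 1 := by have := j.2; ext; have : (0 : ℕ) < j := hij; simp; omega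
      convert! IsCubical.id 2 using 1
      funext x l
      fin_cases l <;> simp

end IsCubical

/-! ### Cubes in coordinates -/

namespace CSet

variable {l m n : ℕ}

/-- The coordinates of a vertex of the cube. -/
def coord (a : (cube n).Vertex) : Fin n → Bool := Subtype.val a Fin.elim0

lemma coord_vertex (v : Fin n → Bool) : coord (Cube.vertex v) = v := rfl

lemma vertex_coord (a : (cube n).Vertex) : Cube.vertex (coord a) = a :=
  Cube.hom_ext (fun x => congrArg a.1 (Subsingleton.elim _ x))

lemma coord_injective {a b : (cube n).Vertex} (h : coord a = coord b) : a = b := by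
  rw [← vertex_coord a, ← vertex_coord b, h]

/-- The map of posets underlying a map of cubes. -/
def fn (x : cube m ⟶ cube n) : (Fin m → Bool) → (Fin n → Bool) := Subtype.val (yonedaEquiv x)

lemma isCubical_fn (x : cube m ⟶ cube n) : IsCubical (fn x) := Subtype.prop (yonedaEquiv x)

lemma fn_injective {x y : cube m ⟶ cube n} (h : fn x = fn y) : x = y :=
  yonedaEquiv.injective (Subtype.ext h)

/-- The map of cubes given by a cubical map of posets. -/
def ofFn (f : (Fin m → Bool) → (Fin n → Bool)) (hf : IsCubical f) : cube m ⟶ cube n :=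
  yoneda.map (⟨f, hf⟩ : (⟨m⟩ : Cube) ⟶ ⟨n⟩)

@[simp]
lemma fn_ofFn (f : (Fin m → Bool) → (Fin n → Bool)) (hf : IsCubical f) : fn (ofFn f hf) = f := rfl

lemma app_eq_comp (x : cube m ⟶ cube n) {k : Cube} (a : k ⟶ ⟨m⟩) :
    x.app (op k) a = a ≫ yonedaEquiv x := by
  have := NatTrans.naturality_apply x a.op (𝟙 (⟨m⟩ : Cube))
  refine Eq.trans ?_ this
  exact congrArg (x.app (op k)) (Category.comp_id a).symm

lemma coord_app (x : cube m ⟶ cube n) (a : (cube m).Vertex) :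
    coord (x.app _ a) = fn x (coord a) :=
  congrArg coord (app_eq_comp x a)

lemma fn_comp (x : cube l ⟶ cube m) (y : cube m ⟶ cube n) : fn (x ≫ y) = fn y ∘ fn x :=
  congrArg Subtype.val (app_eq_comp y (yonedaEquiv x))

lemma fn_constMap (a : (cube n).Vertex) : fn (constMap (cube m) a) = fun _ => coord a := by
  refine (fn_comp _ _).trans ?_
  have : fn (point a) = fun _ => coord a := by
    funext x
    have h := coord_app (point a) (Cube.vertex x)
    rw [coord_vertex] at h
    rw [← h]
    refine congrArg coord ((congrArg ((point a).app _) (Cube.hom_zero_ext _ _)).trans (point_eq a))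
  rw [this]
  rfl

lemma fin_one_eq (x : Fin 1 → Bool) : x = (fun _ => false) ∨ x = (fun _ => true) := by
  cases h : x 0
  · exact Or.inl (funext (fun i => by rw [Subsingleton.elim i 0, h]))
  · exact Or.inr (funext (fun i => by rw [Subsingleton.elim i 0, h]))

/-- The edges of a cube are determined by their end points. -/
lemma edge_ext {x y : cube 1 ⟶ cube n} (h₀ : fn x (fun _ => false) = fn y (fun _ => false))
    (h₁ : fn x (fun _ => true) = fn y (fun _ => true)) : x = y := by
  apply fn_injective
  funext v
  obtain rfl | rfl := fin_one_eq v
  · exact h₀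
  · exact h₁

lemma edge_eq_constMap (x : cube 1 ⟶ cube n) (h : fn x (fun _ => false) = fn x (fun _ => true)) :
    x = constMap (cube 1) (x.app _ (CSet2.cube 1).src) := by
  have h' : coord (x.app _ (CSet2.cube 1).src) = fn x (fun _ => false) := coord_app x _
  apply edge_ext
  · rw [fn_constMap, h']
  · rw [fn_constMap, h', h]

end CSet

/-! ### Additive invariants of paths -/

namespace CPath

section cost

variable {S : CSet} {a b c : S.Vertex} (w : (CSet.cube 1 ⟶ S) → ℕ)

/-- The sum of the weights of the edges of a map `I_n → S`. -/
noncomputable def costHom : ∀ n : ℕ, ((chain n).carrier ⟶ S) → ℕ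
  | 0, _ => 0
  | n + 1, γ => costHom n (inl (chain n) (cube 1) ≫ γ) + w (inr (chain n) (cube 1) ≫ γ)

/-- Monotonicity excludes the flip of the interval. -/
lemma end_cube_one (y : CSet.cube 1 ⟶ CSet.cube 1) :
    y = 𝟙 _ ∨ y = CSet.constMap _ (y.app _ (cube 1).src) := by
  by_cases h : CSet.fn y (fun _ => false) = CSet.fn y (fun _ => true)
  · exact Or.inr (CSet.edge_eq_constMap y h)
  · left
    have hm := (CSet.isCubical_fn y).monotone (a := fun _ => false) (b := fun _ => true)
      (fun _ => Bool.false_le _)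
    obtain h₀ | h₀ := CSet.fin_one_eq (CSet.fn y (fun _ => false)) <;>
    obtain h₁ | h₁ := CSet.fin_one_eq (CSet.fn y (fun _ => true))
    · exact absurd (h₀.trans h₁.symm) h
    · exact CSet.edge_ext h₀ h₁
    · rw [h₀, h₁] at hm
      exact absurd (hm 0) (by decide)
    · exact absurd (h₀.trans h₁.symm) h

/-- The weights of the edges of a chain come from a potential on its vertices. -/
lemma exists_potential (hw : ∀ v : S.Vertex, w (CSet.constMap _ v) = 0) :
    ∀ (m : ℕ) (γ : (chain m).carrier ⟶ S), ∃ E : (chain m).carrier.Vertex → ℕ,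
      E (chain m).src = 0 ∧ E (chain m).tgt = costHom w m γ ∧
      ∀ e : CSet.cube 1 ⟶ (chain m).carrier,
        E (e.app _ (cube 1).src) + w (e ≫ γ) = E (e.app _ (cube 1).tgt)
  | 0, γ => by
    refine ⟨fun _ => 0, rfl, rfl, fun e => ?_⟩
    -- All edges of `□^0` are constant, and constants weigh nothing.
    have : e ≫ γ = CSet.constMap _ (yonedaEquiv γ) := by
      exact congrArg₂ (· ≫ ·) (CSet.toPoint_ext e (CSet.toPoint _))
        (yonedaEquiv.symm_apply_apply γ).symm
    rw [this, hw]
  | m + 1, γ => by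
    classical
    obtain ⟨E, h₀, h₁, hE⟩ := exists_potential hw m (inl (chain m) (cube 1) ≫ γ)
    have hne : (cube 1).tgt ≠ (cube 1).src := fun h =>
      absurd (congrFun (congrArg CSet.coord h) 0) (by decide)
    -- Potential on the last edge: zero at its start, its whole weight at its end.
    let g : (cube 1).carrier.Vertex → ℕ := fun v =>
      if v = (cube 1).src then 0 else w (inr (chain m) (cube 1) ≫ γ)
    have g₀ : g (cube 1).src = 0 := if_pos rfl
    have g₁ : g (cube 1).tgt = w (inr (chain m) (cube 1) ≫ γ) := if_neg hne
    -- The two potentials are added after collapsing. On `chain m` the second term vanishes; on the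
    -- last edge the first one is the total weight of `chain m`.
    let E' : (wedge (chain m) (cube 1)).carrier.Vertex → ℕ := fun v =>
      E ((collapseRight _ _).app _ v) + g ((collapseLeft _ _).app _ v)
    have El : ∀ v, E' ((inl _ _).app _ v) = E v := fun v => by
      change E _ + g _ = _
      rw [collapseRight_inl, collapseLeft_inl, g₀, add_zero]
    have Er : ∀ v, E' ((inr _ _).app _ v) = costHom w m (inl (chain m) (cube 1) ≫ γ) + g v :=
      fun v => by
        change E _ + g _ = _
        rw [collapseRight_inr, collapseLeft_inr, h₁]
    refine ⟨E', (El _).trans h₀, (Er _).trans (congrArg _ g₁), fun e => ?_⟩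
    obtain ⟨y, hy⟩ | ⟨y, hy⟩ := exists_factor_wedge (X := chain m) (Y := cube 1) e
    · subst hy
      refine Eq.trans ?_ ((hE y).trans (El _).symm)
      exact congrArg₂ (· + ·) (El _) (congrArg w (Category.assoc _ _ _))
    · subst hy
      -- An edge lying in the last `□^1` is either that edge itself or constant.
      have key : g (y.app _ (cube 1).src) + w (y ≫ inr (chain m) (cube 1) ≫ γ) =
          g (y.app _ (cube 1).tgt) := by
        obtain hy | hy := end_cube_one y
        · subst hy
          refine Eq.trans ?_ (g₁.symm : _ = g ((cube 1).tgt))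
          refine (congrArg₂ (· + ·) (g₀ : g ((cube 1).src) = 0)
            (congrArg w (Category.id_comp _))).trans (zero_add _)
        · generalize y.app _ (cube 1).src = v at hy
          subst hy
          have h : w (CSet.constMap _ v ≫ inr (chain m) (cube 1) ≫ γ) = 0 :=
            (congrArg w (CSet.constMap_comp _ _ _)).trans (hw _)
          refine (congrArg₂ (· + ·) rfl h).trans ((add_zero _).trans ?_)
          exact congrArg g (CSet.constMap_app _ _ _).symm
      refine Eq.trans ?_ (Er (y.app _ (cube 1).tgt)).symm
      rw [← key, ← add_assoc]
      exact congrArg₂ (· + ·) (Er _) (congrArg w (Category.assoc _ _ _))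

/-- The weights along the reparametrized chain telescope to the difference of the potential between
its end points, and `φ` preserves these. -/
lemma costHom_comp (hw : ∀ v : S.Vertex, w (CSet.constMap _ v) = 0) {n m : ℕ}
    (φ : chain n ⟶ chain m) (γ : (chain m).carrier ⟶ S) :
    costHom w n (φ.hom ≫ γ) = costHom w m γ := by
  obtain ⟨E, h₀, h₁, hE⟩ := exists_potential w hw m γ
  have key : ∀ (n : ℕ) (φ : (chain n).carrier ⟶ (chain m).carrier),
      φ.app _ (chain n).src = (chain m).src →
        costHom w n (φ ≫ γ) = E (φ.app _ (chain n).tgt) := by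
    intro n
    induction n with
    | zero =>
      intro φ hφ
      refine (h₀.symm.trans (congrArg E hφ.symm)).trans ?_
      exact congrArg (fun v => E (φ.app _ v)) (Cube.hom_zero_ext _ _)
    | succ n ih =>
      intro φ hφ
      refine Eq.trans ?_ (hE (inr (chain n) (cube 1) ≫ φ))
      refine congrArg₂ (· + ·) ?_ rfl
      refine (ih (inl (chain n) (cube 1) ≫ φ) hφ).trans ?_
      exact congrArg (fun v => E (φ.app _ v)) (inl_tgt (chain n) (cube 1))
  rw [key n φ.hom φ.map_src, φ.map_tgt, h₁]

variable (hw : ∀ v : S.Vertex, w (CSet.constMap _ v) = 0)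

/-- The sum of the weights of the edges of a path. -/
noncomputable def cost (p : CPath S a b) : ℕ :=
  Quot.lift (fun γ : (Σ n : ℕ, (chain n ⟶ (⟨S, a, b⟩ : CSet2))) => costHom w γ.1 γ.2.hom) (by
    rintro ⟨n, γ⟩ ⟨m, γ'⟩ ⟨φ, h⟩
    dsimp only at φ h
    subst h
    exact costHom_comp w hw φ γ'.hom) p

lemma cost_comp_edge (p : CPath S a b) (e : cube 1 ⟶ (⟨S, b, c⟩ : CSet2)) :
    cost w hw (comp p (edge e)) = cost w hw p + w e.hom := by
  obtain ⟨n, γ, rfl⟩ := exists_rep p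
  rw [← mk_star]
  have h := γ.map_tgt.trans e.map_src.symm
  exact congrArg₂ (· + ·) (congrArg (costHom w n) (inl_glue γ.hom e.hom h))
    (congrArg w (inr_glue γ.hom e.hom h))

lemma cost_refl : cost w hw (refl a) = 0 := rfl

lemma cost_edge (e : cube 1 ⟶ (⟨S, a, b⟩ : CSet2)) : cost w hw (edge e) = w e.hom := by
  have := cost_comp_edge w hw (refl a) e
  rwa [refl_comp, cost_refl, zero_add] at this

lemma cost_comp (p : CPath S a b) (q : CPath S b c) :
    cost w hw (comp p q) = cost w hw p + cost w hw q := by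
  induction q using induction_snoc with
  | h_refl => rw [comp_refl, cost_refl, add_zero]
  | snoc q e ih => rw [← comp_assoc, cost_comp_edge, cost_comp_edge, ih, add_assoc]

end cost

/-! ### The two boundary paths of a square -/

section square

variable {S : CSet} {u v : S.Vertex}

lemma star_comp {X Y Z : CSet2} {a b c : S.Vertex} {m : Z.carrier.Vertex}
    (f : X ⟶ ⟨Z.carrier, Z.src, m⟩) (g : Y ⟶ ⟨Z.carrier, m, Z.tgt⟩) (x : Z ⟶ ⟨S, a, c⟩)
    (f' : X ⟶ ⟨S, a, b⟩) (g' : Y ⟶ ⟨S, b, c⟩) (hf : f'.hom = f.hom ≫ x.hom)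
    (hg : g'.hom = g.hom ≫ x.hom) : star f g ≫ x = star f' g' := by
  have h := f.map_tgt.trans g.map_src.symm
  have h' := f'.map_tgt.trans g'.map_src.symm
  refine CSet2.hom_ext (wedge_hom_ext ?_ ?_)
  · exact (inl_glue_assoc _ _ h _).trans (hf.symm.trans (inl_glue _ _ h').symm)
  · exact (inr_glue_assoc _ _ h _).trans (hg.symm.trans (inr_glue _ _ h').symm)

lemma mk_star_star {a b c : S.Vertex} (e : cube 1 ⟶ (⟨S, a, b⟩ : CSet2))
    (e' : cube 1 ⟶ (⟨S, b, c⟩ : CSet2)) :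
    mk (n := 2) (star (X := chain 1) (star (X := chain 0) (const a) e) e') =
      comp (edge e) (edge e') :=
  mk_star _ _

/-- Serves the source and the target of a square alike. `I_2` begins with the unit `□^0`, whence the
constant map in `hs`. -/
lemma mk_two_comp {m : (CSet.cube 2).Vertex} {w : S.Vertex} (s : chain 2 ⟶ cube 2)
    (e : cube 1 ⟶ (⟨CSet.cube 2, (cube 2).src, m⟩ : CSet2))
    (e' : cube 1 ⟶ (⟨CSet.cube 2, m, (cube 2).tgt⟩ : CSet2))
    (hs : s = star (X := chain 1) (star (X := chain 0) (const (cube 2).src) e) e')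
    (x : cube 2 ⟶ (⟨S, u, v⟩ : CSet2)) (f : cube 1 ⟶ (⟨S, u, w⟩ : CSet2))
    (f' : cube 1 ⟶ (⟨S, w, v⟩ : CSet2)) (hf : f.hom = e.hom ≫ x.hom)
    (hf' : f'.hom = e'.hom ≫ x.hom) :
    mk (s ≫ x) = comp (edge f) (edge f') := by
  subst hs
  refine Eq.trans (congrArg (mk (n := 2)) ?_) (mk_star_star _ _)
  refine star_comp (Z := cube 2) _ _ x _ _ ?_ hf'
  have h := (const (cube 2).src).map_tgt.trans e.map_src.symm
  have h' := (const u).map_tgt.trans f.map_src.symm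
  refine wedge_hom_ext ?_ ?_
  · refine (inl_glue _ _ h').trans (Eq.trans ?_ (inl_glue_assoc _ _ h x.hom).symm)
    exact (congrArg CSet.point x.map_src.symm).trans (CSet.point_comp _ _).symm
  · exact (inr_glue _ _ h').trans (hf.trans (inr_glue_assoc _ _ h x.hom).symm)

lemma mk_sourceSquare_comp {w : S.Vertex} (x : cube 2 ⟶ (⟨S, u, v⟩ : CSet2))
    (f : cube 1 ⟶ (⟨S, u, w⟩ : CSet2)) (f' : cube 1 ⟶ (⟨S, w, v⟩ : CSet2))
    (hf : f.hom = faceMap 0 false ≫ x.hom) (hf' : f'.hom = faceMap 1 true ≫ x.hom) :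
    mk (sourceSquare ≫ x) = comp (edge f) (edge f') :=
  mk_two_comp _ _ _ rfl x f f' hf hf'

lemma mk_targetSquare_comp {w : S.Vertex} (x : cube 2 ⟶ (⟨S, u, v⟩ : CSet2))
    (f : cube 1 ⟶ (⟨S, u, w⟩ : CSet2)) (f' : cube 1 ⟶ (⟨S, w, v⟩ : CSet2))
    (hf : f.hom = faceMap 1 false ≫ x.hom) (hf' : f'.hom = faceMap 0 true ≫ x.hom) :
    mk (targetSquare ≫ x) = comp (edge f) (edge f') :=
  mk_two_comp _ _ _ rfl x f f' hf hf'

end square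

end CPath

/-! ### Paths in cubes -/

lemma Bool.eq_of_le_of_ne {x y : Bool} (h : x ≤ y) (h' : x ≠ y) : x = false ∧ y = true := by
  revert h h'; cases x <;> cases y <;> decide

namespace CPath

section cube

variable {n : ℕ} {a b c d : (CSet.cube n).Vertex}

lemma fn_src (e : cube 1 ⟶ (⟨CSet.cube n, a, b⟩ : CSet2)) :
    CSet.fn e.hom (fun _ => false) = CSet.coord a := by
  have h : CSet.coord (e.hom.app _ (cube 1).src) = CSet.fn e.hom (fun _ => false) :=
    CSet.coord_app e.hom _
  rw [← h, e.map_src]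

lemma fn_tgt (e : cube 1 ⟶ (⟨CSet.cube n, a, b⟩ : CSet2)) :
    CSet.fn e.hom (fun _ => true) = CSet.coord b := by
  have h : CSet.coord (e.hom.app _ (cube 1).tgt) = CSet.fn e.hom (fun _ => true) :=
    CSet.coord_app e.hom _
  rw [← h, e.map_tgt]

/-- An edge of a cube is determined by its end points. -/
lemma edgeHom_unique (e e' : cube 1 ⟶ (⟨CSet.cube n, a, b⟩ : CSet2)) : e = e' :=
  CSet2.hom_ext (CSet.edge_ext ((fn_src e).trans (fn_src e').symm)
    ((fn_tgt e).trans (fn_tgt e').symm))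

lemma edge_loop (e : cube 1 ⟶ (⟨CSet.cube n, a, a⟩ : CSet2)) : edge e = refl a := by
  refine edge_eq_refl e ?_
  refine (CSet.edge_eq_constMap e.hom ((fn_src e).trans (fn_tgt e).symm)).trans ?_
  exact congrArg (CSet.constMap _) e.map_src

lemma coord_le_of_edge (e : cube 1 ⟶ (⟨CSet.cube n, a, b⟩ : CSet2)) :
    CSet.coord a ≤ CSet.coord b := by
  rw [← fn_src e, ← fn_tgt e]
  exact (CSet.isCubical_fn e.hom).monotone (fun _ => Bool.false_le _)

lemma coord_le (p : CPath (CSet.cube n) a b) : CSet.coord a ≤ CSet.coord b := by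
  induction p using induction_snoc with
  | h_refl => exact le_rfl
  | snoc p e ih => exact ih.trans (coord_le_of_edge e)

/-- A cube has no nontrivial loops. -/
lemma loop_eq_refl (p : CPath (CSet.cube n) a a) : p = refl a := by
  -- Induction needs a free end point, so the path may end at any `b` equal to `a`.
  have key : ∀ {b : (CSet.cube n).Vertex} (p : CPath (CSet.cube n) a b) (h : a = b),
      p = h ▸ refl a := by
    intro b p
    induction p using induction_snoc with
    | h_refl => exact fun _ => rfl
    | @snoc b c p e ih =>
      intro h
      subst h
      -- Coordinates only increase, both along the rest of the path and along its last edge, so each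
      -- of them is a loop.
      obtain rfl : a = b :=
        CSet.coord_injective (le_antisymm (coord_le p) (coord_le_of_edge e))
      rw [ih rfl, edge_loop e, refl_comp]
  exact key p rfl

/-- This covers the degenerate squares: the middle vertices agree, or each boundary path consists of
the same edge and a constant one. -/
lemma comp_edge_edge_eq {m m' : (CSet.cube n).Vertex} (h : m = m' ∨ (m = a ∧ m' = b) ∨
      (m = b ∧ m' = a))
    (e : cube 1 ⟶ (⟨CSet.cube n, a, m⟩ : CSet2)) (f : cube 1 ⟶ (⟨CSet.cube n, m, b⟩ : CSet2))
    (e' : cube 1 ⟶ (⟨CSet.cube n, a, m'⟩ : CSet2)) (f' : cube 1 ⟶ (⟨CSet.cube n, m', b⟩ : CSet2)) :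
    comp (edge e) (edge f) = comp (edge e') (edge f') := by
  obtain rfl | ⟨rfl, rfl⟩ | ⟨rfl, rfl⟩ := h
  · rw [edgeHom_unique e e', edgeHom_unique f f']
  · rw [edge_loop e, edge_loop f', comp_refl, refl_comp, edgeHom_unique f e']
  · rw [edge_loop f, edge_loop e', edgeHom_unique e f', comp_refl, refl_comp]

/-- The sum of the indices of the coordinates of `v` which are equal to `1`. -/
def height (v : Fin n → Bool) : ℕ := ∑ k, if v k then (k : ℕ) else 0

lemma height_update (v : Fin n → Bool) (j : Fin n) (hj : v j = false) :
    height (Function.update v j true) = height v + j := by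
  classical
  rw [height, height, ← Finset.add_sum_erase _ _ (Finset.mem_univ j),
    ← Finset.add_sum_erase _ (fun k : Fin n => if v k = true then (k : ℕ) else 0)
      (Finset.mem_univ j)]
  have : ∑ x ∈ Finset.univ.erase j, (if Function.update v j true x = true then (x : ℕ) else 0) =
      ∑ x ∈ Finset.univ.erase j, (if v x = true then (x : ℕ) else 0) :=
    Finset.sum_congr rfl (fun k hk => by
      rw [Function.update_of_ne (Finset.ne_of_mem_erase hk)])
  rw [this]
  simp [hj, add_comm]

/-- The weight of an edge. -/
noncomputable def weight (e : CSet.cube 1 ⟶ CSet.cube n) : ℕ :=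
  if CSet.fn e (fun _ => false) = CSet.fn e (fun _ => true) then 0
  else height (CSet.fn e (fun _ => true))

/-- The condition that makes the total weight invariant under reparametrization. -/
lemma weight_constMap (v : (CSet.cube n).Vertex) : weight (CSet.constMap (CSet.cube 1) v) = 0 := by
  simp [weight, CSet.fn_constMap]

lemma weight_eq (e : cube 1 ⟶ (⟨CSet.cube n, a, b⟩ : CSet2)) (h : a ≠ b) :
    weight e.hom = height (CSet.coord b) := by
  refine (if_neg ?_).trans (congrArg height (fn_tgt e))
  rw [fn_src, fn_tgt]
  exact fun h' => h (CSet.coord_injective h')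

/-- By `le_of_ne` with `p = q` at most one coordinate of the output changes, and by monotonicity it
changes from 0 to 1. -/
lemma eq_update_of_edge {m : ℕ} {f : (Fin m → Bool) → (Fin n → Bool)} (hf : IsCubical f)
    {p : Fin m} {x x' : Fin m → Bool} (hxx : x ≤ x') (hx : ∀ r, r ≠ p → x r = x' r) {k : Fin n}
    (hk : f x k ≠ f x' k) : f x k = false ∧ f x' = Function.update (f x) k true := by
  have h₀ : f x k = false ∧ f x' k = true := Bool.eq_of_le_of_ne (hf.monotone hxx k) hk
  refine ⟨h₀.1, funext (fun l => ?_)⟩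
  by_cases hl : l = k
  · subst hl; simp [h₀.2]
  · rw [Function.update_of_ne hl]
    by_contra hl'
    exact hl (le_antisymm (hf.le_of_ne le_rfl hx hx (Ne.symm hl') hk)
      (hf.le_of_ne le_rfl hx hx hk (Ne.symm hl')))

/-- The shapes of the squares of a cube. -/
lemma square_cases {f : (Fin 2 → Bool) → (Fin n → Bool)} (hf : IsCubical f) :
    (f ![false, true] = f ![true, false] ∨
      (f ![false, true] = f ![false, false] ∧ f ![true, false] = f ![true, true]) ∨
      (f ![false, true] = f ![true, true] ∧ f ![true, false] = f ![false, false])) ∨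
    (f ![false, false] ≠ f ![false, true] ∧ f ![false, false] ≠ f ![true, false] ∧
      f ![false, true] ≠ f ![true, true] ∧ f ![true, false] ≠ f ![true, true] ∧
      height (f ![true, false]) < height (f ![false, true])) := by
  have d0 : ∀ ε : Bool, ∀ r : Fin 2, r ≠ 0 → (![false, ε] : Fin 2 → Bool) r = ![true, ε] r := by
    decide
  have d1 : ∀ ε : Bool, ∀ r : Fin 2, r ≠ 1 → (![ε, false] : Fin 2 → Bool) r = ![ε, true] r := by
    decide
  have l0 : ∀ ε : Bool, (![false, ε] : Fin 2 → Bool) ≤ ![true, ε] := by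
    intro ε i; fin_cases i <;> simp
  have l1 : ∀ ε : Bool, (![ε, false] : Fin 2 → Bool) ≤ ![ε, true] := by
    intro ε i; fin_cases i <;> simp
  by_cases hA : f ![false, false] = f ![false, true] <;>
  by_cases hB : f ![false, false] = f ![true, false]
  · exact Or.inl (Or.inl (hA.symm.trans hB))
  · left; right; left
    refine ⟨hA.symm, ?_⟩
    obtain ⟨i, hi⟩ := Function.ne_iff.1 hB
    obtain ⟨hi₀, hi₁⟩ := eq_update_of_edge hf (l0 _) (d0 _) hi
    -- Coordinate `i` also changes along the opposite edge: by `hA` it is 0 at the start, and at the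
    -- end it is at least its value 1 at `![true, false]`. So both opposite edges raise `i` and
    -- nothing else.
    have hi' : f ![false, true] i ≠ f ![true, true] i := by
      have := hf.monotone (l1 true) i
      rw [hi₁, Function.update_self] at this
      rw [← hA, hi₀, Bool.eq_true_of_true_le this]
      decide
    obtain ⟨-, h⟩ := eq_update_of_edge hf (l0 _) (d0 _) hi'
    rw [hi₁, h, hA]
  · left; right; right
    refine ⟨?_, hB.symm⟩
    obtain ⟨i, hi⟩ := Function.ne_iff.1 hA
    obtain ⟨hi₀, hi₁⟩ := eq_update_of_edge hf (l1 _) (d1 _) hi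
    have hi' : f ![true, false] i ≠ f ![true, true] i := by
      have := hf.monotone (l0 true) i
      rw [hi₁, Function.update_self] at this
      rw [← hB, hi₀, Bool.eq_true_of_true_le this]
      decide
    obtain ⟨-, h⟩ := eq_update_of_edge hf (l1 _) (d1 _) hi'
    rw [hi₁, h, hB]
  · obtain ⟨j, hj⟩ := Function.ne_iff.1 hA
    obtain ⟨i, hi⟩ := Function.ne_iff.1 hB
    obtain ⟨hi₀, hi₁⟩ := eq_update_of_edge hf (l0 _) (d0 _) hi
    obtain ⟨hj₀, hj₁⟩ := eq_update_of_edge hf (l1 _) (d1 _) hj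
    -- This inequality is what orients the squares.
    have hij : i ≤ j := hf.le_of_ne (Fin.zero_le 1) (d0 _) (d1 _) hi hj
    -- If `i = j`, as for a connection, the two middle vertices coincide.
    obtain rfl | hij := hij.eq_or_lt
    · exact Or.inl (Or.inl (hj₁.trans hi₁.symm))
    · right
      have ti := hf.monotone (l1 true) i
      have tj := hf.monotone (l0 true) j
      rw [hi₁, Function.update_self] at ti
      rw [hj₁, Function.update_self] at tj
      refine ⟨hA, hB, fun h => ?_, fun h => ?_, ?_⟩
      · rw [← h, hj₁, Function.update_of_ne hij.ne, hi₀] at ti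
        exact absurd (Bool.eq_true_of_true_le ti) (by decide)
      · rw [← h, hi₁, Function.update_of_ne hij.ne', hj₀] at tj
        exact absurd (Bool.eq_true_of_true_le tj) (by decide)
      · rw [hi₁, hj₁, height_update _ _ hi₀, height_update _ _ hj₀]
        exact Nat.add_lt_add_left hij _

lemma coord_square (x : cube 2 ⟶ (⟨CSet.cube n, a, b⟩ : CSet2)) (ε ε' : Bool) :
    CSet.coord (x.hom.app _ (Cube.vertex ![ε, ε'])) = CSet.fn x.hom ![ε, ε'] :=
  CSet.coord_app x.hom _

lemma square_src (x : cube 2 ⟶ (⟨CSet.cube n, a, b⟩ : CSet2)) :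
    CSet.coord a = CSet.fn x.hom ![false, false] := by
  rw [← coord_square]
  refine congrArg CSet.coord (x.map_src.symm.trans (congrArg (x.hom.app _) ?_))
  exact CSet.coord_injective (by change _ = ![false, false]; funext i; fin_cases i <;> rfl)

lemma square_tgt (x : cube 2 ⟶ (⟨CSet.cube n, a, b⟩ : CSet2)) :
    CSet.coord b = CSet.fn x.hom ![true, true] := by
  rw [← coord_square]
  refine congrArg CSet.coord (x.map_tgt.symm.trans (congrArg (x.hom.app _) ?_))
  exact CSet.coord_injective (by change _ = ![true, true]; funext i; fin_cases i <;> rfl)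

lemma coord_face_comp (x : CSet.cube 2 ⟶ CSet.cube n) (i : Fin 2) (ε : Bool)
    (v : (CSet.cube 1).Vertex) :
    CSet.coord ((faceMap i ε ≫ x).app _ v) =
      CSet.fn x (i.insertNth ε (CSet.coord v) : Fin 2 → Bool) := by
  rw [CSet.coord_app, CSet.fn_comp]
  rfl

lemma insert_zero (ε ε' : Bool) :
    ((0 : Fin 2).insertNth ε (fun _ => ε') : Fin 2 → Bool) = ![ε, ε'] := by
  funext i; fin_cases i <;> rfl

lemma insert_one (ε ε' : Bool) :
    ((1 : Fin 2).insertNth ε (fun _ => ε') : Fin 2 → Bool) = ![ε', ε] := by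
  funext i; fin_cases i <;> rfl

/-- The two paths along a square of a cube. -/
lemma exists_square_edges (x : cube 2 ⟶ (⟨CSet.cube n, a, b⟩ : CSet2)) :
    ∃ (m m' : (CSet.cube n).Vertex)
      (e : cube 1 ⟶ (⟨CSet.cube n, a, m⟩ : CSet2)) (f : cube 1 ⟶ (⟨CSet.cube n, m, b⟩ : CSet2))
      (e' : cube 1 ⟶ (⟨CSet.cube n, a, m'⟩ : CSet2))
      (f' : cube 1 ⟶ (⟨CSet.cube n, m', b⟩ : CSet2)),
      CSet.coord m = CSet.fn x.hom ![false, true] ∧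
      CSet.coord m' = CSet.fn x.hom ![true, false] ∧
      mk (sourceSquare ≫ x) = comp (edge e) (edge f) ∧
      mk (targetSquare ≫ x) = comp (edge e') (edge f') := by
  have hs := square_src x
  have ht := square_tgt x
  have key : ∀ (i : Fin 2) (ε : Bool) (v : (CSet.cube 1).Vertex) (u : (CSet.cube n).Vertex),
      CSet.coord u = CSet.fn x.hom (i.insertNth ε (CSet.coord v) : Fin 2 → Bool) →
      (faceMap i ε ≫ x.hom).app _ v = u := fun i ε v u h =>
    CSet.coord_injective ((coord_face_comp x.hom i ε v).trans h.symm)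
  refine ⟨x.hom.app _ (Cube.vertex ![false, true]), x.hom.app _ (Cube.vertex ![true, false]),
    ⟨faceMap 0 false ≫ x.hom, key _ _ _ _ ?_, key _ _ _ _ ?_⟩,
    ⟨faceMap 1 true ≫ x.hom, key _ _ _ _ ?_, key _ _ _ _ ?_⟩,
    ⟨faceMap 1 false ≫ x.hom, key _ _ _ _ ?_, key _ _ _ _ ?_⟩,
    ⟨faceMap 0 true ≫ x.hom, key _ _ _ _ ?_, key _ _ _ _ ?_⟩,
    coord_square _ _ _, coord_square _ _ _, mk_sourceSquare_comp x _ _ rfl rfl,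
    mk_targetSquare_comp x _ _ rfl rfl⟩
  · exact hs.trans (congrArg _ (insert_zero false false).symm)
  · exact (coord_square _ _ _).trans (congrArg _ (insert_zero false true).symm)
  · exact (coord_square _ _ _).trans (congrArg _ (insert_one true false).symm)
  · exact ht.trans (congrArg _ (insert_one true true).symm)
  · exact hs.trans (congrArg _ (insert_one false false).symm)
  · exact (coord_square _ _ _).trans (congrArg _ (insert_one false true).symm)
  · exact (coord_square _ _ _).trans (congrArg _ (insert_zero true false).symm)
  · exact ht.trans (congrArg _ (insert_zero true true).symm)

/-- A degenerate square leaves the path unchanged. Otherwise the boundary paths end at the same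
vertex, so their weights differ by the heights of the middle vertices, which `square_cases`
compares. -/
lemma eq_or_cost_lt_of_step {p q : CPath (CSet.cube n) a b} (h : Step p q) :
    p = q ∨ cost weight weight_constMap q < cost weight weight_constMap p := by
  rw [step_iff] at h
  obtain ⟨u, v, p₁, x, p₂, rfl, rfl⟩ := h
  obtain ⟨m, m', e, f, e', f', hm, hm', h₁, h₂⟩ := exists_square_edges x
  rw [h₁, h₂]
  have hs := square_src x
  have ht := square_tgt x
  obtain h | ⟨i₁, i₂, i₃, i₄, hlt⟩ := square_cases (CSet.isCubical_fn x.hom)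
  · left
    rw [← hm, ← hm', ← hs, ← ht] at h
    rw [comp_edge_edge_eq (h.imp CSet.coord_injective
      (Or.imp (And.imp CSet.coord_injective CSet.coord_injective)
        (And.imp CSet.coord_injective CSet.coord_injective))) e f e' f']
  · right
    rw [← hm, ← hm'] at hlt
    have ne : ∀ {c d : (CSet.cube n).Vertex} {v w : Fin n → Bool}, CSet.coord c = v →
        CSet.coord d = w → v ≠ w → c ≠ d := by
      rintro c d _ _ rfl rfl h rfl
      exact h rfl
    simp only [cost_comp, cost_edge]
    rw [weight_eq e (ne hs hm i₁), weight_eq f (ne hm ht i₃), weight_eq e' (ne hs hm' i₂),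
      weight_eq f' (ne hm' ht i₄)]
    omega

/-- The preorders of paths in a cube are partial orders. -/
lemma cube_antisymm {p q : CPath (CSet.cube n) a b} (h : p ≤ q) (h' : q ≤ p) : p = q := by
  -- The weight decreases along every nontrivial sequence of steps, which excludes cycles.
  have key : ∀ {p q : CPath (CSet.cube n) a b}, p ≤ q →
      p = q ∨ cost weight weight_constMap q < cost weight weight_constMap p := by
    intro p q h
    induction h with
    | refl => exact Or.inl rfl
    | tail _ h ih =>
      obtain rfl | ih := ih
      · exact eq_or_cost_lt_of_step h
      · obtain rfl | h := eq_or_cost_lt_of_step h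
        · exact Or.inr ih
        · exact Or.inr (h.trans ih)
  obtain h | h := key h
  · exact h
  · obtain h' | h' := key h'
    · exact h'.symm
    · exact absurd h h'.asymm

/-! ### Least paths in a cube -/

/-- The vertex obtained from `a` by changing the `j`-th coordinate into `1`. -/
def raise (a : (CSet.cube n).Vertex) (j : Fin n) : (CSet.cube n).Vertex :=
  Cube.vertex (Function.update (CSet.coord a) j true)

lemma coord_raise (a : (CSet.cube n).Vertex) (j : Fin n) :
    CSet.coord (raise a j) = Function.update (CSet.coord a) j true := rfl

/-- The edge from `a` to `raise a j`. -/
def raiseEdge (a : (CSet.cube n).Vertex) (j : Fin n) (h : CSet.coord a j = false) :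
    cube 1 ⟶ (⟨CSet.cube n, a, raise a j⟩ : CSet2) where
  hom := CSet.ofFn _ (IsCubical.edge j (CSet.coord a))
  map_src := by
    apply CSet.coord_injective
    refine (CSet.coord_app _ _).trans ?_
    funext k
    by_cases hk : k = j
    · subst hk; simp [h]; rfl
    · simp [hk]
  map_tgt := by
    apply CSet.coord_injective
    refine (CSet.coord_app _ _).trans ?_
    funext k
    by_cases hk : k = j
    · subst hk; simp [coord_raise]; rfl
    · simp [hk, coord_raise]

/-- One step across the square at `a` in the directions `i < j`: its source raises `j` first, hence
is the smaller side. The edge `e` may be arbitrary, as edges are determined by their end points. -/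
lemma raise_square {i j : Fin n} (hij : i < j) (hi : CSet.coord a i = false)
    (hj : CSet.coord a j = false) (hj' : CSet.coord (raise a i) j = false)
    (e : cube 1 ⟶ (⟨CSet.cube n, raise a j, raise (raise a i) j⟩ : CSet2)) :
    comp (edge (raiseEdge a j hj)) (edge e) ≤
      comp (edge (raiseEdge a i hi)) (edge (raiseEdge (raise a i) j hj')) := by
  let x : cube 2 ⟶ (⟨CSet.cube n, a, raise (raise a i) j⟩ : CSet2) :=
    { hom := CSet.ofFn _ (IsCubical.square hij (CSet.coord a))
      map_src := by
        apply CSet.coord_injective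
        refine (CSet.coord_app _ _).trans ?_
        funext k
        by_cases hki : k = i
        · subst hki; simp [hi]; rfl
        · by_cases hkj : k = j
          · subst hkj; simp [hki, hj]; rfl
          · simp [hki, hkj]
      map_tgt := by
        apply CSet.coord_injective
        refine (CSet.coord_app _ _).trans ?_
        funext k
        by_cases hki : k = i
        · subst hki; simp [coord_raise, Function.update_apply]; rfl
        · by_cases hkj : k = j
          · subst hkj; simp [hki, coord_raise]; rfl
          · simp [hki, hkj, coord_raise] }
  obtain ⟨m, m', e₁, f₁, e₂, f₂, hm, hm', h₁, h₂⟩ := exists_square_edges x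
  obtain rfl : m = raise a j := by
    apply CSet.coord_injective
    rw [hm, coord_raise]
    funext k
    by_cases hki : k = i
    · subst hki; simp [x, hi, hij.ne]
    · by_cases hkj : k = j
      · subst hkj; simp [x, hki]
      · simp [x, hki, hkj]
  obtain rfl : m' = raise a i := by
    apply CSet.coord_injective
    rw [hm', coord_raise]
    funext k
    by_cases hki : k = i
    · subst hki; simp [x]
    · by_cases hkj : k = j
      · subst hkj; simp [x, hki, hj]
      · simp [x, hki, hkj]
  rw [edgeHom_unique (raiseEdge a j hj) e₁, edgeHom_unique e f₁,
    edgeHom_unique (raiseEdge a i hi) e₂, edgeHom_unique (raiseEdge (raise a i) j hj') f₂, ← h₁,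
    ← h₂]
  refine Relation.ReflTransGen.single ((step_iff _ _).2 ⟨_, _, refl _, x, refl _, ?_, ?_⟩) <;>
  rw [comp_refl, refl_comp]

/-- Any path can be lowered so that it begins by raising the largest possible coordinate. -/
lemma exists_raise_le {j : Fin n} (hb : CSet.coord b j = true) (p : CPath (CSet.cube n) a b)
    (ha : CSet.coord a j = false) (hab : ∀ k, j < k → CSet.coord a k = CSet.coord b k) :
    ∃ p' : CPath (CSet.cube n) (raise a j) b, comp (edge (raiseEdge a j ha)) p' ≤ p := by
  induction p using induction_cons with
  | h_refl => rw [ha] at hb; exact absurd hb (by decide)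
  | @cons a c e p ih =>
    by_cases hac : a = c
    · subst hac
      rw [edge_loop, refl_comp]
      exact ih ha hab
    · obtain ⟨i, hi⟩ : ∃ i, CSet.coord a i ≠ CSet.coord c i := by
        by_contra! h
        exact hac (CSet.coord_injective (funext h))
      have hf := CSet.isCubical_fn e.hom
      rw [← fn_src e, ← fn_tgt e] at hi
      obtain ⟨hi₀, hi₁⟩ := eq_update_of_edge hf (p := 0)
        (fun _ => Bool.false_le _) (fun r hr => absurd (Subsingleton.elim r 0) hr) hi
      rw [fn_src] at hi₀ hi₁
      rw [fn_tgt] at hi₁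
      obtain rfl : c = raise a i := CSet.coord_injective hi₁
      rw [edgeHom_unique e (raiseEdge a i hi₀)]
      obtain rfl | hne := eq_or_ne i j
      · exact ⟨p, le_rfl⟩
      · have hle := coord_le p i
        rw [coord_raise, Function.update_self] at hle
        -- At `i` the vertices `a` and `b` differ, whereas they agree above `j`.
        have hij : i < j := by
          by_contra h
          have := hab i (lt_of_le_of_ne (not_lt.1 h) hne.symm)
          rw [hi₀] at this
          rw [← this] at hle
          exact absurd (Bool.eq_true_of_true_le hle) (by decide)
        have hj' : CSet.coord (raise a i) j = false := by
          rw [coord_raise, Function.update_of_ne hne.symm, ha]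
        -- The rest of the path is lowered so as to start with `j`; a square then moves `j` ahead of
        -- `i`.
        obtain ⟨p', hp'⟩ := ih hj' (fun k hk => by
          rw [coord_raise, Function.update_of_ne (hij.trans hk).ne', hab k hk])
        have hr : raise (raise a i) j = raise (raise a j) i := by
          apply CSet.coord_injective
          simp only [coord_raise]
          exact Function.update_comm hne _ _ _
        have hi' : CSet.coord (raise a j) i = false := by
          rw [coord_raise, Function.update_of_ne hne, hi₀]
        -- The two orders of raising give vertices that are only propositionally equal, so an edge
        -- with the required end point is obtained by rewriting.
        obtain ⟨e'⟩ : Nonempty (cube 1 ⟶ (⟨CSet.cube n, raise a j, raise (raise a i) j⟩ : CSet2)) := by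
          rw [hr]
          exact ⟨raiseEdge (raise a j) i hi'⟩
        refine ⟨comp (edge e') p', ?_⟩
        refine le_trans ?_ (comp_le_comp (le_refl _) hp')
        rw [← comp_assoc, ← comp_assoc]
        exact comp_le_comp (raise_square hij hi₀ ha hj' e') le_rfl

/-- There is a least path between two comparable vertices of a cube. -/
lemma exists_least_cube (a b : (CSet.cube n).Vertex) (hab : CSet.coord a ≤ CSet.coord b) :
    ∃ p₀ : CPath (CSet.cube n) a b, ∀ p, p₀ ≤ p := by
  -- Induction on the number of coordinates that have to be raised.
  induction hN : (Finset.univ.filter (fun k => CSet.coord a k ≠ CSet.coord b k)).card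
    using Nat.strong_induction_on generalizing a with
  | _ N ih =>
    by_cases h : a = b
    · subst h
      exact ⟨refl a, fun p => (loop_eq_refl p).symm.le⟩
    · have hne : (Finset.univ.filter (fun k => CSet.coord a k ≠ CSet.coord b k)).Nonempty := by
        by_contra h'
        rw [Finset.not_nonempty_iff_eq_empty, Finset.filter_eq_empty_iff] at h'
        exact h (CSet.coord_injective (funext (fun k => not_not.1 (h' (Finset.mem_univ k)))))
      -- The least path raises the largest of these coordinates first.
      obtain ⟨j, hj, hmax⟩ := Finset.exists_max_image _ id hne
      simp only [Finset.mem_filter, Finset.mem_univ, true_and, id_eq] at hj hmax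
      have hj₀ : CSet.coord a j = false ∧ CSet.coord b j = true :=
        Bool.eq_of_le_of_ne (hab j) hj
      have hle : CSet.coord (raise a j) ≤ CSet.coord b := by
        intro k
        by_cases hk : k = j
        · subst hk; rw [hj₀.2]; exact Bool.le_true _
        · rw [coord_raise, Function.update_of_ne hk]; exact hab k
      obtain ⟨p₀, hp₀⟩ := ih _ (by
        rw [← hN]
        apply Finset.card_lt_card
        rw [Finset.ssubset_iff_of_subset]
        · refine ⟨j, by simpa using hj, ?_⟩
          rw [Finset.mem_filter, coord_raise, Function.update_self, hj₀.2]
          simp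
        · intro k
          simp only [Finset.mem_filter, Finset.mem_univ, true_and]
          by_cases hk : k = j
          · subst hk; simp [coord_raise, hj₀.2]
          · rw [coord_raise, Function.update_of_ne hk]; exact id) (raise a j) hle rfl
      refine ⟨comp (edge (raiseEdge a j hj₀.1)) p₀, fun p => ?_⟩
      obtain ⟨p', hp'⟩ := exists_raise_le hj₀.2 p hj₀.1 (fun k hk => by
        by_contra hk'
        exact absurd (hmax k hk') (not_le.2 hk))
      exact (comp_le_comp le_rfl (hp₀ p')).trans hp'

end cube

end CPath

/-! ### Morphisms in wedges -/

/-- A functor from cubical sets to categories, such that the objects of the category attached to a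
cubical set are its vertices. -/
structure VertexCat where
  Hom : ∀ (S : CSet) (_ _ : S.Vertex), Type
  one : ∀ {S : CSet} (a : S.Vertex), Hom S a a
  mul : ∀ {S : CSet} {a b c : S.Vertex}, Hom S a b → Hom S b c → Hom S a c
  map : ∀ {S T : CSet} (f : S ⟶ T) {a b : S.Vertex}, Hom S a b → Hom T (f.app _ a) (f.app _ b)
  one_mul : ∀ {S : CSet} {a b : S.Vertex} (h : Hom S a b), mul (one a) h = h
  mul_one : ∀ {S : CSet} {a b : S.Vertex} (h : Hom S a b), mul h (one b) = h
  mul_assoc : ∀ {S : CSet} {a b c d : S.Vertex} (h : Hom S a b) (k : Hom S b c) (l : Hom S c d),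
    mul (mul h k) l = mul h (mul k l)
  map_one : ∀ {S T : CSet} (f : S ⟶ T) (a : S.Vertex), map f (one a) = one (f.app _ a)
  map_mul : ∀ {S T : CSet} (f : S ⟶ T) {a b c : S.Vertex} (h : Hom S a b) (k : Hom S b c),
    map f (mul h k) = mul (map f h) (map f k)
  map_id : ∀ {S : CSet} {a b : S.Vertex} (h : Hom S a b), map (𝟙 S) h = h
  map_comp : ∀ {S T U : CSet} (f : S ⟶ T) (g : T ⟶ U) {a b : S.Vertex} (h : Hom S a b),
    map (f ≫ g) h = map g (map f h)

namespace VertexCat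

variable (H : VertexCat)

/-- Transport along equalities of vertices. -/
def cast {S : CSet} {a a' b b' : S.Vertex} (ha : a = a') (hb : b = b') (h : H.Hom S a b) :
    H.Hom S a' b' := by
  subst ha hb; exact h

lemma cast_one {S : CSet} {a a' : S.Vertex} (ha ha' : a = a') :
    H.cast ha ha' (H.one a) = H.one a' := by
  subst ha; rfl

lemma cast_mul {S : CSet} {a a' b b' c c' : S.Vertex} (ha : a = a') (hb : b = b') (hc : c = c')
    (h : H.Hom S a b) (k : H.Hom S b c) :
    H.cast ha hc (H.mul h k) = H.mul (H.cast ha hb h) (H.cast hb hc k) := by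
  subst ha hb hc; rfl

lemma cast_cast {S : CSet} {a a' a'' b b' b'' : S.Vertex} (ha : a = a') (hb : b = b')
    (ha' : a' = a'') (hb' : b' = b'') (h : H.Hom S a b) :
    H.cast ha' hb' (H.cast ha hb h) = H.cast (ha.trans ha') (hb.trans hb') h := by
  subst ha hb ha' hb'; rfl

lemma cast_rfl {S : CSet} {a b : S.Vertex} (h : H.Hom S a b) : H.cast rfl rfl h = h := rfl

lemma map_cast {S T : CSet} (f : S ⟶ T) {a a' b b' : S.Vertex} (ha : a = a') (hb : b = b')
    (h : H.Hom S a b) : H.map f (H.cast ha hb h) =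
      H.cast (congrArg (f.app _) ha) (congrArg (f.app _) hb) (H.map f h) := by
  subst ha hb; rfl

lemma cast_map_map {S T U : CSet} {f : S ⟶ T} {g : T ⟶ U} {k : S ⟶ U} (hk : f ≫ g = k)
    {a b : S.Vertex} {a' b' : U.Vertex} (ha : g.app _ (f.app _ a) = a')
    (hb : g.app _ (f.app _ b) = b') (ha' : k.app _ a = a') (hb' : k.app _ b = b')
    (h : H.Hom S a b) : H.cast ha hb (H.map g (H.map f h)) = H.cast ha' hb' (H.map k h) := by
  subst hk ha hb; exact (H.map_comp f g h).symm

lemma cast_map_map_of_id {S T : CSet} {f : S ⟶ T} {g : T ⟶ S} (hfg : f ≫ g = 𝟙 S)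
    {a b : S.Vertex} (ha : g.app _ (f.app _ a) = a) (hb : g.app _ (f.app _ b) = b)
    (h : H.Hom S a b) : H.cast ha hb (H.map g (H.map f h)) = h :=
  (H.cast_map_map hfg ha hb rfl rfl h).trans (H.map_id h)

/-- The morphisms generated by the images of the morphisms of cubes. -/
inductive Generated {S : CSet} : ∀ {a b : S.Vertex}, H.Hom S a b → Prop
  | cube {m : ℕ} (x : CSet.cube m ⟶ S) {u v : (CSet.cube m).Vertex}
      (h : H.Hom (CSet.cube m) u v) : Generated (H.map x h)
  | one (a : S.Vertex) : Generated (H.one a)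
  | mul {a b c : S.Vertex} {h : H.Hom S a b} {k : H.Hom S b c} (hh : Generated h)
      (hk : Generated k) : Generated (H.mul h k)

/-- There are no nontrivial morphisms out of the second point of `X`. -/
structure FinalTgt (X : CSet2) : Prop where
  eq : ∀ {a : X.carrier.Vertex}, H.Hom X.carrier X.tgt a → a = X.tgt
  eq_one : ∀ h : H.Hom X.carrier X.tgt X.tgt, h = H.one _

/-- There are no nontrivial morphisms to the first point of `X`. -/
structure InitialSrc (X : CSet2) : Prop where
  eq : ∀ {a : X.carrier.Vertex}, H.Hom X.carrier a X.src → a = X.src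
  eq_one : ∀ h : H.Hom X.carrier X.src X.src, h = H.one _

/-! ### Normal forms of morphisms of a wedge -/

variable {X Y : CSet2}

/-- The composite through the junction of a morphism of `X` and a morphism of `Y`. -/
noncomputable def cross {a : X.carrier.Vertex} {b : Y.carrier.Vertex}
    (f : H.Hom X.carrier a X.tgt) (g : H.Hom Y.carrier Y.src b) :
    H.Hom (wedge X Y).carrier ((inl X Y).app _ a) ((inr X Y).app _ b) :=
  H.mul (H.map (inl X Y) f) (H.cast (inl_tgt X Y).symm rfl (H.map (inr X Y) g))

lemma cross_one {a : X.carrier.Vertex} (f : H.Hom X.carrier a X.tgt) :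
    H.cross f (H.one Y.src) = H.cast rfl (inl_tgt X Y) (H.map (inl X Y) f) := by
  have h : H.cast (inl_tgt X Y).symm rfl (H.one ((inr X Y).app _ Y.src)) =
      H.cast rfl (inl_tgt X Y) (H.one ((inl X Y).app _ X.tgt)) := by
    rw [← H.cast_one (inl_tgt X Y).symm (inl_tgt X Y).symm, H.cast_cast]
  rw [cross, map_one, h, ← H.cast_rfl (H.map (inl X Y) f), ← H.cast_mul, H.mul_one]
  rfl

lemma one_cross {b : Y.carrier.Vertex} (g : H.Hom Y.carrier Y.src b) :
    H.cross (H.one X.tgt) g = H.cast (inl_tgt X Y).symm rfl (H.map (inr X Y) g) := by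
  rw [cross, map_one, H.one_mul]

/-- The shape of the morphisms of a wedge. -/
structure Normal {u v : (wedge X Y).carrier.Vertex} (h : H.Hom (wedge X Y).carrier u v) : Prop where
  left : ∀ (a a' : X.carrier.Vertex) (hu : (inl X Y).app _ a = u) (hv : (inl X Y).app _ a' = v),
    ∃ f, h = H.cast hu hv (H.map (inl X Y) f)
  right : ∀ (b b' : Y.carrier.Vertex) (hu : (inr X Y).app _ b = u) (hv : (inr X Y).app _ b' = v),
    ∃ g, h = H.cast hu hv (H.map (inr X Y) g)
  cross : ∀ (a : X.carrier.Vertex) (b : Y.carrier.Vertex) (hu : (inl X Y).app _ a = u)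
    (hv : (inr X Y).app _ b = v), ∃ f g, h = H.cast hu hv (H.cross f g)
  back : ∀ (b : Y.carrier.Vertex) (a : X.carrier.Vertex), (inr X Y).app _ b = u →
    (inl X Y).app _ a = v → b = Y.src ∧ a = X.tgt

variable {H}

/-- The junction is a vertex of both factors, so end points may have a second description. When both
end points are the junction, `FinalTgt` makes `f` an identity, which also comes from `Y`. -/
lemma normal_inl (hX : H.FinalTgt X) {a a' : X.carrier.Vertex} (f : H.Hom X.carrier a a') :
    H.Normal (H.map (inl X Y) f) where
  left a₁ a₁' hu hv := by
    obtain rfl := inl_injective hu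
    obtain rfl := inl_injective hv
    exact ⟨f, rfl⟩
  right b b' hu hv := by
    obtain rfl := eq_tgt_of_inl_eq_inr hu.symm
    obtain rfl := eq_src_of_inl_eq_inr hu.symm
    obtain rfl := eq_tgt_of_inl_eq_inr hv.symm
    obtain rfl := eq_src_of_inl_eq_inr hv.symm
    refine ⟨H.one _, ?_⟩
    rw [hX.eq_one f, H.map_one, H.map_one, H.cast_one]
  cross a₁ b hu hv := by
    obtain rfl := inl_injective hu
    obtain rfl := eq_tgt_of_inl_eq_inr hv.symm
    obtain rfl := eq_src_of_inl_eq_inr hv.symm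
    refine ⟨f, H.one _, ?_⟩
    rw [cross_one, H.cast_cast]
    rfl
  back b a₁ hu hv := by
    obtain rfl := eq_tgt_of_inl_eq_inr hu.symm
    obtain rfl := inl_injective hv
    exact ⟨eq_src_of_inl_eq_inr hu.symm, hX.eq f⟩

lemma normal_inr (hY : H.InitialSrc Y) {b b' : Y.carrier.Vertex} (g : H.Hom Y.carrier b b') :
    H.Normal (H.map (inr X Y) g) where
  right b₁ b₁' hu hv := by
    obtain rfl := inr_injective hu
    obtain rfl := inr_injective hv
    exact ⟨g, rfl⟩
  left a a' hu hv := by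
    obtain rfl := eq_tgt_of_inl_eq_inr hu
    obtain rfl := eq_src_of_inl_eq_inr hu
    obtain rfl := eq_tgt_of_inl_eq_inr hv
    obtain rfl := eq_src_of_inl_eq_inr hv
    refine ⟨H.one _, ?_⟩
    rw [hY.eq_one g, H.map_one, H.map_one, H.cast_one]
  cross a b₁ hu hv := by
    obtain rfl := inr_injective hv
    obtain rfl := eq_tgt_of_inl_eq_inr hu
    obtain rfl := eq_src_of_inl_eq_inr hu
    refine ⟨H.one _, g, ?_⟩
    rw [one_cross, H.cast_cast]
    rfl
  back b₁ a hu hv := by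
    obtain rfl := eq_src_of_inl_eq_inr hv
    obtain rfl := inr_injective hu
    exact ⟨hY.eq g, eq_tgt_of_inl_eq_inr hv⟩

lemma exists_inl_or_inr (v : (wedge X Y).carrier.Vertex) :
    (∃ a, (inl X Y).app _ a = v) ∨ ∃ b, (inr X Y).app _ b = v :=
  exists_of_wedge v

/-- By `back`, nothing goes from `Y` to `X` except at the junction, so the intermediate vertex of a
composite within one factor lies in that factor. In a composite from `X` to `Y`, the morphism lying
in a single factor is absorbed by that side of the other one. -/
lemma normal_mul (hX : H.FinalTgt X) (hY : H.InitialSrc Y) {u v w : (wedge X Y).carrier.Vertex}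
    {h : H.Hom (wedge X Y).carrier u v} {k : H.Hom (wedge X Y).carrier v w} (hh : H.Normal h)
    (hk : H.Normal k) : H.Normal (H.mul h k) where
  left a a' hu hw := by
    obtain ⟨c, hc⟩ : ∃ c, (inl X Y).app _ c = v := by
      obtain hv | ⟨b, hb⟩ := exists_inl_or_inr v
      · exact hv
      · exact ⟨X.tgt, by rw [inl_tgt, ← (hk.back b a' hb hw).1, hb]⟩
    obtain ⟨f, rfl⟩ := hh.left a c hu hc
    obtain ⟨f', rfl⟩ := hk.left c a' hc hw
    exact ⟨H.mul f f', by rw [H.map_mul, ← H.cast_mul]⟩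
  right b b' hu hw := by
    obtain ⟨c, hc⟩ : ∃ c, (inr X Y).app _ c = v := by
      obtain ⟨a, ha⟩ | hv := exists_inl_or_inr v
      · exact ⟨Y.src, by rw [← inl_tgt, ← (hh.back b a hu ha).2, ha]⟩
      · exact hv
    obtain ⟨f, rfl⟩ := hh.right b c hu hc
    obtain ⟨f', rfl⟩ := hk.right c b' hc hw
    exact ⟨H.mul f f', by rw [H.map_mul, ← H.cast_mul]⟩
  cross a b hu hw := by
    subst hu hw
    obtain ⟨c, rfl⟩ | ⟨c, rfl⟩ := exists_inl_or_inr v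
    · obtain ⟨f, rfl⟩ := hh.left a c rfl rfl
      obtain ⟨f', g, rfl⟩ := hk.cross c b rfl rfl
      refine ⟨H.mul f f', g, ?_⟩
      simp only [cast_rfl, VertexCat.cross, H.map_mul, H.mul_assoc]
    · obtain ⟨f, g, rfl⟩ := hh.cross a c rfl rfl
      obtain ⟨g', rfl⟩ := hk.right c b rfl rfl
      refine ⟨f, H.mul g g', ?_⟩
      simp only [cast_rfl, VertexCat.cross, H.map_mul, H.mul_assoc]
      rw [H.cast_mul _ rfl rfl, cast_rfl]
  back b a hu hw := by
    subst hu hw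
    obtain ⟨c, rfl⟩ | ⟨c, rfl⟩ := exists_inl_or_inr v
    · obtain ⟨rfl, rfl⟩ := hh.back b c rfl rfl
      obtain ⟨f, -⟩ := hk.left _ a rfl rfl
      exact ⟨rfl, hX.eq f⟩
    · obtain ⟨rfl, rfl⟩ := hk.back c a rfl rfl
      obtain ⟨g, -⟩ := hh.right b _ rfl rfl
      exact ⟨hY.eq g, rfl⟩

/-- All the morphisms of a wedge have the expected shape. -/
lemma normal_of_generated (hX : H.FinalTgt X) (hY : H.InitialSrc Y)
    {u v : (wedge X Y).carrier.Vertex} {h : H.Hom (wedge X Y).carrier u v}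
    (hh : H.Generated h) : H.Normal h := by
  induction hh with
  | cube x h =>
    -- A generator comes from one cube, hence from one factor.
    obtain ⟨y, rfl⟩ | ⟨y, rfl⟩ := exists_factor_wedge x
    · rw [H.map_comp]
      exact normal_inl hX _
    · rw [H.map_comp]
      exact normal_inr hY _
  | one a =>
    obtain ⟨a, rfl⟩ | ⟨a, rfl⟩ := exists_inl_or_inr a
    · rw [← H.map_one]
      exact normal_inl hX _
    · rw [← H.map_one]
      exact normal_inr hY _
  | mul _ _ ih ih' => exact normal_mul hX hY ih ih'

end VertexCat

/-! ### Paths in a wedge -/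

namespace CPath

/-- The path category, as a functor with values in categories. -/
noncomputable def vertexCat : VertexCat where
  Hom := CPath
  one := refl
  mul := comp
  map f := map f
  one_mul := refl_comp
  mul_one := comp_refl
  mul_assoc := comp_assoc
  map_one := map_refl
  map_mul f := map_comp f
  map_id h := by
    obtain ⟨n, γ, rfl⟩ := exists_rep h
    exact congrArg mk (Category.comp_id γ)
  map_comp f g _ _ h := by
    obtain ⟨n, γ, rfl⟩ := exists_rep h
    exact congrArg mk (CSet2.hom_ext (Category.assoc _ _ _).symm)

/-- An edge is the image of the tautological edge of `□^1` under the map that defines it. -/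
lemma generated {S : CSet} {a b : S.Vertex} (p : vertexCat.Hom S a b) : vertexCat.Generated p := by
  induction p using induction_snoc with
  | h_refl => exact .one a
  | @snoc b c p e ih =>
    refine .mul ih ?_
    obtain ⟨x, h₁, h₂⟩ := e
    change CSet.cube 1 ⟶ S at x
    change x.app _ (cube 1).src = b at h₁
    change x.app _ (cube 1).tgt = c at h₂
    subst h₁ h₂
    have h : edge (⟨x, rfl, rfl⟩ : cube 1 ⟶ ⟨S, _, _⟩) =
        vertexCat.map x (edge (⟨𝟙 _, rfl, rfl⟩ :
          cube 1 ⟶ ⟨CSet.cube 1, (cube 1).src, (cube 1).tgt⟩)) := by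
      refine congrArg (mk (n := 1)) (star_comp (Z := cube 1) _ _ ⟨x, rfl, rfl⟩ _ _ ?_ ?_).symm
      · exact (CSet.point_comp _ _).symm
      · exact (Category.id_comp _).symm
    rw [h]
    exact .cube x _

lemma cast_le_cast {S : CSet} {a a' b b' : S.Vertex} (ha : a = a') (hb : b = b')
    {p q : vertexCat.Hom S a b} :
    LE.le (α := CPath S a' b') (vertexCat.cast ha hb p) (vertexCat.cast ha hb q) ↔
      LE.le (α := CPath S a b) p q := by
  subst ha hb; rfl

lemma app_app_of_comp_eq_id {S T : CSet} {f : S ⟶ T} {g : T ⟶ S} (hfg : f ≫ g = 𝟙 S)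
    (a : S.Vertex) : g.app _ (f.app _ a) = a :=
  types_congr_hom (congr_app hfg _) a

/-- Retracts induce order embeddings on paths. -/
lemma map_le_map_iff {S T : CSet} {f : S ⟶ T} {g : T ⟶ S} (hfg : f ≫ g = 𝟙 S) {a b : S.Vertex}
    {p q : CPath S a b} : map f p ≤ map f q ↔ p ≤ q := by
  refine ⟨fun h => ?_, map_mono f⟩
  have e := vertexCat.cast_map_map_of_id hfg (app_app_of_comp_eq_id hfg a)
    (app_app_of_comp_eq_id hfg b)
  rw [← e p, ← e q]
  exact (cast_le_cast _ _).2 (map_mono g h)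

lemma map_injective {S T : CSet} {f : S ⟶ T} {g : T ⟶ S} (hfg : f ≫ g = 𝟙 S) {a b : S.Vertex}
    {p q : CPath S a b} (h : map f p = map f q) : p = q := by
  have e := vertexCat.cast_map_map_of_id hfg (app_app_of_comp_eq_id hfg a)
    (app_app_of_comp_eq_id hfg b)
  exact (e p).symm.trans ((congrArg (fun r => vertexCat.cast _ _ (map g r)) h).trans (e q))

/-- The constant map factors through `□^0`, where every path is a trivial loop. -/
lemma map_constMap (S : CSet) {T : CSet} (v : T.Vertex) {a b : S.Vertex} (p : CPath S a b) :
    vertexCat.cast (CSet.constMap_app S v a) (CSet.constMap_app S v b)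
      (vertexCat.map (CSet.constMap S v) p) = refl v := by
  obtain h : (CSet.toPoint S).app _ a = (CSet.toPoint S).app _ b := Cube.hom_zero_ext _ _
  have key : ∀ {u w : (CSet.cube 0).Vertex} (q : CPath (CSet.cube 0) u w)
      (hu : (CSet.point v).app _ u = v) (hw : (CSet.point v).app _ w = v),
      vertexCat.cast hu hw (map (CSet.point v) q) = refl v := by
    intro u w q hu hw
    obtain rfl : u = w := Cube.hom_zero_ext _ _
    rw [loop_eq_refl q, map_refl]
    exact vertexCat.cast_one hu hw
  have := vertexCat.map_comp (CSet.toPoint S) (CSet.point v) p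
  exact (congrArg (vertexCat.cast _ _) this).trans (key _ _ _)

variable {X Y : CSet2} {a : X.carrier.Vertex} {b : Y.carrier.Vertex}

/-- The collapse is the identity on `X` and makes the path of `Y` trivial. -/
lemma collapseRight_cross (p : vertexCat.Hom X.carrier a X.tgt)
    (q : vertexCat.Hom Y.carrier Y.src b) :
    vertexCat.cast (collapseRight_inl a) (collapseRight_inr b)
      (vertexCat.map (collapseRight X Y) (vertexCat.cross p q)) = p := by
  rw [VertexCat.cross, vertexCat.map_mul,
    vertexCat.cast_mul (collapseRight_inl a) (collapseRight_inl X.tgt) (collapseRight_inr b),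
    vertexCat.map_cast, vertexCat.cast_cast]
  refine (congrArg₂ comp (vertexCat.cast_map_map_of_id (inl_collapseRight X Y) _ _ p)
    ((vertexCat.cast_map_map (inr_collapseRight X Y) _ _ _ _ q).trans (map_constMap _ _ q))).trans
    (comp_refl p)

lemma collapseLeft_cross (p : vertexCat.Hom X.carrier a X.tgt)
    (q : vertexCat.Hom Y.carrier Y.src b) :
    vertexCat.cast (collapseLeft_inl a) (collapseLeft_inr b)
      (vertexCat.map (collapseLeft X Y) (vertexCat.cross p q)) = q := by
  rw [VertexCat.cross, vertexCat.map_mul,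
    vertexCat.cast_mul (collapseLeft_inl a) (collapseLeft_inl X.tgt) (collapseLeft_inr b),
    vertexCat.map_cast, vertexCat.cast_cast]
  refine (congrArg₂ comp ((vertexCat.cast_map_map (inl_collapseLeft X Y) _ _ _ _ p).trans
    (map_constMap _ _ p)) (vertexCat.cast_map_map_of_id (inr_collapseLeft X Y) _ _ q)).trans
    (refl_comp q)

/-- Composition and both collapses are monotone, so composites through the junction carry the
product order. -/
lemma cross_le_cross_iff {p p' : vertexCat.Hom X.carrier a X.tgt}
    {q q' : vertexCat.Hom Y.carrier Y.src b} :
    LE.le (α := CPath (wedge X Y).carrier _ _) (vertexCat.cross p q) (vertexCat.cross p' q') ↔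
      LE.le (α := CPath _ _ _) p p' ∧ LE.le (α := CPath _ _ _) q q' := by
  refine ⟨fun h => ⟨?_, ?_⟩, fun h => ?_⟩
  · rw [← collapseRight_cross p q, ← collapseRight_cross p' q']
    exact (cast_le_cast _ _).2 (map_mono _ h)
  · rw [← collapseLeft_cross p q, ← collapseLeft_cross p' q']
    exact (cast_le_cast _ _).2 (map_mono _ h)
  · exact comp_le_comp (map_mono _ h.1) ((cast_le_cast _ _).2 (map_mono _ h.2))

lemma cross_injective {p p' : vertexCat.Hom X.carrier a X.tgt}
    {q q' : vertexCat.Hom Y.carrier Y.src b}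
    (h : vertexCat.cross p q = vertexCat.cross p' q') : p = p' ∧ q = q' := by
  constructor
  · rw [← collapseRight_cross p q, ← collapseRight_cross p' q', h]
  · rw [← collapseLeft_cross p q, ← collapseLeft_cross p' q', h]

end CPath

/-! ### Isomorphisms and colimits of simplicial categories -/

namespace SCat

variable {C D : SCat} {n : SimplexCategoryᵒᵖ}

lemma tr_bijective {x x' y y' : C} (hx : x = x') (hy : y = y') :
    Function.Bijective (tr (n := n) hx hy) := by
  subst hx hy; exact Function.bijective_id

lemma onMap_comp {E : SCat} (F : C ⟶ D) (G : D ⟶ E) {x y : C} (f : (C.Map x y).obj n) :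
    (onMap (F ≫ G) x y).app n f = (onMap G _ _).app n ((onMap F x y).app n f) := rfl

lemma onMap_id {x y : C} (f : (C.Map x y).obj n) : (onMap (𝟙 C) x y).app n f = f := rfl

/-! ### Inverting a simplicial functor that is bijective on objects and mapping spaces -/

section inverse

variable (F : C ⟶ D) (hobj : Function.Bijective (onObj F))
  (hmap : ∀ (n : SimplexCategoryᵒᵖ) (x y : C), Function.Bijective ((onMap F x y).app n))

/-- The inverse on objects. -/
noncomputable def invObj (y : D) : C := (Equiv.ofBijective _ hobj).symm y

lemma onObj_invObj (y : D) : onObj F (invObj F hobj y) = y :=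
  (Equiv.ofBijective _ hobj).apply_symm_apply y

/-- The bijection on simplices of mapping spaces. -/
noncomputable def mapEquiv (n : SimplexCategoryᵒᵖ) (y y' : D) :
    (C.Map (invObj F hobj y) (invObj F hobj y')).obj n ≃ (D.Map y y').obj n :=
  Equiv.ofBijective (fun f => tr (onObj_invObj F hobj y) (onObj_invObj F hobj y')
    ((onMap F _ _).app n f)) ((tr_bijective _ _).comp (hmap n _ _))

lemma mapEquiv_apply (n : SimplexCategoryᵒᵖ) (y y' : D)
    (f : (C.Map (invObj F hobj y) (invObj F hobj y')).obj n) :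
    mapEquiv F hobj hmap n y y' f = tr (onObj_invObj F hobj y) (onObj_invObj F hobj y')
      ((onMap F _ _).app n f) := rfl

/-- The inverse of a simplicial functor which is bijective on objects and on mapping spaces. -/
noncomputable def invFunctor : D ⟶ C where
  obj := invObj F hobj
  map y y' :=
  { app n := ↾((mapEquiv F hobj hmap n y y').symm)
    naturality n m θ := by
      ext f
      change (mapEquiv F hobj hmap m y y').symm ((D.Map y y').map θ f) =
        (C.Map _ _).map θ ((mapEquiv F hobj hmap n y y').symm f)
      rw [Equiv.symm_apply_eq, mapEquiv_apply]
      have := NatTrans.naturality_apply (onMap F (invObj F hobj y) (invObj F hobj y')) θ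
        ((mapEquiv F hobj hmap n y y').symm f)
      rw [this, ← tr_map, ← mapEquiv_apply F hobj hmap, Equiv.apply_symm_apply] }
  map_id y := by
    ext n f
    change (mapEquiv F hobj hmap n y y).symm (one n y) = one n _
    rw [Equiv.symm_apply_eq, mapEquiv_apply, onMap_one, tr_one]
  map_comp x y z := by
    ext n ⟨f, g⟩
    change (mapEquiv F hobj hmap n x z).symm (mul f g) =
      mul ((mapEquiv F hobj hmap n x y).symm f) ((mapEquiv F hobj hmap n y z).symm g)
    rw [Equiv.symm_apply_eq, mapEquiv_apply, onMap_mul, tr_mul _ (onObj_invObj F hobj y),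
      ← mapEquiv_apply F hobj hmap, ← mapEquiv_apply F hobj hmap, Equiv.apply_symm_apply,
      Equiv.apply_symm_apply]

end inverse

lemma isIso_of_bijective (F : C ⟶ D) (hobj : Function.Bijective (onObj F))
    (hmap : ∀ (n : SimplexCategoryᵒᵖ) (x y : C), Function.Bijective ((onMap F x y).app n)) :
    IsIso F := by
  refine ⟨invFunctor F hobj hmap, ?_, ?_⟩
  · refine functor_ext (fun x => (Equiv.ofBijective _ hobj).symm_apply_apply x)
      (fun n x y f => ?_)
    apply (hmap n x y).1
    have hx : ∀ x : C, invObj F hobj (onObj F x) = x :=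
      fun x => (Equiv.ofBijective _ hobj).symm_apply_apply x
    change (onMap F x y).app n (tr (hx x) (hx y)
      ((mapEquiv F hobj hmap n (onObj F x) (onObj F y)).symm ((onMap F x y).app n f))) = _
    rw [onMap_tr]
    exact (mapEquiv F hobj hmap n (onObj F x) (onObj F y)).apply_symm_apply _
  · refine functor_ext (onObj_invObj F hobj) (fun n x y f => ?_)
    exact (mapEquiv F hobj hmap n x y).apply_symm_apply f

lemma onMap_injective_of_isIso (F : C ⟶ D) [IsIso F] {x y : C} {f g : (C.Map x y).obj n}
    (h : (onMap F x y).app n f = (onMap F x y).app n g) : f = g := by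
  have e := fun f : (C.Map x y).obj n => onMap_congr (IsIso.hom_inv_id F) f
  have := (e f).symm.trans ((congrArg (fun k => tr _ _ ((onMap (inv F) _ _).app n k)) h).trans (e g))
  exact this

lemma onMap_surjective_of_isIso (F : C ⟶ D) [IsIso F] {x y : C}
    (g : (D.Map (onObj F x) (onObj F y)).obj n) : ∃ f, (onMap F x y).app n f = g := by
  have h : ∀ x : C, onObj (inv F) (onObj F x) = x := fun x =>
    congrArg (fun G : C ⟶ C => onObj G x) (IsIso.hom_inv_id F)
  refine ⟨tr (h x) (h y) ((onMap (inv F) _ _).app n g), ?_⟩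
  rw [onMap_tr]
  exact onMap_congr (IsIso.inv_hom_id F) g

/-! ### Generation of a colimit by its diagram -/

section colimit

variable {J : Type} [Category.{0} J] {F : J ⥤ SCat} {s : Cocone F}

/-- Compares an arbitrary colimit with the explicit one. A section is enough to see that all objects
and simplices are evaluations of formal ones. -/
lemma desc_inverse (hs : IsColimit s) : ∃ G : s.pt ⟶ Colim.pt F, G ≫ Colim.desc s = 𝟙 s.pt :=
  ⟨hs.desc (Colim.cocone F),
    ((Colim.isColimit F).coconePointUniqueUpToIso hs).inv_hom_id⟩

lemma exists_onObj_of_isColimit (hs : IsColimit s) (x : s.pt) :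
    ∃ (j : J) (y : F.obj j), onObj (s.ι.app j) y = x := by
  obtain ⟨G, hG⟩ := desc_inverse hs
  have hx : onObj (Colim.desc s) (onObj G x) = x :=
    congrArg (fun K : s.pt ⟶ s.pt => onObj K x) hG
  generalize onObj G x = z at hx
  obtain ⟨j, y⟩ := z
  exact ⟨j, y, hx⟩

/-- The mapping spaces of a colimit are generated by the mapping spaces of the diagram. -/
lemma induction_of_isColimit (hs : IsColimit s)
    {motive : ∀ {x y : s.pt}, (s.pt.Map x y).obj n → Prop}
    (h_of : ∀ (j : J) (x y : F.obj j) (f : ((F.obj j).Map x y).obj n),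
      motive ((onMap (s.ι.app j) x y).app n f))
    (h_one : ∀ x : s.pt, motive (one n x))
    (h_mul : ∀ {x y z : s.pt} (f : (s.pt.Map x y).obj n) (g : (s.pt.Map y z).obj n),
      motive f → motive g → motive (mul f g))
    {x y : s.pt} (f : (s.pt.Map x y).obj n) : motive f := by
  -- Evaluating a word inserts transports along equalities of objects.
  have h_tr : ∀ {x x' y y' : s.pt} (hx : x = x') (hy : y = y') (f : (s.pt.Map x y).obj n),
      motive f → motive (tr hx hy f) := by
    rintro x _ y _ rfl rfl f hf
    exact hf
  obtain ⟨G, hG⟩ := desc_inverse hs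
  have hf := onMap_congr hG f
  rw [onMap_id] at hf
  rw [← hf]
  apply h_tr
  have key : ∀ {a b : Colim.Ob F} (w : Colim.Word F n a b), motive (Colim.eval s w) := by
    intro a b w
    induction w with
    | of j x y hx hy f => exact h_tr _ _ _ (h_of j x y f)
    | one a => exact h_one _
    | mul v w hv hw => exact h_mul _ _ hv hw
  rw [onMap_comp]
  generalize (onMap G x y).app n f = q
  obtain ⟨w⟩ := q
  exact key w

end colimit

end SCat

/-! ### The mapping spaces of the rigidification -/

namespace CSet

/-- The rigidification as a pointwise Kan extension. -/
noncomputable def rigidIsColimit (S : CSet) :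
    IsColimit ((Functor.LeftExtension.mk rigid rigidUnit).coconeAt S) :=
  Functor.isPointwiseLeftKanExtensionOfIsLeftKanExtension rigid rigidUnit S

lemma point_eq_yoneda_map {m : ℕ} (v : (cube m).Vertex) :
    point v = yoneda.map (show (⟨0⟩ : Cube) ⟶ ⟨m⟩ from v) := by
  apply yonedaEquiv.injective
  refine (yonedaEquiv.apply_symm_apply v).trans ?_
  exact (Category.id_comp _).symm

/-- Naturality of the unit at `v : □^0 → □^m`, as `vertexObj` is defined through `□^0`. -/
lemma onObj_rigidUnit {m : ℕ} (v : (cube m).Vertex) :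
    SCat.onObj (rigidUnit.app ⟨m⟩) v = vertexObj v := by
  have h := rigidUnit.naturality (show (⟨0⟩ : Cube) ⟶ ⟨m⟩ from v)
  have h' := congrArg (fun G : cubePath.obj ⟨0⟩ ⟶ rigid.obj (cube m) =>
    SCat.onObj G (𝟙 (⟨0⟩ : Cube))) h
  refine Eq.trans ?_ (h'.trans ?_)
  · exact congrArg (SCat.onObj (rigidUnit.app ⟨m⟩)) (Category.id_comp v).symm
  · rw [vertexObj, point_eq_yoneda_map]
    rfl

lemma vertexObj_surjective {S : CSet} (x : rigid.obj S) : ∃ a : S.Vertex, vertexObj a = x := by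
  obtain ⟨j, y, hy⟩ := SCat.exists_onObj_of_isColimit (rigidIsColimit S) x
  refine ⟨j.hom.app _ y, ?_⟩
  rw [← hy]
  exact (onObj_vertexObj j.hom y).symm.trans
    (congrArg (SCat.onObj (rigid.map j.hom)) (onObj_rigidUnit (m := j.left.dim) y).symm)

lemma rigidUnit_comparison (m : Cube) :
    rigidUnit.app m ≫ comparison.app (yoneda.obj m) = 𝟙 _ :=
  rigid.descOfIsLeftKanExtension_fac_app rigidUnit _ (𝟙 cubePath) m

/-- Naturality at `point a` reduces this to `□^0`, where the comparison undoes the unit. -/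
lemma onObj_comparison {S : CSet} (a : S.Vertex) :
    SCat.onObj (comparison.app S) (vertexObj a) = a := by
  have h := comparison.naturality (point a)
  have h' := congrArg (fun G : rigid.obj (cube 0) ⟶ _ =>
    SCat.onObj G (SCat.onObj (rigidUnit.app ⟨0⟩) (𝟙 (⟨0⟩ : Cube)))) h
  refine h'.trans (Eq.trans ?_ (point_eq a))
  have h'' := congrArg (fun G : cubePath.obj ⟨0⟩ ⟶ _ => SCat.onObj G (𝟙 (⟨0⟩ : Cube)))
    (rigidUnit_comparison ⟨0⟩)
  exact congrArg (SCat.onObj ((pathCat ⋙ ProsetCat.nerveFunctor).map (point a))) h''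

lemma vertexObj_injective {S : CSet} {a b : S.Vertex} (h : vertexObj a = vertexObj b) : a = b := by
  have := congrArg (SCat.onObj (comparison.app S)) h
  exact (onObj_comparison a).symm.trans (this.trans (onObj_comparison b))

/-- The `n`-simplices of the mapping spaces of the rigidification. -/
noncomputable def simplexCat (n : SimplexCategoryᵒᵖ) : VertexCat where
  Hom S a b := ((rigid.obj S).Map (vertexObj a) (vertexObj b)).obj n
  one a := SCat.one n (vertexObj a)
  mul f g := SCat.mul f g
  map f a b h := SCat.tr (onObj_vertexObj f a) (onObj_vertexObj f b)
    ((SCat.onMap (rigid.map f) _ _).app n h)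
  one_mul h := SCat.one_mul h
  mul_one h := SCat.mul_one h
  mul_assoc h k l := SCat.mul_assoc h k l
  map_one f a := by rw [SCat.onMap_one, SCat.tr_one]
  map_mul f a b c h k := by rw [SCat.onMap_mul, SCat.tr_mul]
  map_id {S} a b h := SCat.onMap_congr (rigid.map_id S) h
  map_comp f g a b h := by
    have := SCat.onMap_congr (rigid.map_comp f g) h
    rw [SCat.onMap_comp] at this
    rw [SCat.onMap_tr, SCat.tr_tr, ← this]
    exact (SCat.tr_tr _ _ _ _ _).symm

variable {n : SimplexCategoryᵒᵖ} {S T : CSet} {a b c : S.Vertex}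

/-- The leg of the colimit at `x` is the unit of the cube followed by `rigid.map x`, so its
simplices are images under `x` of simplices over the cube. -/
lemma generated_of_cube {m : ℕ} (x : cube m ⟶ S) (u v : (cube m).Vertex)
    (f : ((cubePath.obj ⟨m⟩).Map u v).obj n)
    (ha : SCat.onObj (rigidUnit.app ⟨m⟩ ≫ rigid.map x) u = vertexObj a)
    (hb : SCat.onObj (rigidUnit.app ⟨m⟩ ≫ rigid.map x) v = vertexObj b) :
    (simplexCat n).Generated (S := S) (a := a) (b := b)
      (SCat.tr ha hb ((SCat.onMap (rigidUnit.app ⟨m⟩ ≫ rigid.map x) u v).app n f)) := by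
  have h : ∀ w : (cube m).Vertex, SCat.onObj (rigidUnit.app ⟨m⟩ ≫ rigid.map x) w =
      vertexObj (x.app _ w) := fun w =>
    (congrArg (SCat.onObj (rigid.map x)) (onObj_rigidUnit w)).trans (onObj_vertexObj x w)
  obtain rfl := vertexObj_injective (ha.symm.trans (h u))
  obtain rfl := vertexObj_injective (hb.symm.trans (h v))
  let f' : (simplexCat n).Hom (cube m) u v :=
    SCat.tr (onObj_rigidUnit u) (onObj_rigidUnit v) ((SCat.onMap (rigidUnit.app ⟨m⟩) u v).app n f)
  have hf' : (simplexCat n).map x f' =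
      SCat.tr ha hb ((SCat.onMap (rigidUnit.app ⟨m⟩ ≫ rigid.map x) u v).app n f) :=
    (congrArg (SCat.tr _ _) (SCat.onMap_tr (rigid.map x) (onObj_rigidUnit u)
      (onObj_rigidUnit v) _)).trans (SCat.tr_tr _ _ _ _ _)
  exact hf' ▸ VertexCat.Generated.cube x f'

lemma simplex_generated (σ : (simplexCat n).Hom S a b) : (simplexCat n).Generated σ := by
  refine SCat.induction_of_isColimit (n := n) (x := vertexObj a) (y := vertexObj b) (rigidIsColimit S)
    -- Objects of the colimit are not literally of the form `vertexObj a`, so the motive ranges over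
    -- all such descriptions of the end points.
    (motive := fun {x y : rigid.obj S} (f : ((rigid.obj S).Map x y).obj n) =>
      ∀ (a b : S.Vertex) (hx : x = vertexObj a) (hy : y = vertexObj b),
        (simplexCat n).Generated (S := S) (a := a) (b := b) (SCat.tr hx hy f))
    (fun j x y f a b hx hy => generated_of_cube (m := j.left.dim) j.hom x y f hx hy)
    (fun x a b hx hy => by
      obtain rfl := vertexObj_injective (hx.symm.trans hy)
      have : SCat.tr hx hy (SCat.one n x) = SCat.one n (vertexObj a) := SCat.tr_one hx
      exact this ▸ VertexCat.Generated.one a)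
    (fun {x y z} f g hf hg a b hx hz => by
      obtain ⟨c, hc⟩ := vertexObj_surjective y
      have : SCat.tr hx hz (SCat.mul f g) = SCat.mul (SCat.tr hx hc.symm f) (SCat.tr hc.symm hz g) :=
        SCat.tr_mul hx hc.symm hz f g
      exact this ▸ VertexCat.Generated.mul (H := simplexCat n) (hf a c hx hc.symm)
        (hg c b hc.symm hz)) σ a b rfl rfl

/-! ### From simplices of the rigidification to monotone families of paths -/

/-- The simplex of paths attached to a simplex of the rigidification. -/
noncomputable def comparisonSimplex (σ : (simplexCat n).Hom S a b) : (nerve (CPath S a b)).obj n :=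
  SCat.tr (C := ProsetCat.nerveObj (pathObj S)) (onObj_comparison a) (onObj_comparison b)
    ((SCat.onMap (comparison.app S) _ _).app n σ)

/-- The `i`-th path of the simplex of paths attached to a simplex of the rigidification. -/
noncomputable def simplexPath (σ : (simplexCat n).Hom S a b) (i : Fin (n.unop.len + 1)) :
    CPath S a b :=
  Functor.obj (comparisonSimplex σ) i

lemma simplexPath_one (a : S.Vertex) (i : Fin (n.unop.len + 1)) :
    simplexPath ((simplexCat n).one a) i = CPath.refl a := by
  have : comparisonSimplex ((simplexCat n).one a) =
      SCat.one (C := ProsetCat.nerveObj (pathObj S)) n a := by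
    refine (congrArg (SCat.tr _ _) (SCat.onMap_one (comparison.app S) (vertexObj a))).trans ?_
    exact SCat.tr_one _
  exact congrArg (fun F : (nerve (CPath S a a)).obj n => Functor.obj F i) this

lemma simplexPath_mul (σ : (simplexCat n).Hom S a b) (τ : (simplexCat n).Hom S b c)
    (i : Fin (n.unop.len + 1)) :
    simplexPath ((simplexCat n).mul σ τ) i = CPath.comp (simplexPath σ i) (simplexPath τ i) := by
  have : comparisonSimplex ((simplexCat n).mul σ τ) =
      SCat.mul (C := ProsetCat.nerveObj (pathObj S)) (comparisonSimplex σ)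
        (comparisonSimplex τ) := by
    refine (congrArg (SCat.tr _ _) (SCat.onMap_mul (comparison.app S) σ τ)).trans ?_
    exact SCat.tr_mul _ _ _ _ _
  exact congrArg (fun F : (nerve (CPath S a c)).obj n => Functor.obj F i) this

lemma simplexPath_map (f : S ⟶ T) (σ : (simplexCat n).Hom S a b) (i : Fin (n.unop.len + 1)) :
    simplexPath ((simplexCat n).map f σ) i = CPath.map f (simplexPath σ i) := by
  have h := SCat.onMap_congr (comparison.naturality f) σ
  let N : ProsetCat.nerveObj (pathObj S) ⟶ ProsetCat.nerveObj (pathObj T) :=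
    (pathCat ⋙ ProsetCat.nerveFunctor).map f
  have : comparisonSimplex ((simplexCat n).map f σ) =
      (SCat.onMap N a b).app n (comparisonSimplex σ) := by
    refine (congrArg (SCat.tr _ _) (SCat.onMap_tr (comparison.app T) _ _ _)).trans ?_
    refine Eq.trans ?_ (SCat.onMap_tr N (onObj_comparison a) (onObj_comparison b) _).symm
    refine Eq.trans ?_ (congrArg (SCat.tr _ _) h)
    refine (SCat.tr_tr _ _ _ _ _).trans (Eq.trans ?_ (SCat.tr_tr _ _ _ _ _).symm)
    rfl
  exact congrArg (fun F : (nerve (CPath T _ _)).obj n => Functor.obj F i) this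

lemma simplexPath_cast {a' b' : S.Vertex} (ha : a = a') (hb : b = b')
    (σ : (simplexCat n).Hom S a b) (i : Fin (n.unop.len + 1)) :
    simplexPath ((simplexCat n).cast ha hb σ) i =
      CPath.vertexCat.cast ha hb (simplexPath σ i) := by
  subst ha hb; rfl

lemma simplexPath_cross {X Y : CSet2} {a : X.carrier.Vertex} {b : Y.carrier.Vertex}
    (σ : (simplexCat n).Hom X.carrier a X.tgt) (τ : (simplexCat n).Hom Y.carrier Y.src b)
    (i : Fin (n.unop.len + 1)) :
    simplexPath ((simplexCat n).cross σ τ) i =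
      CPath.vertexCat.cross (simplexPath σ i) (simplexPath τ i) := by
  refine (simplexPath_mul _ _ i).trans (congrArg₂ CPath.comp (simplexPath_map _ _ i) ?_)
  refine (simplexPath_cast _ _ _ i).trans (congrArg _ (simplexPath_map _ _ i))

/-- The comparison functor is bijective on mapping spaces. -/
structure ComparisonBijective (S : CSet) : Prop where
  injective : ∀ {n : SimplexCategoryᵒᵖ} {a b : S.Vertex} {σ τ : (simplexCat n).Hom S a b},
    (∀ i, simplexPath σ i = simplexPath τ i) → σ = τ
  surjective : ∀ {n : SimplexCategoryᵒᵖ} {a b : S.Vertex} (p : Fin (n.unop.len + 1) → CPath S a b),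
    Monotone p → ∃ σ : (simplexCat n).Hom S a b, ∀ i, simplexPath σ i = p i

lemma comparisonSimplex_ext {σ τ : (simplexCat n).Hom S a b}
    (h : ∀ i, simplexPath σ i = simplexPath τ i) : comparisonSimplex σ = comparisonSimplex τ :=
  ProsetCat.nerve_ext h

lemma comparisonBijective_of_isIso (S : CSet) [IsIso (comparison.app S)] :
    ComparisonBijective S where
  injective h := by
    have h' := comparisonSimplex_ext h
    exact SCat.onMap_injective_of_isIso (comparison.app S) ((SCat.tr_bijective _ _).1 h')
  surjective {n a b} p hp := by
    let F : (nerve (CPath S a b)).obj n := hp.functor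
    obtain ⟨G, hG⟩ := (SCat.tr_bijective (C := ProsetCat.nerveObj (pathObj S)) (n := n)
      (onObj_comparison a) (onObj_comparison b)).2 F
    obtain ⟨σ, hσ⟩ := SCat.onMap_surjective_of_isIso (comparison.app S) G
    refine ⟨σ, fun i => ?_⟩
    have : comparisonSimplex σ = F := (congrArg (SCat.tr _ _) hσ).trans hG
    exact congrArg (fun F : (nerve (CPath S a b)).obj n => Functor.obj F i) this

lemma ComparisonBijective.comparisonSimplex_bijective (h : ComparisonBijective S) :
    Function.Bijective (comparisonSimplex : (simplexCat n).Hom S a b → _) := by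
  refine ⟨fun σ τ h' => h.injective (fun i => ?_), fun F => ?_⟩
  · exact congrArg (fun F : (nerve (CPath S a b)).obj n => Functor.obj F i) h'
  · obtain ⟨σ, hσ⟩ := h.surjective (fun i => Functor.obj F i)
      (fun _ _ hij => (CategoryTheory.Functor.map F (homOfLE hij)).le)
    exact ⟨σ, ProsetCat.nerve_ext hσ⟩

/-- On objects the comparison is always bijective, with inverse `vertexObj`; only mapping spaces
need the hypothesis. -/
lemma ComparisonBijective.isIso {S : CSet} (h : ComparisonBijective S) :
    IsIso (comparison.app S) := by
  refine SCat.isIso_of_bijective _ ⟨fun x y hxy => ?_, fun a => ⟨vertexObj a, onObj_comparison a⟩⟩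
    (fun n x y => ?_)
  · obtain ⟨a, rfl⟩ := vertexObj_surjective x
    obtain ⟨b, rfl⟩ := vertexObj_surjective y
    exact congrArg vertexObj ((onObj_comparison a).symm.trans (hxy.trans (onObj_comparison b)))
  · obtain ⟨a, rfl⟩ := vertexObj_surjective x
    obtain ⟨b, rfl⟩ := vertexObj_surjective y
    exact (Function.Bijective.of_comp_iff' (SCat.tr_bijective
      (C := ProsetCat.nerveObj (pathObj S)) (onObj_comparison a) (onObj_comparison b)) _).1
      h.comparisonSimplex_bijective

end CSet

/-! ### Necklaces -/

namespace CSet2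

open CSet

/-- The properties of necklaces which are inherited by wedges. -/
structure Good (X : CSet2) : Prop where
  bijective : ComparisonBijective X.carrier
  antisymm : ∀ {a b : X.carrier.Vertex} {p q : CPath X.carrier a b}, p ≤ q → q ≤ p → p = q
  final : CPath.vertexCat.FinalTgt X
  initial : CPath.vertexCat.InitialSrc X

/-- The unit of a pointwise Kan extension along a fully faithful functor is invertible, and followed
by the comparison it gives the identity. -/
lemma isIso_comparison_cube (n : ℕ) : IsIso (comparison.app (CSet.cube n)) := by
  have h : IsIso rigidUnit :=
    (Functor.isPointwiseLeftKanExtensionOfIsLeftKanExtension rigid rigidUnit).isIso_hom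
  have h' : IsIso (rigidUnit.app ⟨n⟩) := inferInstance
  have h'' : IsIso (rigidUnit.app ⟨n⟩ ≫ comparison.app (yoneda.obj ⟨n⟩)) := by
    have : rigidUnit.app ⟨n⟩ ≫ comparison.app (yoneda.obj ⟨n⟩) = 𝟙 (cubePath.obj ⟨n⟩) :=
      rigidUnit_comparison ⟨n⟩
    exact this ▸ IsIso.id _
  exact IsIso.of_isIso_comp_left (rigidUnit.app ⟨n⟩) _

/-- Coordinates increase along paths, so a path out of the greatest vertex or into the least one is
a loop, hence trivial. -/
lemma good_cube (n : ℕ) : Good (cube n) where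
  bijective :=
    have : IsIso (comparison.app (cube n).carrier) := isIso_comparison_cube n
    comparisonBijective_of_isIso _
  antisymm h h' := CPath.cube_antisymm h h'
  final :=
    { eq := fun p => CSet.coord_injective
        (le_antisymm (fun _ => Bool.le_true _) (CPath.coord_le p))
      eq_one := fun p => CPath.loop_eq_refl p }
  initial :=
    { eq := fun p => CSet.coord_injective
        (le_antisymm (CPath.coord_le p) (fun _ => Bool.false_le _))
      eq_one := fun p => CPath.loop_eq_refl p }

namespace Good

variable {X Y : CSet2} {n : SimplexCategoryᵒᵖ}

/-- Passes from paths to simplices: every simplex has a 0-th path, and it is determined by its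
paths. -/
lemma finalTgt (hX : Good X) : (simplexCat n).FinalTgt X where
  eq σ := hX.final.eq (simplexPath σ 0)
  eq_one σ := hX.bijective.injective (fun i =>
    (hX.final.eq_one (simplexPath σ i)).trans (simplexPath_one _ i).symm)

lemma initialSrc (hX : Good X) : (simplexCat n).InitialSrc X where
  eq σ := hX.initial.eq (simplexPath σ 0)
  eq_one σ := hX.bijective.injective (fun i =>
    (hX.initial.eq_one (simplexPath σ i)).trans (simplexPath_one _ i).symm)

/-! ### Stability under wedges -/

section wedge

variable {u v : (wedge X Y).carrier.Vertex}

lemma normal_path (hX : Good X) (hY : Good Y)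
    (p : CPath.vertexCat.Hom (wedge X Y).carrier u v) : CPath.vertexCat.Normal p :=
  VertexCat.normal_of_generated hX.final hY.initial (CPath.generated p)

lemma normal_simplex (hX : Good X) (hY : Good Y) (σ : (simplexCat n).Hom (wedge X Y).carrier u v) :
    (simplexCat n).Normal σ :=
  VertexCat.normal_of_generated hX.finalTgt hY.initialSrc (simplex_generated σ)

/-- The missing combination, from `Y` to `X`, occurs only at the junction, which also lies in `X`.
-/
lemma endpoints (hX : Good X) (hY : Good Y) (p : CPath (wedge X Y).carrier u v) :
    (∃ a a', (inl X Y).app _ a = u ∧ (inl X Y).app _ a' = v) ∨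
    (∃ b b', (inr X Y).app _ b = u ∧ (inr X Y).app _ b' = v) ∨
    (∃ a b, (inl X Y).app _ a = u ∧ (inr X Y).app _ b = v) := by
  obtain ⟨a, ha⟩ | ⟨b, hb⟩ := VertexCat.exists_inl_or_inr u <;>
  obtain ⟨a', ha'⟩ | ⟨b', hb'⟩ := VertexCat.exists_inl_or_inr v
  · exact Or.inl ⟨a, a', ha, ha'⟩
  · exact Or.inr (Or.inr ⟨a, b', ha, hb'⟩)
  · obtain ⟨rfl, rfl⟩ := (normal_path hX hY p).back b a' hb ha'
    exact Or.inl ⟨X.tgt, X.tgt, (inl_tgt X Y).trans hb, ha'⟩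
  · exact Or.inr (Or.inl ⟨b, b', hb, hb'⟩)

lemma wedge_antisymm (hX : Good X) (hY : Good Y) {p q : CPath (wedge X Y).carrier u v}
    (h : p ≤ q) (h' : q ≤ p) : p = q := by
  have hp := normal_path hX hY p
  have hq := normal_path hX hY q
  obtain ⟨a, a', rfl, rfl⟩ | ⟨b, b', rfl, rfl⟩ | ⟨a, b, rfl, rfl⟩ := endpoints hX hY p
  · obtain ⟨p, rfl⟩ := hp.left a a' rfl rfl
    obtain ⟨q, rfl⟩ := hq.left a a' rfl rfl
    exact congrArg (CPath.vertexCat.map (inl X Y)) (hX.antisymm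
      ((CPath.map_le_map_iff (inl_collapseRight X Y)).1 h)
      ((CPath.map_le_map_iff (inl_collapseRight X Y)).1 h'))
  · obtain ⟨p, rfl⟩ := hp.right b b' rfl rfl
    obtain ⟨q, rfl⟩ := hq.right b b' rfl rfl
    exact congrArg (CPath.vertexCat.map (inr X Y)) (hY.antisymm
      ((CPath.map_le_map_iff (inr_collapseLeft X Y)).1 h)
      ((CPath.map_le_map_iff (inr_collapseLeft X Y)).1 h'))
  · obtain ⟨p, r, rfl⟩ := hp.cross a b rfl rfl
    obtain ⟨q, s, rfl⟩ := hq.cross a b rfl rfl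
    have h₁ := CPath.cross_le_cross_iff.1 h
    have h₂ := CPath.cross_le_cross_iff.1 h'
    have e₁ : p = q := hX.antisymm h₁.1 h₂.1
    have e₂ : r = s := hY.antisymm h₁.2 h₂.2
    rw [e₁, e₂]

/-- Uniqueness is known for paths; it reaches simplices through the injectivity of the comparison
for each factor. -/
lemma cross_simplex_injective (hX : Good X) (hY : Good Y) {a : X.carrier.Vertex}
    {b : Y.carrier.Vertex} {σ σ' : (simplexCat n).Hom X.carrier a X.tgt}
    {τ τ' : (simplexCat n).Hom Y.carrier Y.src b}
    (h : ∀ i, simplexPath ((simplexCat n).cross σ τ) i =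
      simplexPath ((simplexCat n).cross σ' τ') i) : σ = σ' ∧ τ = τ' := by
  simp only [simplexPath_cross] at h
  exact ⟨hX.bijective.injective (fun i => (CPath.cross_injective (h i)).1),
    hY.bijective.injective (fun i => (CPath.cross_injective (h i)).2)⟩

lemma wedge_injective (hX : Good X) (hY : Good Y) {σ τ : (simplexCat n).Hom (wedge X Y).carrier u v}
    (h : ∀ i, simplexPath σ i = simplexPath τ i) : σ = τ := by
  have hσ := normal_simplex hX hY σ
  have hτ := normal_simplex hX hY τ
  obtain ⟨a, a', rfl, rfl⟩ | ⟨b, b', rfl, rfl⟩ | ⟨a, b, rfl, rfl⟩ :=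
    endpoints hX hY (simplexPath σ 0)
  · obtain ⟨σ, rfl⟩ := hσ.left a a' rfl rfl
    obtain ⟨τ, rfl⟩ := hτ.left a a' rfl rfl
    simp only [VertexCat.cast_rfl, simplexPath_map] at h
    exact congrArg ((simplexCat n).map (inl X Y)) (hX.bijective.injective
      (fun i => CPath.map_injective (inl_collapseRight X Y) (h i)))
  · obtain ⟨σ, rfl⟩ := hσ.right b b' rfl rfl
    obtain ⟨τ, rfl⟩ := hτ.right b b' rfl rfl
    simp only [VertexCat.cast_rfl, simplexPath_map] at h
    exact congrArg ((simplexCat n).map (inr X Y)) (hY.bijective.injective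
      (fun i => CPath.map_injective (inr_collapseLeft X Y) (h i)))
  · obtain ⟨σ, σ', rfl⟩ := hσ.cross a b rfl rfl
    obtain ⟨τ, τ', rfl⟩ := hτ.cross a b rfl rfl
    obtain ⟨rfl, rfl⟩ := cross_simplex_injective hX hY h
    rfl

/-- All `p i` share their end points, hence the type of their normal form. Their components in the
factors are again monotone families; these lift to simplices, whose image or composite in the wedge
lifts `p`. -/
lemma wedge_surjective (hX : Good X) (hY : Good Y)
    (p : Fin (n.unop.len + 1) → CPath (wedge X Y).carrier u v)
    (hp : Monotone p) :
    ∃ σ : (simplexCat n).Hom (wedge X Y).carrier u v, ∀ i, simplexPath σ i = p i := by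
  have hn := fun i => normal_path hX hY (p i)
  obtain ⟨a, a', rfl, rfl⟩ | ⟨b, b', rfl, rfl⟩ | ⟨a, b, rfl, rfl⟩ := endpoints hX hY (p 0)
  · choose q hq using fun i => (hn i).left a a' rfl rfl
    obtain ⟨σ, hσ⟩ := hX.bijective.surjective q (fun i j hij =>
      (CPath.map_le_map_iff (inl_collapseRight X Y)).1 (by
        have := hp hij
        rw [hq i, hq j] at this
        exact this))
    refine ⟨(simplexCat n).map (inl X Y) σ, fun i => ?_⟩
    rw [simplexPath_map, hσ, hq i]
    rfl
  · choose q hq using fun i => (hn i).right b b' rfl rfl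
    obtain ⟨σ, hσ⟩ := hY.bijective.surjective q (fun i j hij =>
      (CPath.map_le_map_iff (inr_collapseLeft X Y)).1 (by
        have := hp hij
        rw [hq i, hq j] at this
        exact this))
    refine ⟨(simplexCat n).map (inr X Y) σ, fun i => ?_⟩
    rw [simplexPath_map, hσ, hq i]
    rfl
  · choose q r hqr using fun i => (hn i).cross a b rfl rfl
    have hm : ∀ {i j}, i ≤ j → _ := fun {i j} hij => CPath.cross_le_cross_iff.1 (by
        have := hp hij
        rw [hqr i, hqr j] at this
        exact this)
    obtain ⟨σ, hσ⟩ := hX.bijective.surjective q (fun i j hij => (hm hij).1)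
    obtain ⟨τ, hτ⟩ := hY.bijective.surjective r (fun i j hij => (hm hij).2)
    refine ⟨(simplexCat n).cross σ τ, fun i => ?_⟩
    rw [simplexPath_cross, hσ, hτ, hqr i]
    rfl

lemma wedge (hX : Good X) (hY : Good Y) : Good (X.wedge Y) where
  bijective := ⟨wedge_injective hX hY, wedge_surjective hX hY⟩
  antisymm := wedge_antisymm hX hY
  final :=
    { eq := fun {v} p => by
        have hp := normal_path hX hY p
        obtain ⟨a, rfl⟩ | ⟨b, rfl⟩ := VertexCat.exists_inl_or_inr v
        · obtain ⟨h, rfl⟩ := hp.back _ a rfl rfl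
          exact (inl_tgt X Y).trans (congrArg ((inr X Y).app _) h.symm)
        · obtain ⟨q, -⟩ := hp.right _ b rfl rfl
          exact congrArg ((inr X Y).app _) (hY.final.eq q)
      eq_one := fun p => by
        obtain ⟨q, rfl⟩ := (normal_path hX hY p).right _ _ rfl rfl
        rw [hY.final.eq_one q]
        exact CPath.map_refl _ _ }
  initial :=
    { eq := fun {v} p => by
        have hp := normal_path hX hY p
        obtain ⟨a, rfl⟩ | ⟨b, rfl⟩ := VertexCat.exists_inl_or_inr v
        · obtain ⟨q, -⟩ := hp.left a _ rfl rfl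
          exact congrArg ((inl X Y).app _) (hX.initial.eq q)
        · obtain ⟨rfl, h⟩ := hp.back b _ rfl rfl
          exact (inl_tgt X Y).symm.trans (congrArg ((inl X Y).app _) h.symm)
      eq_one := fun p => by
        obtain ⟨q, rfl⟩ := (normal_path hX hY p).left _ _ rfl rfl
        rw [hX.initial.eq_one q]
        exact CPath.map_refl _ _ }

end wedge

/-- The comparison is natural, so its invertibility transports along `e`; the other properties are
reflected by the injections on vertices and paths. -/
lemma of_iso (e : X ≅ Y) (hY : Good Y) : Good X := by
  have h : e.hom.hom ≫ e.inv.hom = 𝟙 _ := congrArg Hom.hom e.hom_inv_id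
  have h' : e.inv.hom ≫ e.hom.hom = 𝟙 _ := congrArg Hom.hom e.inv_hom_id
  have hinj : ∀ {a b : X.carrier.Vertex}, e.hom.hom.app _ a = e.hom.hom.app _ b → a = b :=
    fun {a b} hab => (CPath.app_app_of_comp_eq_id h a).symm.trans
      ((congrArg (e.inv.hom.app _) hab).trans (CPath.app_app_of_comp_eq_id h b))
  have hs := e.hom.map_src
  have ht := e.hom.map_tgt
  refine ⟨?_, ?_, ⟨?_, ?_⟩, ⟨?_, ?_⟩⟩
  · have : IsIso (comparison.app Y.carrier) := hY.bijective.isIso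
    have : IsIso (comparison.app X.carrier) :=
      (NatTrans.isIso_app_iff_of_iso comparison ⟨e.hom.hom, e.inv.hom, h, h'⟩).2 this
    exact comparisonBijective_of_isIso _
  · intro a b p q hpq hqp
    exact CPath.map_injective h (hY.antisymm (CPath.map_mono _ hpq) (CPath.map_mono _ hqp))
  · intro a p
    exact hinj ((hY.final.eq (CPath.vertexCat.cast ht rfl (CPath.map e.hom.hom p))).trans ht.symm)
  · intro p
    apply CPath.map_injective h
    have key : ∀ {v : Y.carrier.Vertex}, v = Y.tgt → ∀ q : CPath Y.carrier v v,
        q = CPath.refl v := by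
      rintro _ rfl q
      exact hY.final.eq_one q
    exact (key ht _).trans (CPath.map_refl _ _).symm
  · intro a p
    exact hinj ((hY.initial.eq (CPath.vertexCat.cast rfl hs (CPath.map e.hom.hom p))).trans hs.symm)
  · intro p
    apply CPath.map_injective h
    have key : ∀ {v : Y.carrier.Vertex}, v = Y.src → ∀ q : CPath Y.carrier v v,
        q = CPath.refl v := by
      rintro _ rfl q
      exact hY.initial.eq_one q
    exact (key hs _).trans (CPath.map_refl _ _).symm

end Good

lemma good_necklace : ∀ l : List ℕ, Good (necklace l)
  | [] => good_cube 0
  | n :: l => (good_cube n).wedge (good_necklace l)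

lemma IsNecklace.good {T : CSet2} (hT : T.IsNecklace) : Good T := by
  obtain ⟨l, -, ⟨e⟩⟩ := hT
  exact Good.of_iso e (good_necklace l)

/-! ### Composition in wedges -/

lemma eqToHom_app_eq_tr {C : SCat} {n : SimplexCategoryᵒᵖ} {x x' y y' : C} (hx : x = x')
    (hy : y = y') (e : C.Map x y = C.Map x' y') (f : (C.Map x y).obj n) :
    (eqToHom e).app n f = SCat.tr hx hy f := by
  subst hx hy; rfl

lemma rigidTMap_app {X Y : CSet2} (f : X ⟶ Y) {n : SimplexCategoryᵒᵖ}
    (σ : (simplexCat n).Hom X.carrier X.src X.tgt) :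
    (rigidTMap f).app n σ =
      (simplexCat n).cast f.map_src f.map_tgt ((simplexCat n).map f.hom σ) := by
  have key : ∀ {a a' b b' : Y.carrier.Vertex} (ha : a = a') (hb : b = b')
      (τ : (simplexCat n).Hom Y.carrier a b), (simplexCat n).cast ha hb τ =
        SCat.tr (congrArg vertexObj ha) (congrArg vertexObj hb) τ := by
    rintro a _ b _ rfl rfl τ
    rfl
  refine Eq.trans ?_ (key f.map_src f.map_tgt _).symm
  refine Eq.trans ?_ (SCat.tr_tr _ _ _ _ _).symm
  exact eqToHom_app_eq_tr _ _ _ _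

/-- Identifies the map of the theorem with `cross`; the braiding accounts for the exchange of `τ`
and `σ`. -/
lemma compMap_app (U V : CSet2) {n : SimplexCategoryᵒᵖ}
    (τ : (simplexCat n).Hom V.carrier V.src V.tgt) (σ : (simplexCat n).Hom U.carrier U.src U.tgt) :
    (compMap U V).app n (SCat.pr (A := rigidT V) (B := rigidT U) τ σ) =
      (simplexCat n).cross σ τ :=
  congrArg₂ (fun s t => SCat.mul (C := rigid.obj (wedge U V).carrier) s t)
    (rigidTMap_app (Y := ⟨(wedge U V).carrier, (wedge U V).src, mid U V⟩) ⟨inl U V, rfl, rfl⟩ σ)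
    (rigidTMap_app (Y := ⟨(wedge U V).carrier, mid U V, (wedge U V).tgt⟩)
      ⟨inr U V, (inl_tgt U V).symm, rfl⟩ τ)

/-- Existence and uniqueness of the normal form of a simplex from the first point of `U` to the last
point of `V`. -/
lemma isIso_compMap {U V : CSet2} (hU : Good U) (hV : Good V) : IsIso (compMap U V) := by
  rw [NatTrans.isIso_iff_isIso_app]
  intro n
  rw [isIso_iff_bijective]
  constructor
  · rintro ⟨τ, σ⟩ ⟨τ', σ'⟩ h
    have h' := (compMap_app U V τ σ).symm.trans (h.trans (compMap_app U V τ' σ'))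
    have hh := Good.cross_simplex_injective (n := n) hU hV (σ := σ) (σ' := σ') (τ := τ) (τ' := τ')
      (fun i => congrArg (fun s => simplexPath s i) h')
    exact Prod.ext hh.2 hh.1
  · intro ρ
    obtain ⟨σ, τ, h⟩ := (Good.normal_simplex (n := n) hU hV ρ).cross U.src V.tgt rfl rfl
    exact ⟨SCat.pr (A := rigidT V) (B := rigidT U) τ σ, (compMap_app U V τ σ).trans h.symm⟩

end CSet2

/-! ### Contractibility -/

namespace SSet

open Simplicial

/-- A simplicial homotopy, given by its defining equations. -/
lemma nonempty_homotopy {X Y : SSet.{0}} {f g : X ⟶ Y} (h : X ⊗ Δ[1] ⟶ Y)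
    (h₀ : ι₀ ≫ h = f) (h₁ : ι₁ ≫ h = g) : Nonempty (Homotopy f g) :=
  ⟨{ h := h
     h₀ := h₀
     h₁ := h₁
     -- The homotopy is relative to the empty subcomplex, so `hx` is absurd.
     rel := by
      ext n ⟨⟨x, hx⟩, s⟩
      exact hx.elim }⟩

lemma contractible_of_iso {X Y : SSet.{0}} (e : X ≅ Y) (hY : SSetContractible Y) :
    SSetContractible X := by
  obtain ⟨y, ⟨H⟩⟩ := hY
  refine ⟨e.inv.app _ y, nonempty_homotopy (e.hom ▷ Δ[1] ≫ H.h ≫ e.inv) ?_ ?_⟩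
  · have : ι₀ ≫ e.hom ▷ Δ[1] ≫ H.h ≫ e.inv = e.hom ≫ (ι₀ ≫ H.h) ≫ e.inv := rfl
    rw [this, Homotopy.h₀]
    ext n x
    exact NatTrans.naturality_apply e.inv _ y
  · have : ι₁ ≫ e.hom ▷ Δ[1] ≫ H.h ≫ e.inv = e.hom ≫ (ι₁ ≫ H.h) ≫ e.inv := rfl
    rw [this, Homotopy.h₁, Category.id_comp, Iso.hom_inv_id]

/-- The function obtained from `f` by replacing by `a` its values on the part lying over the
initial vertex of the interval. -/
def truncate {ι A : Type} (a : A) (s : ι → Fin 2) (f : ι → A) (i : ι) : A :=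
  if s i = 0 then a else f i

/-- The indices lying over 0 form a lower set, on which the values become the least element. -/
lemma truncate_monotone {ι A : Type} [Preorder ι] [Preorder A] {a : A} (ha : ∀ x, a ≤ x)
    {s : ι → Fin 2} (hs : Monotone s) {f : ι → A} (hf : Monotone f) :
    Monotone (truncate a s f) := by
  intro i j hij
  unfold truncate
  split_ifs with h h'
  · exact le_rfl
  · exact ha _
  · exact absurd (le_antisymm ((hs hij).trans_eq (by assumption)) (Fin.zero_le _)) h
  · exact hf hij

variable {A : Type} [Preorder A] {a : A}

/-- The contraction of the nerve of a preorder onto a least element. -/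
def nerveContraction (ha : ∀ x, a ≤ x) : nerve A ⊗ Δ[1] ⟶ nerve A where
  app n := ↾(fun p =>
    (truncate_monotone ha (stdSimplex.objEquiv (n := ⦋1⦌) (m := n) p.2).toOrderHom.monotone
      (f := fun i => Functor.obj (p.1 : (nerve A).obj n) i)
      (fun _ _ hij => (CategoryTheory.Functor.map p.1 (homOfLE hij)).le)).functor)
  naturality n m θ := by
    refine ConcreteCategory.hom_ext _ _ (fun p => ?_)
    exact ProsetCat.nerve_ext (A := A) (fun i => rfl)

/-- Over the end 0 of the interval every value is replaced by `a`, over the end 1 none is. -/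
lemma nerve_contractible (ha : ∀ x, a ≤ x) : SSetContractible (nerve A) := by
  refine ⟨(Functor.const _).obj a, nonempty_homotopy (nerveContraction ha) ?_ ?_⟩
  · refine NatTrans.ext (funext fun n => ConcreteCategory.hom_ext _ _ (fun F => ?_))
    exact ProsetCat.nerve_ext (A := A) (fun i => rfl)
  · refine NatTrans.ext (funext fun n => ConcreteCategory.hom_ext _ _ (fun F => ?_))
    exact ProsetCat.nerve_ext (A := A) (fun i => rfl)

end SSet

namespace CSet

variable {S : CSet} {a b : S.Vertex}

/-- The comparison map on mapping spaces. -/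
noncomputable def comparisonMap (S : CSet) (a b : S.Vertex) :
    rigidMap S a b ⟶ nerve (CPath S a b) where
  app n := ↾(fun σ => comparisonSimplex (n := n) σ)
  naturality n m θ := by
    refine ConcreteCategory.hom_ext _ _ (fun σ => ?_)
    refine (congrArg (SCat.tr (C := ProsetCat.nerveObj (pathObj S)) (onObj_comparison a)
      (onObj_comparison b))
      (NatTrans.naturality_apply (SCat.onMap (comparison.app S) _ _) θ σ)).trans ?_
    exact (SCat.tr_map (C := ProsetCat.nerveObj (pathObj S)) θ _ _ _).symm

lemma isIso_comparisonMap (h : ComparisonBijective S) : IsIso (comparisonMap S a b) := by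
  rw [NatTrans.isIso_iff_isIso_app]
  intro n
  rw [isIso_iff_bijective]
  exact h.comparisonSimplex_bijective

lemma rigidMap_contractible (h : ComparisonBijective S) {p₀ : CPath S a b}
    (hp₀ : ∀ p, p₀ ≤ p) : SSetContractible (rigidMap S a b) :=
  have := isIso_comparisonMap (a := a) (b := b) h
  SSet.contractible_of_iso (asIso (comparisonMap S a b)) (SSet.nerve_contractible hp₀)

end CSet

namespace CSet2

lemma coord_le_coord {n : ℕ} {a b : (cube n).carrier.Vertex} (h : CubeLE n a b) :
    CSet.coord a ≤ CSet.coord b :=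
  fun i => h _ i

lemma cubeLE_src {n : ℕ} (b : (cube n).carrier.Vertex) : CubeLE n (cube n).src b :=
  fun _ _ => Bool.false_le _

/-- Needed to continue from the junction to a vertex of a later cube. -/
lemma necklaceLE_src : ∀ (l : List ℕ) (b : (necklace l).carrier.Vertex),
    NecklaceLE l (necklace l).src b
  | [], b => cubeLE_src b
  | n :: l, b => by
    obtain ⟨b, rfl⟩ | ⟨b, rfl⟩ := VertexCat.exists_inl_or_inr (X := cube n) (Y := necklace l) b
    · exact WedgeLE.left (cubeLE_src b)
    · exact WedgeLE.cross _ b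

/-- By normal forms, the paths in question are those of the first cube, those of the remaining
necklace, or pairs of such with the product order, where the pair of least paths is least. -/
lemma exists_least_necklace : ∀ (l : List ℕ) (a b : (necklace l).carrier.Vertex),
    NecklaceLE l a b → ∃ p₀ : CPath (necklace l).carrier a b, ∀ p, p₀ ≤ p
  | [], a, b, h => CPath.exists_least_cube a b (coord_le_coord h)
  | n :: l, _, _, h => by
    have hX := good_cube n
    have hY := good_necklace l
    cases h with
    | @left a b h =>
      obtain ⟨p₀, hp₀⟩ := CPath.exists_least_cube a b (coord_le_coord h)
      refine ⟨CPath.map (inl _ _) p₀, fun p => ?_⟩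
      obtain ⟨q, rfl⟩ := (hX.normal_path hY p).left a b rfl rfl
      exact CPath.map_mono _ (hp₀ q)
    | @right a b h =>
      obtain ⟨p₀, hp₀⟩ := exists_least_necklace l a b h
      refine ⟨CPath.map (inr _ _) p₀, fun p => ?_⟩
      obtain ⟨q, rfl⟩ := (hX.normal_path hY p).right a b rfl rfl
      exact CPath.map_mono _ (hp₀ q)
    | cross a b =>
      obtain ⟨p₀, hp₀⟩ := CPath.exists_least_cube a (cube n).tgt (fun _ => Bool.le_true _)
      obtain ⟨q₀, hq₀⟩ := exists_least_necklace l _ b (necklaceLE_src l b)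
      refine ⟨CPath.vertexCat.cross p₀ q₀, fun p => ?_⟩
      obtain ⟨q, r, rfl⟩ := (hX.normal_path hY p).cross a b rfl rfl
      exact CPath.cross_le_cross_iff.2 ⟨hp₀ q, hq₀ r⟩

/-- A least path is carried back along the isomorphism that witnesses the order. -/
lemma exists_least_of_vertexLE {T : CSet2} {a b : T.carrier.Vertex} (h : T.VertexLE a b) :
    ∃ p₀ : CPath T.carrier a b, ∀ p, p₀ ≤ p := by
  obtain ⟨l, -, e, h⟩ := h
  obtain ⟨q₀, hq₀⟩ := exists_least_necklace l _ _ h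
  have he : e.hom.hom ≫ e.inv.hom = 𝟙 _ := congrArg Hom.hom e.hom_inv_id
  have ha := CPath.app_app_of_comp_eq_id he a
  have hb := CPath.app_app_of_comp_eq_id he b
  refine ⟨CPath.vertexCat.cast ha hb (CPath.map e.inv.hom q₀), fun p => ?_⟩
  rw [← CPath.vertexCat.cast_map_map_of_id he ha hb p]
  exact (CPath.cast_le_cast _ _).2 (CPath.map_mono _ (hq₀ _))

lemma IsNecklace.vertexLE_src_tgt {T : CSet2} (hT : T.IsNecklace) : T.VertexLE T.src T.tgt := by
  obtain ⟨l, hl, ⟨e⟩⟩ := hT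
  refine ⟨l, hl, e, ?_⟩
  rw [e.hom.map_src]
  exact necklaceLE_src l _

lemma IsNecklace.contractible {T : CSet2} (hT : T.IsNecklace) {a b : T.carrier.Vertex}
    (h : T.VertexLE a b) : SSetContractible (CSet.rigidMap T.carrier a b) :=
  have ⟨_, hp₀⟩ := exists_least_of_vertexLE h
  CSet.rigidMap_contractible hT.good.bijective hp₀

end CSet2

theorem mainTheorem6 :
    (∀ T : CSet2, T.IsNecklace →
      (CSet.pathCat.obj T.carrier).IsPosetCat ∧ IsIso (CSet.comparison.app T.carrier)) ∧
    (∀ U V : CSet2, U.IsNecklace → V.IsNecklace → IsIso (CSet2.compMap U V)) ∧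
    (∀ T : CSet2, T.IsNecklace →
      (∀ a b : T.carrier.Vertex, T.VertexLE a b →
        SSetContractible (CSet.rigidMap T.carrier a b)) ∧
      SSetContractible T.rigidT) :=
  ⟨fun _ hT => ⟨fun _ _ _ _ h h' => hT.good.antisymm h h', hT.good.bijective.isIso⟩,
    fun _ _ hU hV => isIso_compMap hU.good hV.good,
    fun _ hT => ⟨fun _ _ h => hT.contractible h, hT.contractible hT.vertexLE_src_tgt⟩⟩
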